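/- Let $\xi(s)=\frac12 s(s-1)\pi^{-s/2}\Gamma(s/2)\zeta(s)$ be the Riemann xi-function and let $\theta>1$ be a real number. Then there is a function $K_\theta$ on $\mathbb{R}$ satisfying $$\exp\Bigl(-2\theta\,\frac{\xi'}{\xi}(s)\Bigr)=\int_{-\infty}^{\infty}K_\theta(x)\,e^{izx}\,dx,\qquad s=\tfrac12-iz, \tag{1}$$ for $\Im z>1/2$, the integral being absolutely convergent; any function that satisfies (1), with an absolutely convergent integral, on some horizontal line $\Im z=c$ with $c>1/2$ is almost everywhere equal to $K_\theta$. Moreover, $K_\theta$ has the following properties. (K-ii) $K_\theta$ is a real-valued continuous function on $\mathbb{R}$, $K_\theta(x)\ll \exp(x/2)$ as $x\to+\infty$, and (1) holds for all $z$ with $\Im z>1/2$. (K-iii) $K_\theta(x)=0$ for $x<0$. (K-iv) $K_\theta$ is continuously differentiable on $\mathbb{R}\setminus\{\log n : n\in\mathbb{N},\ n\ge 1\}$, and $|K_\theta'(x)|$ is locally integrable on $\mathbb{R}$. (K-v) There exists $0<\tau\le\infty$ such that $\det(1\pm\mathsf{K}_\theta[t])\neq 0$ for all $0\le t<\tau$.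 Here $\mathsf{K}_\theta[t]$ is the (bounded) operator on $L^2(-\infty,t)$ given by $$(\mathsf{K}_\theta[t]f)(x)=\mathbf{1}_{(-\infty,t]}(x)\int_{-\infty}^{t}K_\theta(x+y)f(y)\,dy,$$ and $\det$ is the Fredholm determinant: for an integral operator $A$ on $L^2(-\infty,t)$ with continuous kernel $k$, $\det(1+A)=\sum_{n\ge0}\frac1{n!}\int_{(-\infty,t]^n}\det\bigl(k(x_i,x_j)\bigr)_{i,j=1}^{n}\,dx_1\cdots dx_n$. -/

import Mathlib

open MeasureTheory Set Filter Asymptotics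

/-- The Riemann xi-function, as an entire function. Since
`completedRiemannZeta s = completedRiemannZeta₀ s - 1 / s - 1 / (1 - s)`, this is the entire extension
of `s (s - 1) π^(-s/2) Γ(s/2) ζ(s) / 2`, see `riemannXi_eq`. -/
noncomputable def riemannXi (s : ℂ) : ℂ :=
  (s * (s - 1) * completedRiemannZeta₀ s + 1) / 2

/-- Away from the points where a factor has a pole, `riemannXi` is given by the usual product. -/
theorem riemannXi_eq {s : ℂ} (h1 : s ≠ 1) (hG : ∀ n : ℕ, s ≠ -(2 * n)) :
    riemannXi s =
      s * (s - 1) / 2 * (Real.pi : ℂ) ^ (-s / 2) * Complex.Gamma (s / 2) * riemannZeta s := by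
  have h0 : s ≠ 0 := by simpa using hG 0
  have hne : Complex.Gammaℝ s ≠ 0 := by
    rw [Ne, Complex.Gammaℝ_eq_zero_iff]
    rintro ⟨n, hn⟩
    exact hG n hn
  have h2 : (1 : ℂ) - s ≠ 0 := sub_ne_zero.mpr (Ne.symm h1)
  have key : riemannXi s = s * (s - 1) / 2 * completedRiemannZeta s := by
    rw [completedRiemannZeta_eq, riemannXi]
    field_simp
    ring
  have hz : completedRiemannZeta s = Complex.Gammaℝ s * riemannZeta s := by
    rw [riemannZeta_def_of_ne_zero h0]
    field_simp
  rw [key, hz, Complex.Gammaℝ_def]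
  ring

/-- The function `exp(-2θ ξ'(s)/ξ(s))`, `s = 1/2 - iz`, of the complex variable `z`. -/
noncomputable def expLogDerivXi (θ : ℝ) (z : ℂ) : ℂ :=
  Complex.exp (-2 * θ * (deriv riemannXi (1 / 2 - Complex.I * z) /
    riemannXi (1 / 2 - Complex.I * z)))

/-- At the point `z`, the formula
`exp(-2θ ξ'(s)/ξ(s)) = ∫_{-∞}^{∞} K(x) e^{izx} dx`, `s = 1/2 - iz`, holds,
with an absolutely convergent integral. -/
def FourierFormulaAt (θ : ℝ) (K : ℝ → ℂ) (z : ℂ) : Prop :=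
  Integrable (fun x : ℝ => K x * Complex.exp (Complex.I * z * x)) ∧
    expLogDerivXi θ z = ∫ x : ℝ, K x * Complex.exp (Complex.I * z * x)

/-- The complex Hilbert space `L²(-∞, t)`. -/
abbrev L2Iic (t : ℝ) : Type := Lp ℂ 2 (volume.restrict (Iic t))

/-- `A` is the integral operator on `L²(-∞, t)` with kernel `k`:
`(A f)(x) = 1_{(-∞, t]}(x) ∫_{-∞}^t k(x, y) f(y) dy`. -/
def IsIntegralOperator {t : ℝ} (A : L2Iic t →L[ℂ] L2Iic t) (k : ℝ → ℝ → ℂ) : Prop :=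
  ∀ f : L2Iic t, A f =ᵐ[volume.restrict (Iic t)]
    (Iic t).indicator (fun x => ∫ y in Iic t, k x y * f y)

/-- `d` is the Fredholm determinant `det(1 + A)` of an integral operator `A` on `L²(-∞, t)` with
continuous kernel `k`, i.e. the sum of the (convergent) Fredholm series
`∑ₙ (1/n!) ∫_{(-∞, t]ⁿ} det (k(xᵢ, xⱼ))ᵢⱼ dx₁ ⋯ dxₙ`. The operator determines `k` on `(-∞, t]²`,
by continuity. -/
def HasFredholmDet {t : ℝ} (A : L2Iic t →L[ℂ] L2Iic t) (d : ℂ) : Prop :=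
  ∃ k : ℝ → ℝ → ℂ,
    ContinuousOn (Function.uncurry k) (Iic t ×ˢ Iic t) ∧
    IsIntegralOperator A k ∧
    (∀ n : ℕ, Integrable (fun x : Fin n → ℝ => (Matrix.of fun i j => k (x i) (x j)).det)
      (Measure.pi fun _ => volume.restrict (Iic t))) ∧
    HasSum (fun n : ℕ => (1 / (n.factorial : ℂ)) *
      ∫ x : Fin n → ℝ, (Matrix.of fun i j => k (x i) (x j)).det
        ∂(Measure.pi fun _ => volume.restrict (Iic t))) d

/-! Put F(s) = exp(-2θ ξ'/ξ(s)). With s = 1/2 - iz, formula (1) says that e^{x/2} K_θ(x) has Laplace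
transform F, so K_θ(x) must be e^{-x/2}/(2π) times the integral of F(s) e^{sx} over a vertical line
Re s = σ > 1. For Re s > 1, F(s) = g(s) exp(-2θ ζ'/ζ(s)), where g collects the polynomial, the power
of π and the gamma factor. Since Re ψ(s/2) ≥ log|s| - O(1), g(s) ≪ |s|^{-θ}, which is integrable on
vertical lines because θ > 1. For Re s ≥ 2 the zeta factor is bounded. This already gives continuity
of K_θ, and moving the line to +∞ gives K_θ = 0 on the negative axis.

The hard point is the growth e^{x/2} and the validity of (1) up to Im z > 1/2. Both need an
integrable majorant of F that is uniform in 1 < Re s ≤ 2 (`exists_norm_expLogDerivXiAt_le`), and for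
θ close to 1 this leaves room only for -Re ζ'/ζ(s) ≤ ε log|t| + C with ε small
(`exists_neg_re_logDeriv_riemannZeta_le`). Two facts give it for every ε > 0. (a) Van der Corput
differencing saves a power in the zeta sums over dyadic blocks longer than a small power of t. Hence
ζ(s) ≪ |t|^{εr} for Re s ≥ 1 - r and all small r (`exists_norm_riemannZeta_le`): the exponent is
o(r), not merely O(r). (b) On a circle of radius r about c with Re c > 1, the average of log|ζ(z)|
Re(z - c) is at most (r²/2) Re ζ'/ζ(c), because every zero in the disc lies to the left of c and can
only increase the right side (`circleAverage_log_norm_mul_re_sub_le`). On the left half of the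
circle (a) bounds log|ζ| by εr log|t| + O(1) and the weight is at most r; on the right half |1/ζ(z)|
≤ ζ(Re z) gives O(1). Division by r² leaves O(ε log|t|) + O(1), with r fixed in terms of ε.

For smoothness, exp(-2θ ζ'/ζ) is an absolutely convergent Dirichlet series Σ a_n n^{-s}, so e^{x/2}
K_θ(x) is a combination of translates by log n of the inverse transform of g. That transform
vanishes on y ≤ 0, so the sum is finite on every interval bounded above; it is C¹ away from 0, with
derivative O(y^{θ-2}) as y → 0+.

Uniqueness is injectivity of the Fourier transform on a line. For the determinants, the kernel K_θ(x
+ y) on (-∞, t]² lives on [-t, t]², so the n-th Fredholm term is at most (2tM)^n with M a bound for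
|K_θ|, and det(1 ± K_θ[t]) is close to 1 for small t. -/

/-! ### Exponential sums: van der Corput differencing -/

open Finset in
-- A Kuzmin–Landau bound in which control of second differences replaces monotonicity of the first.
-- With c_n = 1/(e^{i(p(n+1) - p(n))} - 1) one has u_n = (u_{n+1} - u_n) c_n. Summation by parts
-- leaves two boundary terms of size 2/l and the variation of c, each step of which is at most
-- 4μ/l².
theorem norm_sum_exp_le_of_diff_bounds {p : ℕ → ℝ} {l μ : ℝ} {L : ℕ} (hl : 0 < l) (hμ0 : 0 ≤ μ)
    (h1 : ∀ n < L, l ≤ p (n + 1) - p n) (h2 : ∀ n < L, p (n + 1) - p n ≤ Real.pi)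
    (h3 : ∀ n, n + 1 < L → |(p (n + 2) - p (n + 1)) - (p (n + 1) - p n)| ≤ μ) :
    ‖∑ n ∈ range L, Complex.exp (Complex.I * p n)‖ ≤ 4 / l + 4 * L * μ / l ^ 2 := by
  rcases Nat.eq_zero_or_pos L with rfl | hL
  · simp; positivity
  set u : ℕ → ℂ := fun n => Complex.exp (Complex.I * p n) with hu
  set c : ℕ → ℂ := fun n => (Complex.exp (Complex.I * ((p (n + 1) - p n : ℝ) : ℂ)) - 1)⁻¹ with hc
  have hun : ∀ n, ‖u n‖ = 1 := fun n => by
    simp only [hu]; rw [mul_comm]; exact Complex.norm_exp_ofReal_mul_I _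
  have hden : ∀ n < L, l / 2 ≤ ‖Complex.exp (Complex.I * ((p (n + 1) - p n : ℝ) : ℂ)) - 1‖ := by
    intro n hn
    rw [Complex.norm_exp_I_mul_ofReal_sub_one]
    set d := p (n + 1) - p n
    have hd1 := h1 n hn
    have hd2 := h2 n hn
    have := Real.mul_le_sin (x := d / 2) (by linarith) (by linarith)
    have h4 : l / 4 ≤ 2 / Real.pi * (d / 2) := by
      have : (1 : ℝ) / 4 ≤ 1 / Real.pi := one_div_le_one_div_of_le Real.pi_pos Real.pi_le_four
      calc l / 4 = 1 / 4 * l := by ring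
        _ ≤ 1 / Real.pi * d := mul_le_mul this hd1 hl.le (by positivity)
        _ = _ := by ring
    rw [norm_mul, Real.norm_eq_abs, Real.norm_eq_abs, abs_of_pos (by norm_num : (0:ℝ) < 2)]
    linarith [le_abs_self (Real.sin (d / 2))]
  have hcn : ∀ n < L, ‖c n‖ ≤ 2 / l := by
    intro n hn
    simp only [hc]
    rw [norm_inv, show 2 / l = (l / 2)⁻¹ by rw [inv_div]]
    exact inv_anti₀ (by positivity) (hden n hn)
  have hne : ∀ n < L, Complex.exp (Complex.I * ((p (n + 1) - p n : ℝ) : ℂ)) - 1 ≠ 0 := by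
    intro n hn h
    have := hden n hn
    rw [h, norm_zero] at this
    linarith
  have hrec : ∀ n < L, u n = (u (n + 1) - u n) * c n := by
    intro n hn
    have : u (n + 1) = u n * Complex.exp (Complex.I * ((p (n + 1) - p n : ℝ) : ℂ)) := by
      simp only [hu]
      rw [← Complex.exp_add]; congr 1; push_cast; ring
    rw [this, show u n * Complex.exp (Complex.I * ((p (n + 1) - p n : ℝ) : ℂ)) - u n =
      u n * (Complex.exp (Complex.I * ((p (n + 1) - p n : ℝ) : ℂ)) - 1) by ring, mul_assoc,
      mul_inv_cancel₀ (hne n hn), mul_one]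
  have hcc : ∀ n, n + 1 < L → ‖c (n + 1) - c n‖ ≤ 4 * μ / l ^ 2 := by
    intro n hn
    have e1 := hne n (by omega)
    have e2 := hne (n + 1) hn
    have : c (n + 1) - c n = (Complex.exp (Complex.I * ((p (n + 1) - p n : ℝ) : ℂ)) -
        Complex.exp (Complex.I * ((p (n + 2) - p (n + 1) : ℝ) : ℂ))) * (c (n + 1) * c n) := by
      simp only [hc]
      field_simp
      ring
    rw [this, norm_mul, norm_mul]
    have h5 : ‖Complex.exp (Complex.I * ((p (n + 1) - p n : ℝ) : ℂ)) -
        Complex.exp (Complex.I * ((p (n + 2) - p (n + 1) : ℝ) : ℂ))‖ ≤ μ := by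
      have : Complex.exp (Complex.I * ((p (n + 1) - p n : ℝ) : ℂ)) -
          Complex.exp (Complex.I * ((p (n + 2) - p (n + 1) : ℝ) : ℂ)) =
          -(Complex.exp (Complex.I * ((p (n + 1) - p n : ℝ) : ℂ)) *
          (Complex.exp (Complex.I * (((p (n + 2) - p (n + 1)) - (p (n + 1) - p n) : ℝ) : ℂ)) - 1)) := by
        rw [mul_sub, ← Complex.exp_add, mul_one, neg_sub]
        congr 2
        push_cast; ring
      rw [this, norm_neg, norm_mul, mul_comm Complex.I, Complex.norm_exp_ofReal_mul_I, one_mul]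
      refine le_trans ?_ (h3 n hn)
      exact Real.norm_exp_I_mul_ofReal_sub_one_le
    calc _ ≤ μ * (2 / l * (2 / l)) :=
          mul_le_mul h5 (mul_le_mul (hcn _ hn) (hcn _ (by omega)) (norm_nonneg _) (by positivity))
            (by positivity) (le_trans (abs_nonneg _) (h3 n hn))
      _ = _ := by ring
  have habel : ∀ m, m < L → ∑ n ∈ range (m + 1), u n =
      u (m + 1) * c m - u 0 * c 0 - ∑ n ∈ range m, u (n + 1) * (c (n + 1) - c n) := by
    intro m
    induction m with
    | zero => 
      intro h
      simp only [zero_add, sum_range_one, range_zero, sum_empty]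
      linear_combination hrec 0 h
    | succ m ih =>
      intro h
      rw [sum_range_succ, ih (by omega), sum_range_succ _ m]
      linear_combination hrec (m + 1) h
  obtain ⟨m, rfl⟩ : ∃ m, L = m + 1 := ⟨L - 1, by omega⟩
  rw [habel m (by omega)]
  have hb : ‖∑ n ∈ range m, u (n + 1) * (c (n + 1) - c n)‖ ≤ m * (4 * μ / l ^ 2) := by
    refine (norm_sum_le _ _).trans ?_
    calc _ ≤ ∑ n ∈ range m, 4 * μ / l ^ 2 := by
          refine sum_le_sum fun n hn => ?_
          rw [norm_mul, hun, one_mul]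
          exact hcc n (by have := mem_range.1 hn; omega)
      _ = _ := by simp
  have hμ : (m : ℝ) * (4 * μ / l ^ 2) ≤ 4 * ((m + 1 : ℕ) : ℝ) * μ / l ^ 2 := by
    have : 0 ≤ 4 * μ / l ^ 2 := by positivity
    push_cast
    calc (m : ℝ) * (4 * μ / l ^ 2) ≤ (m + 1) * (4 * μ / l ^ 2) := by nlinarith
      _ = _ := by ring
  calc _ ≤ ‖u (m + 1) * c m‖ + ‖u 0 * c 0‖ + _ := (norm_sub_le _ _).trans (add_le_add (norm_sub_le _ _) le_rfl)
    _ ≤ 2 / l + 2 / l + m * (4 * μ / l ^ 2) := by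
        refine add_le_add (add_le_add ?_ ?_) hb
        · rw [norm_mul, hun, one_mul]; exact hcn _ (by omega)
        · rw [norm_mul, hun, one_mul]; exact hcn _ (by omega)
    _ ≤ _ := by have : 2 / l + 2 / l = 4 / l := by ring
                linarith

open Finset in
/-- The van der Corput inequality. -/
theorem vanDerCorput_inequality (u : ℕ → ℂ) (hu : ∀ n, ‖u n‖ ≤ 1) (L H : ℕ) :
    (H : ℝ) ^ 2 * ‖∑ n ∈ range L, u n‖ ^ 2 ≤ (L + H) * (H * L +
      2 * H * ∑ d ∈ Finset.Ico 1 H, ‖∑ n ∈ range (L - d), u (n + d) * (starRingEnd ℂ) (u n)‖) := by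
  -- Extension by zero to ℤ makes each shift of the sum a sum over the same window [-H, L), which
  -- depends on no shift h < H.
  set v : ℤ → ℂ := fun m => if 0 ≤ m ∧ m < L then u m.toNat else 0 with hv
  have hv0 : ∀ m : ℤ, ¬ (0 ≤ m ∧ m < L) → v m = 0 := fun m hm => if_neg hm
  have hvn : ∀ n : ℕ, n < L → v n = u n := by
    intro n hn
    simp only [hv]
    rw [if_pos ⟨by omega, by exact_mod_cast hn⟩]; simp
  set S := ∑ n ∈ range L, u n with hS
  set I := Finset.Ico (-(H:ℤ)) L with hI
  set T : ℕ → ℂ := fun d => ∑ n ∈ range (L - d), u (n + d) * (starRingEnd ℂ) (u n) with hT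
  have hSh : ∀ h ∈ range H, S = ∑ m ∈ I, v (m + h) := by
    intro h hh
    have hh := mem_range.1 hh
    refine sum_bij_ne_zero (fun (n : ℕ) _ _ => (n : ℤ) - h) ?_ ?_ ?_ ?_
    · intro n hn _; have := mem_range.1 hn; simp only [hI, Finset.mem_Ico]; omega
    · intro a _ _ b _ _ e; omega
    · intro m hm hne
      have : 0 ≤ m + h ∧ m + h < L := by by_contra hc; exact hne (hv0 _ hc)
      have e : v (m + h) = u (m + h).toNat := if_pos this
      exact ⟨(m + h).toNat, by simp; omega, by rw [← e]; exact hne, by omega⟩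
    · intro n hn _
      rw [sub_add_cancel, hvn n (mem_range.1 hn)]
  have hR : ∀ h ∈ range H, ∀ d : ℕ, h + d ∈ range H →
      ∑ m ∈ I, v (m + (h + d : ℕ)) * (starRingEnd ℂ) (v (m + h)) = T d := by
    intro h hh d hd
    have hh := mem_range.1 hh
    have hd := mem_range.1 hd
    symm
    refine sum_bij_ne_zero (fun (n : ℕ) _ _ => (n : ℤ) - h) ?_ ?_ ?_ ?_
    · intro n hn _; have := mem_range.1 hn; simp only [hI, Finset.mem_Ico]; omega
    · intro a _ _ b _ _ e; omega
    · intro m hm hne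
      have h1 : 0 ≤ m + h ∧ m + h < L := by
        by_contra hc; apply hne; rw [hv0 _ hc]; simp
      have h2 : 0 ≤ m + (h + d : ℕ) ∧ m + (h + d : ℕ) < L := by
        by_contra hc; apply hne; rw [hv0 _ hc]; simp
      have e1 : v (m + h) = u (m + h).toNat := if_pos h1
      have e2 : v (m + (h + d : ℕ)) = u ((m + h).toNat + d) := by
        rw [show (m + h).toNat + d = (m + (h + d : ℕ)).toNat by omega]; exact if_pos h2
      exact ⟨(m + h).toNat, by simp; omega, by rw [← e1, ← e2]; exact hne, by omega⟩
    · intro n hn _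
      have := mem_range.1 hn
      rw [show (n : ℤ) - h + (h + d : ℕ) = ((n + d : ℕ) : ℤ) by push_cast; ring, sub_add_cancel,
        hvn n (by omega), hvn (n + d) (by omega)]
  have hT0 : ‖T 0‖ ≤ L := by
    refine (norm_sum_le _ _).trans ?_
    calc _ ≤ ∑ n ∈ range (L - 0), (1 : ℝ) := by
          refine sum_le_sum fun n _ => ?_
          rw [norm_mul, RCLike.norm_conj]
          exact mul_le_one₀ (hu _) (norm_nonneg _) (hu _)
      _ = L := by simp
  have hcard : (#I : ℝ) = L + H := by
    simp only [hI, Int.card_Ico]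
    rw [show ((L : ℤ) - -(H : ℤ)).toNat = L + H by omega]; push_cast; ring
  -- S is averaged over H shifts; Cauchy–Schwarz over the L + H points of the window then produces
  -- the correlations `T d`.
  have hHS : (H : ℂ) * S = ∑ m ∈ I, ∑ h ∈ range H, v (m + h) := by
    rw [sum_comm, ← sum_congr rfl hSh]; simp
  -- For fixed h the diagonal contributes at most L, and each distance d ≥ 1 occurs at most once on
  -- either side of h.
  have hrow : ∀ h ∈ range H, ∑ h' ∈ range H,
      ‖∑ m ∈ I, v (m + h) * (starRingEnd ℂ) (v (m + h'))‖ ≤ L + 2 * ∑ d ∈ Finset.Ico 1 H, ‖T d‖ := by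
    intro h hh
    have hh' := mem_range.1 hh
    rw [← sum_range_add_sum_Ico _ hh'.le, sum_eq_sum_Ico_succ_bot hh']
    have e1 : ∑ h' ∈ range h, ‖∑ m ∈ I, v (m + h) * (starRingEnd ℂ) (v (m + h'))‖ ≤
        ∑ d ∈ Finset.Ico 1 H, ‖T d‖ := by
      calc _ = ∑ j ∈ range h, ‖T (h - 1 - j + 1)‖ := by
            refine sum_congr rfl fun j hj => ?_
            have hj := mem_range.1 hj
            rw [← hR j (by simp; omega) (h - 1 - j + 1) (by simp; omega),
              show j + (h - 1 - j + 1) = h by omega]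
        _ = ∑ d ∈ Finset.Ico 1 (h + 1), ‖T d‖ := by
            rw [sum_range_reflect (fun j => ‖T (j + 1)‖), sum_Ico_eq_sum_range, Nat.add_sub_cancel]
            simp_rw [add_comm 1]
        _ ≤ _ := sum_le_sum_of_subset_of_nonneg
            (Ico_subset_Ico le_rfl (by omega)) fun _ _ _ => norm_nonneg _
    have e2 : ∑ h' ∈ Finset.Ico (h + 1) H, ‖∑ m ∈ I, v (m + h) * (starRingEnd ℂ) (v (m + h'))‖ ≤
        ∑ d ∈ Finset.Ico 1 H, ‖T d‖ := by
      calc _ = ∑ j ∈ range (H - (h + 1)), ‖T (1 + j)‖ := by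
            rw [sum_Ico_eq_sum_range]
            refine sum_congr rfl fun j hj => ?_
            have hj := mem_range.1 hj
            rw [← hR h hh (1 + j) (by simp; omega), ← RCLike.norm_conj, map_sum,
              show h + (1 + j) = h + 1 + j by omega]
            simp_rw [map_mul, RingHomCompTriple.comp_apply, RingHom.id_apply, mul_comm]
        _ = ∑ d ∈ Finset.Ico 1 (H - h), ‖T d‖ := by
            rw [sum_Ico_eq_sum_range, show H - h - 1 = H - (h + 1) by omega]
        _ ≤ _ := sum_le_sum_of_subset_of_nonneg
            (Ico_subset_Ico le_rfl (by omega)) fun _ _ _ => norm_nonneg _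
    have e3 : ‖∑ m ∈ I, v (m + h) * (starRingEnd ℂ) (v (m + h))‖ ≤ L := by
      have := hR h hh 0 (by simpa using hh)
      rw [add_zero] at this
      rw [this]; exact hT0
    linarith
  have key : (H : ℝ) ^ 2 * ‖S‖ ^ 2 ≤ (L + H) * ∑ m ∈ I, ‖∑ h ∈ range H, v (m + h)‖ ^ 2 := by
    rw [← hcard, ← mul_pow, show (H : ℝ) * ‖S‖ = ‖(H : ℂ) * S‖ by simp, hHS]
    calc _ ≤ (∑ m ∈ I, ‖∑ h ∈ range H, v (m + h)‖) ^ 2 :=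
          pow_le_pow_left₀ (norm_nonneg _) (norm_sum_le _ _) 2
      _ ≤ _ := sq_sum_le_card_mul_sum_sq
  refine key.trans (mul_le_mul_of_nonneg_left ?_ (by positivity))
  have hsq : ((∑ m ∈ I, ‖∑ h ∈ range H, v (m + h)‖ ^ 2 : ℝ) : ℂ) =
      ∑ h ∈ range H, ∑ h' ∈ range H, ∑ m ∈ I, v (m + h) * (starRingEnd ℂ) (v (m + h')) := by
    push_cast
    simp_rw [← Complex.mul_conj', map_sum, sum_mul_sum]
    rw [sum_comm]
    refine sum_congr rfl fun h _ => sum_comm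
  calc (∑ m ∈ I, ‖∑ h ∈ range H, v (m + h)‖ ^ 2 : ℝ)
      ≤ ‖((∑ m ∈ I, ‖∑ h ∈ range H, v (m + h)‖ ^ 2 : ℝ) : ℂ)‖ := by
        rw [Complex.norm_real]; exact le_abs_self _
    _ ≤ ∑ h ∈ range H, ∑ h' ∈ range H, ‖∑ m ∈ I, v (m + h) * (starRingEnd ℂ) (v (m + h'))‖ := by
        rw [hsq]
        exact (norm_sum_le _ _).trans (sum_le_sum fun h _ => norm_sum_le _ _)
    _ ≤ ∑ h ∈ range H, (L + 2 * ∑ d ∈ Finset.Ico 1 H, ‖T d‖) := sum_le_sum hrow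
    _ = _ := by simp; ring

/-- Power saving for exponential sums over at most `N` terms whose phase `D 0` has `k`-th derivative
`D k` of size `l`, where `N ^ (-α) ≤ l ≤ N ^ (-β)`. -/
def PowerSaving (k : ℕ) (α β : ℝ) : Prop :=
  ∀ C : ℝ, 1 ≤ C → ∃ M δ : ℝ, 0 ≤ M ∧ 0 < δ ∧ ∀ (N l a : ℝ) (D : ℕ → ℝ → ℝ) (L : ℕ),
    1 ≤ N → N ^ (-α) ≤ l → l ≤ N ^ (-β) → (L : ℝ) ≤ N →
    (∀ j ≤ k, ∀ x ∈ Set.Icc a (a + L), HasDerivAt (D j) (D (j + 1) x) x) →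
    (∀ x ∈ Set.Icc a (a + L), l ≤ D k x ∧ D k x ≤ C * l) →
    (∀ x ∈ Set.Icc a (a + L), |D (k + 1) x| ≤ C * l / N) →
    ‖∑ n ∈ Finset.range L, Complex.exp (Complex.I * D 0 (a + n))‖ ≤ M * N ^ (1 - δ)

theorem exists_sub_eq_mul_of_hasDerivAt {f f' : ℝ → ℝ} {x y : ℝ} (hxy : x ≤ y)
    (h : ∀ z ∈ Set.Icc x y, HasDerivAt f (f' z) z) :
    ∃ z ∈ Set.Icc x y, f y - f x = (y - x) * f' z := by
  rcases hxy.eq_or_lt with rfl | hlt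
  · exact ⟨x, by simp, by simp⟩
  · obtain ⟨c, hc, he⟩ := exists_hasDerivAt_eq_slope f f' hlt
      (fun z hz => (h z hz).continuousAt.continuousWithinAt)
      fun z hz => h z (Set.Ioo_subset_Icc_self hz)
    refine ⟨c, Set.Ioo_subset_Icc_self hc, ?_⟩
    rw [he]; field_simp [(sub_pos.2 hlt).ne']

theorem norm_sum_exp_le_length (p : ℕ → ℝ) (L : ℕ) :
    ‖∑ n ∈ Finset.range L, Complex.exp (Complex.I * p n)‖ ≤ L := by
  refine (norm_sum_le _ _).trans ?_
  simp_rw [mul_comm Complex.I, Complex.norm_exp_ofReal_mul_I]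
  simp

/-- For k = 1 the derivative bounds are bounds for the first differences of the phase, with second
differences O(l/N), so the sum is O(1/l) = O(N^α). -/
theorem powerSaving_one {α β : ℝ} (hβ : 0 < β) (hα : α < 1) : PowerSaving 1 α β := by
  intro C hC
  have hC0 : 0 < C := by linarith
  refine ⟨max (5 + 4 * C) (C ^ (max 0 ((1 - α) / β))), 1 - α, by positivity, by linarith, ?_⟩
  intro N l a D L hN hl1 hl2 hL hD hk hk1
  have hN0 : 0 < N := by linarith
  have hl0 : 0 < l := lt_of_lt_of_le (by positivity) hl1
  rw [show 1 - (1 - α) = α by ring]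
  -- The first case keeps the differences of the phase below π. In the second N is bounded in terms
  -- of C, and the trivial bound costs only the second constant of the maximum.
  by_cases hbig : C * N ^ (-β) ≤ 1
  · refine le_trans ?_ (mul_le_mul_of_nonneg_right (le_max_left _ _) (by positivity))
    rcases Nat.eq_zero_or_pos L with rfl | hLpos
    · simp; positivity
    obtain ⟨m, rfl⟩ : ∃ m, L = m + 1 := ⟨L - 1, by omega⟩
    have hIcc : ∀ n : ℕ, n < m + 1 → ∀ y ∈ Set.Icc (a + n) (a + n + 1), y ∈ Set.Icc a (a + (m + 1 : ℕ)) := by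
      intro n hn y hy
      have : (n : ℝ) + 1 ≤ (m + 1 : ℕ) := by exact_mod_cast hn
      have : (0 : ℝ) ≤ n := by positivity
      exact ⟨by linarith [hy.1], by linarith [hy.2]⟩
    have hdiff : ∀ n : ℕ, n < m + 1 → ∀ j ≤ 1, ∃ z ∈ Set.Icc a (a + (m + 1 : ℕ)),
        D j (a + (n + 1 : ℕ)) - D j (a + n) = D (j + 1) z := by
      intro n hn j hj
      obtain ⟨z, hz, he⟩ := exists_sub_eq_mul_of_hasDerivAt (f := D j) (f' := D (j + 1))
        (x := a + n) (y := a + n + 1) (by linarith) fun z hz => hD j hj z (hIcc n hn z hz)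
      refine ⟨z, hIcc n hn z hz, ?_⟩
      rw [show a + ((n + 1 : ℕ) : ℝ) = a + n + 1 by push_cast; ring, he]; ring
    have hCl : C * l ≤ Real.pi := by
      have : C * l ≤ C * N ^ (-β) := by gcongr
      linarith [Real.pi_gt_three]
    have := norm_sum_exp_le_of_diff_bounds (p := fun n : ℕ => D 0 (a + n)) (l := l)
      (μ := C * l / N) (L := m) hl0 (by positivity) (fun n hn => by
        obtain ⟨z, hz, he⟩ := hdiff n (by omega) 0 (by omega)
        rw [he]; exact (hk z hz).1) (fun n hn => by
        obtain ⟨z, hz, he⟩ := hdiff n (by omega) 0 (by omega)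
        rw [he]; exact (hk z hz).2.trans hCl) (fun n hn => by
        obtain ⟨z, hz, he⟩ := exists_sub_eq_mul_of_hasDerivAt (f := fun y => D 0 (y + 1) - D 0 y)
          (f' := fun y => D 1 (y + 1) - D 1 y) (x := a + n) (y := a + n + 1) (by linarith)
          fun z hz => by
            have h1 := hD 0 (by omega) (z + 1) (hIcc (n + 1) (by omega) _
              ⟨by push_cast; linarith [hz.1], by push_cast; linarith [hz.2]⟩)
            exact (h1.comp_add_const z 1).sub (hD 0 (by omega) z (hIcc n (by omega) z hz))
        obtain ⟨w, hw, he2⟩ := exists_sub_eq_mul_of_hasDerivAt (f := D 1) (f' := D 2)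
          (x := z) (y := z + 1) (by linarith) fun w hw => hD 1 le_rfl w ⟨by
            have : (0 : ℝ) ≤ n := by positivity
            linarith [hz.1, hw.1], by
            have : (n : ℝ) + 2 ≤ (m + 1 : ℕ) := by exact_mod_cast (by omega)
            linarith [hz.2, hw.2]⟩
        have hw' : w ∈ Set.Icc a (a + (m + 1 : ℕ)) := ⟨by
            have : (0 : ℝ) ≤ n := by positivity
            linarith [hz.1, hw.1], by
            have : (n : ℝ) + 2 ≤ (m + 1 : ℕ) := by exact_mod_cast (by omega)
            linarith [hz.2, hw.2]⟩
        have e : D 0 (a + (n + 2 : ℕ)) - D 0 (a + (n + 1 : ℕ)) - (D 0 (a + (n + 1 : ℕ)) - D 0 (a + n)) =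
            D 2 w := by
          have := he
          simp only [he2] at this
          rw [show a + ((n + 2 : ℕ) : ℝ) = a + n + 1 + 1 by push_cast; ring,
            show a + ((n + 1 : ℕ) : ℝ) = a + n + 1 by push_cast; ring, this]
          ring
        simp only [e]
        exact hk1 w hw')
    rw [Finset.sum_range_succ]
    refine (norm_add_le _ _).trans ?_
    rw [mul_comm Complex.I, Complex.norm_exp_ofReal_mul_I]
    have hm : (m : ℝ) ≤ N := le_trans (by push_cast; linarith) hL
    have h4 : 4 * (m : ℝ) * (C * l / N) / l ^ 2 ≤ 4 * C / l := by
      rw [div_le_div_iff₀ (by positivity) hl0]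
      have : 4 * (m : ℝ) * (C * l / N) * l = (m / N) * (4 * C * l ^ 2) := by field_simp
      rw [this]
      exact mul_le_of_le_one_left (by positivity) ((div_le_one hN0).2 hm)
    have hinv : 1 / l ≤ N ^ α := by
      rw [one_div, ← neg_neg α, Real.rpow_neg hN0.le]
      exact inv_anti₀ (by positivity) hl1
    have h1 : 1 ≤ N ^ α := by
      refine le_trans ?_ hinv
      rw [le_div_iff₀ hl0, one_mul]
      refine hl2.trans (le_trans ?_ hbig)
      exact le_mul_of_one_le_left (by positivity) hC
    calc _ ≤ 4 / l + 4 * C / l + 1 := by linarith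
      _ = (4 + 4 * C) * (1 / l) + 1 := by ring
      _ ≤ (4 + 4 * C) * N ^ α + N ^ α := by gcongr
      _ = _ := by ring
  · refine le_trans ?_ (mul_le_mul_of_nonneg_right (le_max_right _ _) (by positivity))
    refine (norm_sum_exp_le_length (fun n : ℕ => D 0 (a + n)) L).trans (hL.trans ?_)
    push Not at hbig
    have hNC : N ^ β ≤ C := by
      rw [Real.rpow_neg hN0.le, ← div_eq_mul_inv, lt_div_iff₀ (by positivity)] at hbig
      linarith
    have : N ^ (1 - α) ≤ C ^ (max 0 ((1 - α) / β)) := by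
      rw [max_eq_right (div_nonneg (by linarith) hβ.le)]
      calc N ^ (1 - α) = (N ^ β) ^ ((1 - α) / β) := by
            rw [← Real.rpow_mul hN0.le]; congr 1; field_simp
        _ ≤ _ := Real.rpow_le_rpow (by positivity) hNC (div_nonneg (by linarith) hβ.le)
    calc N = N ^ (1 - α) * N ^ α := by rw [← Real.rpow_add hN0]; simp
      _ ≤ _ := by gcongr

open Finset in
-- Van der Corput differencing with H ≈ N^η. A shift d turns a phase with (k+1)-st derivative of
-- size l into one with k-th derivative of size dl. For N^κ ≤ d ≤ N^η this size lies in the range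
-- where the hypothesis applies. The shifts d < N^κ are estimated trivially, which is affordable
-- because κ < η.
theorem PowerSaving.succ {k : ℕ} {α β κ η : ℝ} (hκ : 0 ≤ κ) (hκη : κ < η) (hη : η ≤ 1)
    (h : PowerSaving k (α - κ) (β - η)) : PowerSaving (k + 1) α β := by
  intro C hC
  obtain ⟨M, δ, hM, hδ, h⟩ := h C hC
  -- ‖S‖² will be at most (4 + 8 + 8M) N^{2-ρ} with ρ = min(η - κ, δ); the square root halves the
  -- saving.
  refine ⟨√(12 + 8 * M), min (η - κ) δ / 2, by positivity, by have := lt_min (sub_pos.2 hκη) hδ; linarith, ?_⟩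
  intro N l a D L hN hl1 hl2 hL hD hk hk1
  have hN0 : 0 < N := by linarith
  have hl0 : 0 < l := lt_of_lt_of_le (by positivity) hl1
  have hC0 : 0 < C := by linarith
  set S := ∑ n ∈ range L, Complex.exp (Complex.I * D 0 (a + n)) with hS
  set ρ := min (η - κ) δ with hρ
  set H := ⌊N ^ η⌋₊ with hH
  have hNη : 1 ≤ N ^ η := Real.one_le_rpow hN (by linarith)
  have hH1 : 1 ≤ H := Nat.one_le_floor_iff _ |>.2 hNη
  have hHle : (H : ℝ) ≤ N ^ η := Nat.floor_le (by positivity)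
  have hHge : N ^ η / 2 ≤ H := by
    have := Nat.lt_floor_add_one (N ^ η)
    have h1 : (1 : ℝ) ≤ H := by exact_mod_cast hH1
    linarith
  have hHpos : (0 : ℝ) < H := by positivity
  have hHN : (H : ℝ) ≤ N := hHle.trans (by
    calc N ^ η ≤ N ^ (1 : ℝ) := Real.rpow_le_rpow_of_exponent_le hN hη
      _ = N := Real.rpow_one N)
  set u : ℕ → ℂ := fun n => Complex.exp (Complex.I * D 0 (a + n)) with hu
  have hu1 : ∀ n, ‖u n‖ ≤ 1 := fun n => by
    simp only [hu]; rw [mul_comm, Complex.norm_exp_ofReal_mul_I]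
  set R : ℕ → ℝ := fun d => ‖∑ n ∈ range (L - d), u (n + d) * (starRingEnd ℂ) (u n)‖ with hR
  have hvdc := vanDerCorput_inequality u hu1 L H
  have hphase : ∀ d, R d = ‖∑ n ∈ range (L - d),
      Complex.exp (Complex.I * ((fun j x => D j (x + d) - D j x) : ℕ → ℝ → ℝ) 0 (a + n))‖ := by
    intro d
    simp only [hR]
    congr 1
    refine sum_congr rfl fun n _ => ?_
    simp only [hu]
    rw [← Complex.exp_conj, ← Complex.exp_add]
    congr 1
    simp only [map_mul, Complex.conj_I, Complex.conj_ofReal]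
    push_cast
    rw [show a + (n + d) = a + n + d by ring]
    ring
  have htriv : ∀ d, R d ≤ N := by
    intro d
    rw [hphase]
    refine (norm_sum_exp_le_length _ _).trans (le_trans ?_ hL)
    exact_mod_cast Nat.sub_le _ _
  have hbound : ∀ d ∈ Finset.Ico 1 H, N ^ κ ≤ d → R d ≤ M * N ^ (1 - δ) := by
    intro d hd hdκ
    have hd' := Finset.mem_Ico.1 hd
    have hd1 : (1 : ℝ) ≤ d := by exact_mod_cast hd'.1
    have hd0 : (0 : ℝ) < d := by linarith
    by_cases hdL : L ≤ d
    · simp only [hR]; rw [Nat.sub_eq_zero_of_le hdL]; simp; positivity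
    push Not at hdL
    have hcast : ((L - d : ℕ) : ℝ) = L - d := by rw [Nat.cast_sub hdL.le]
    have hin : ∀ x ∈ Set.Icc a (a + (L - d : ℕ)), ∀ z ∈ Set.Icc x (x + d), z ∈ Set.Icc a (a + L) := by
      intro x hx z hz
      rw [hcast] at hx
      exact ⟨hx.1.trans hz.1, by linarith [hx.2, hz.2]⟩
    rw [hphase]
    refine h N (d * l) a (fun j x => D j (x + d) - D j x) (L - d) hN ?_ ?_ ?_ ?_ ?_ ?_
    · calc N ^ (-(α - κ)) = N ^ κ * N ^ (-α) := by rw [← Real.rpow_add hN0]; congr 1; ring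
        _ ≤ _ := by gcongr
    · calc (d : ℝ) * l ≤ N ^ η * N ^ (-β) := by
            gcongr
            refine le_trans ?_ hHle
            exact_mod_cast hd'.2.le
        _ = _ := by rw [← Real.rpow_add hN0]; congr 1; ring
    · rw [hcast]; linarith
    · intro j hj x hx
      exact ((hD j (by omega) (x + d) (hin x hx _ ⟨by linarith, le_rfl⟩)).comp_add_const x d).sub
        (hD j (by omega) x (hin x hx _ ⟨le_rfl, by linarith⟩))
    · intro x hx
      obtain ⟨z, hz, he⟩ := exists_sub_eq_mul_of_hasDerivAt (f := D k) (f' := D (k + 1))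
        (x := x) (y := x + d) (by linarith) fun z hz => hD k (by omega) z (hin x hx z hz)
      simp only [he, add_sub_cancel_left]
      have := hk z (hin x hx z hz)
      exact ⟨by nlinarith, by nlinarith⟩
    · intro x hx
      obtain ⟨z, hz, he⟩ := exists_sub_eq_mul_of_hasDerivAt (f := D (k + 1)) (f' := D (k + 2))
        (x := x) (y := x + d) (by linarith) fun z hz => hD (k + 1) le_rfl z (hin x hx z hz)
      simp only [he, add_sub_cancel_left]
      rw [abs_mul, abs_of_pos hd0]
      calc _ ≤ (d : ℝ) * (C * l / N) := by gcongr; exact hk1 z (hin x hx z hz)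
        _ = _ := by ring
  -- At most N^κ shifts are too small for the hypothesis, and each costs at most N.
  have hsumR : ∑ d ∈ Finset.Ico 1 H, R d ≤ N ^ κ * N + H * (M * N ^ (1 - δ)) := by
    calc ∑ d ∈ Finset.Ico 1 H, R d ≤ ∑ d ∈ Finset.Ico 1 H, ((if (d : ℝ) < N ^ κ then N else 0) + M * N ^ (1 - δ)) := by
          refine sum_le_sum fun d hd => ?_
          split_ifs with hc
          · have := htriv d
            have : 0 ≤ M * N ^ (1 - δ) := by positivity
            linarith [htriv d]
          · linarith [hbound d hd (not_lt.1 hc)]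
      _ = ∑ d ∈ (Finset.Ico 1 H).filter (fun d : ℕ => (d : ℝ) < N ^ κ), N + (H - 1 : ℕ) * (M * N ^ (1 - δ)) := by
          rw [sum_add_distrib, sum_filter]; simp
      _ ≤ _ := by
          refine add_le_add ?_ ?_
          · rw [sum_const, nsmul_eq_mul]
            gcongr
            calc ((#((Finset.Ico 1 H).filter fun d : ℕ => (d : ℝ) < N ^ κ) : ℕ) : ℝ) ≤ ((#(Icc (1 : ℕ) ⌊N ^ κ⌋₊) : ℕ) : ℝ) := by
                  norm_cast
                  refine card_le_card fun d hd => ?_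
                  have := mem_filter.1 hd
                  exact mem_Icc.2 ⟨(Finset.mem_Ico.1 this.1).1, Nat.le_floor this.2.le⟩
              _ ≤ N ^ κ := by simp; exact Nat.floor_le (by positivity)
          · gcongr; exact_mod_cast Nat.sub_le _ _
  have hN2 : ∀ e, e ≤ 2 - ρ → N ^ e ≤ N ^ (2 - ρ) := fun e he => Real.rpow_le_rpow_of_exponent_le hN he
  have hfinal : ‖S‖ ^ 2 ≤ (12 + 8 * M) * N ^ (2 - ρ) := by
    have h1 : (H : ℝ) ^ 2 * ‖S‖ ^ 2 ≤ (2 * N) * (H * N + 2 * H * (N ^ κ * N + H * (M * N ^ (1 - δ)))) := by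
      refine hvdc.trans ?_
      have : (0:ℝ) ≤ ∑ d ∈ Finset.Ico 1 H, R d := sum_nonneg fun d _ => norm_nonneg _
      gcongr
      linarith
    have h2 : ‖S‖ ^ 2 ≤ 2 * N ^ 2 / H + 4 * (N ^ κ * N ^ 2) / H + 4 * M * (N * N ^ (1 - δ)) := by
      have : (H : ℝ) ^ 2 * ‖S‖ ^ 2 ≤ (H : ℝ) ^ 2 * (2 * N ^ 2 / H + 4 * (N ^ κ * N ^ 2) / H + 4 * M * (N * N ^ (1 - δ))) := by
        refine h1.trans (le_of_eq ?_)
        field_simp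
        ring
      exact le_of_mul_le_mul_left this (by positivity)
    have hHinv : 1 / (H : ℝ) ≤ 2 * N ^ (-η) := by
      rw [Real.rpow_neg hN0.le, div_le_iff₀ hHpos]
      have := mul_le_mul_of_nonneg_left hHge (by positivity : 0 ≤ 2 * (N ^ η)⁻¹)
      calc (1 : ℝ) = 2 * (N ^ η)⁻¹ * (N ^ η / 2) := by field_simp
        _ ≤ _ := this
    have e0 : N ^ (2 : ℝ) = N ^ 2 := by norm_cast
    have hρ1 : ρ ≤ η - κ := min_le_left _ _
    have hρ2 : ρ ≤ δ := min_le_right _ _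
    have t1 : 2 * N ^ 2 / H ≤ 4 * N ^ (2 - ρ) := by
      calc 2 * N ^ 2 / H = 2 * N ^ 2 * (1 / H) := by ring
        _ ≤ 2 * N ^ 2 * (2 * N ^ (-η)) := by gcongr
        _ = 4 * N ^ (2 - η) := by rw [← e0, sub_eq_add_neg, Real.rpow_add hN0]; ring
        _ ≤ _ := by gcongr 4 * ?_; exact hN2 _ (by linarith)
    have t2 : 4 * (N ^ κ * N ^ 2) / H ≤ 8 * N ^ (2 - ρ) := by
      calc 4 * (N ^ κ * N ^ 2) / H = 4 * (N ^ κ * N ^ 2) * (1 / H) := by ring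
        _ ≤ 4 * (N ^ κ * N ^ 2) * (2 * N ^ (-η)) := by gcongr
        _ = 8 * N ^ (κ + 2 - η) := by
            rw [← e0, sub_eq_add_neg, Real.rpow_add hN0, Real.rpow_add hN0]; ring
        _ ≤ _ := by gcongr 8 * ?_; exact hN2 _ (by linarith)
    have t3 : 4 * M * (N * N ^ (1 - δ)) ≤ 8 * M * N ^ (2 - ρ) := by
      calc 4 * M * (N * N ^ (1 - δ)) = 4 * M * N ^ (2 - δ) := by
            rw [show 2 - δ = 1 + (1 - δ) by ring, Real.rpow_add hN0 1, Real.rpow_one]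
        _ ≤ 4 * M * N ^ (2 - ρ) := by gcongr 4 * M * ?_; exact hN2 _ (by linarith)
        _ ≤ _ := by have : 0 ≤ M * N ^ (2 - ρ) := by positivity
                    linarith
    calc ‖S‖ ^ 2 ≤ _ := h2
      _ ≤ 4 * N ^ (2 - ρ) + 8 * N ^ (2 - ρ) + 8 * M * N ^ (2 - ρ) := by gcongr
      _ = _ := by ring
  have : ‖S‖ ≤ √((12 + 8 * M) * N ^ (2 - ρ)) := Real.le_sqrt_of_sq_le hfinal
  refine this.trans (le_of_eq ?_)
  rw [Real.sqrt_mul (by positivity), Real.sqrt_eq_rpow (N ^ _), ← Real.rpow_mul hN0.le]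
  congr 2; ring

/-- Differencing with κ = 0 and η = β/2 keeps α and halves β, so the induction never leaves the
region 0 < β, α < 1 of the base case. -/
theorem powerSaving_of_lt_one (k : ℕ) (hk : 1 ≤ k) {α β : ℝ} (hβ : 0 < β) (hβ1 : β ≤ 1) (hα : α < 1) :
    PowerSaving k α β := by
  induction k, hk using Nat.le_induction generalizing β with
  | base => exact powerSaving_one hβ hα
  | succ k hk ih =>
    refine PowerSaving.succ (κ := 0) (η := β / 2) le_rfl (by linarith) (by linarith) ?_
    rw [sub_zero]
    exact ih (by linarith) (by linarith)

theorem PowerSaving.glue {k : ℕ} {α β γ : ℝ} (h1 : PowerSaving k α β) (h2 : PowerSaving k β γ) :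
    PowerSaving k α γ := by
  intro C hC
  obtain ⟨M, δ, hM, hδ, h⟩ := h1 C hC
  obtain ⟨M', δ', hM', hδ', h'⟩ := h2 C hC
  refine ⟨max M M', min δ δ', le_max_of_le_left hM, lt_min hδ hδ', ?_⟩
  intro N l a D L hN hl1 hl2 hL hD hk hk1
  rcases le_total l (N ^ (-β)) with hl | hl
  · refine (h N l a D L hN hl1 hl hL hD hk hk1).trans ?_
    gcongr
    · exact le_max_left _ _
    · exact min_le_left _ _
  · refine (h' N l a D L hN hl hl2 hL hD hk hk1).trans ?_
    gcongr
    · exact le_max_right _ _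
    · exact min_le_right _ _

/-- The range must be longer than 1 on the exponent scale, so that the windows in t belonging to
successive k cover a half-line. The part with exponents from 11/8 to 3/4 comes from one differencing
with κ = 7/16 and η = 1/2, which moves it to 15/16 and 1/4. -/
theorem powerSaving_of_two_le {k : ℕ} (hk : 2 ≤ k) : PowerSaving k (11 / 8) (1 / 8) := by
  refine PowerSaving.glue (β := 3 / 4) ?_ (powerSaving_of_lt_one k (by omega) (by norm_num)
    (by norm_num) (by norm_num))
  obtain ⟨j, rfl⟩ : ∃ j, k = j + 1 := ⟨k - 1, by omega⟩
  refine PowerSaving.succ (κ := 7 / 16) (η := 1 / 2) (by norm_num) (by norm_num) (by norm_num) ?_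
  exact powerSaving_of_lt_one j (by omega) (by norm_num) (by norm_num) (by norm_num)

/-! ### Zeta sums: the phase t log n -/

/-- The derivatives of `c * log`. -/
noncomputable def logPhase (c : ℝ) : ℕ → ℝ → ℝ
  | 0, x => c * Real.log x
  | j + 1, x => c * ((-1) ^ j * j.factorial * (x ^ (j + 1))⁻¹)

theorem hasDerivAt_logPhase (c : ℝ) (j : ℕ) {x : ℝ} (hx : 0 < x) :
    HasDerivAt (logPhase c j) (logPhase c (j + 1) x) x := by
  cases j with
  | zero =>
    have e : logPhase c (0 + 1) x = c * x⁻¹ := by simp [logPhase]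
    rw [e]
    exact (Real.hasDerivAt_log hx.ne').const_mul c
  | succ j =>
    have h := (((hasDerivAt_pow (j + 1) x).inv (by positivity)).const_mul
      ((-1) ^ j * (j.factorial : ℝ))).const_mul c
    have e : logPhase c (j + 1 + 1) x = c * ((-1) ^ j * (j.factorial : ℝ) *
        (-(((j + 1 : ℕ) : ℝ) * x ^ (j + 1 - 1)) / (x ^ (j + 1)) ^ 2)) := by
      simp only [logPhase, Nat.factorial_succ, Nat.add_sub_cancel]
      field_simp
      push_cast
      ring
    rw [e]
    exact h

theorem norm_sum_exp_neg (p : ℕ → ℝ) (L : ℕ) :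
    ‖∑ n ∈ Finset.range L, Complex.exp (Complex.I * ((-p n : ℝ) : ℂ))‖ =
      ‖∑ n ∈ Finset.range L, Complex.exp (Complex.I * p n)‖ := by
  rw [← RCLike.norm_conj, map_sum]
  congr 1
  refine Finset.sum_congr rfl fun n _ => ?_
  rw [← Complex.exp_conj]
  simp

/-- On [N, 2N] the k-th derivative of t log x has constant sign and size t N^{-k}. The margins of
1/8 in the exponents absorb the constants depending on k once N is large. -/
theorem PowerSaving.log {k : ℕ} {α : ℝ} (hk : 1 ≤ k) (h : PowerSaving k α (1 / 8)) :
    ∃ M δ : ℝ, 0 ≤ M ∧ 0 < δ ∧ ∀ (t : ℝ) (N L : ℕ), 1 ≤ N → (N : ℝ) ^ (k - α + 1 / 8) ≤ t →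
      t ≤ (N : ℝ) ^ (k - 1 / 4 : ℝ) → L ≤ N →
      ‖∑ n ∈ Finset.range L, Complex.exp (Complex.I * ((t * Real.log (N + n) : ℝ) : ℂ))‖ ≤
        M * (N : ℝ) ^ (1 - δ) := by
  obtain ⟨j, rfl⟩ : ∃ j, k = j + 1 := ⟨k - 1, by omega⟩
  -- 2^(j+1) is the variation of x^{-(j+1)} over [N, 2N]; the further factor j + 1 is the one gained
  -- by the next derivative.
  obtain ⟨M, δ, hM, hδ, h⟩ := h (2 ^ (j + 1) * (j + 1)) (by
    have : (1 : ℝ) ≤ 2 ^ (j + 1) := one_le_pow₀ (by norm_num)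
    have : (0 : ℝ) ≤ j := by positivity
    nlinarith)
  set c : ℝ := j.factorial / 2 ^ (j + 1) with hc
  have hc0 : 0 < c := by positivity
  set N₀ : ℝ := (max c (1 / c)) ^ (8 : ℝ) with hN₀
  refine ⟨max M N₀, min δ 1, by positivity, lt_min hδ one_pos, ?_⟩
  intro t N L hN ht1 ht2 hL
  have hN1 : (1 : ℝ) ≤ N := by exact_mod_cast hN
  have hN0 : (0 : ℝ) < N := by linarith
  have ht0 : 0 < t := lt_of_lt_of_le (by positivity) ht1
  have hLr : (L : ℝ) ≤ N := by exact_mod_cast hL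
  by_cases hbig : N₀ ≤ N
  · have hroot : max c (1 / c) ≤ (N : ℝ) ^ (1 / 8 : ℝ) := by
      calc max c (1 / c) = N₀ ^ (1 / 8 : ℝ) := by
            rw [hN₀, ← Real.rpow_mul (by positivity)]; norm_num
        _ ≤ _ := Real.rpow_le_rpow (by positivity) hbig (by norm_num)
    have hroot1 := (le_max_left _ _).trans hroot
    have hroot2 := (le_max_right _ _).trans hroot
    -- This sign makes the (j+1)-st derivative positive; changing the sign of the phase conjugates
    -- the sum.
    set s : ℝ := (-1) ^ j with hs
    have hss : s * s = 1 := by rw [hs, ← mul_pow]; norm_num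
    set l : ℝ := c * t * (N : ℝ) ^ (-(j + 1 : ℝ)) with hl
    have epow : (N : ℝ) ^ (-(j + 1 : ℝ)) = ((N : ℝ) ^ (j + 1))⁻¹ := by
      rw [Real.rpow_neg hN0.le]; norm_cast
    have key := h N l N (logPhase (s * t)) L hN1 ?_ ?_ hLr ?_ ?_ ?_
    · have e : ‖∑ n ∈ Finset.range L, Complex.exp (Complex.I * logPhase (s * t) 0 (N + n))‖ =
          ‖∑ n ∈ Finset.range L, Complex.exp (Complex.I * ((t * Real.log (N + n) : ℝ) : ℂ))‖ := by
        simp only [logPhase]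
        rcases neg_one_pow_eq_or ℝ j with h1 | h1
        · rw [hs, h1, one_mul]
        · rw [hs, h1, ← norm_sum_exp_neg]
          congr 1
          refine Finset.sum_congr rfl fun n _ => ?_
          congr 3
          ring
      rw [← e]
      refine key.trans ?_
      gcongr
      · exact le_max_left _ _
      · exact min_le_left _ _
    · rw [hl]
      have h1 : 1 ≤ c * (N : ℝ) ^ (1 / 8 : ℝ) := by
        rw [div_le_iff₀ hc0] at hroot2; linarith
      calc (N : ℝ) ^ (-α) = 1 * ((N : ℝ) ^ (-(1 / 8) : ℝ) * (N : ℝ) ^ ((j + 1 : ℕ) - α + 1 / 8) * (N : ℝ) ^ (-(j + 1 : ℝ))) := by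
            rw [← Real.rpow_add hN0, ← Real.rpow_add hN0, one_mul]; congr 1; push_cast; ring
        _ ≤ (c * (N : ℝ) ^ (1 / 8 : ℝ)) * ((N : ℝ) ^ (-(1 / 8) : ℝ) * t * (N : ℝ) ^ (-(j + 1 : ℝ))) := by
            gcongr
        _ = c * t * (N : ℝ) ^ (-(j + 1 : ℝ)) * ((N : ℝ) ^ (1 / 8 : ℝ) * (N : ℝ) ^ (-(1 / 8) : ℝ)) := by ring
        _ = _ := by rw [← Real.rpow_add hN0]; simp
    · rw [hl]
      calc _ ≤ (N : ℝ) ^ (1 / 8 : ℝ) * (N : ℝ) ^ ((j + 1 : ℕ) - 1 / 4 : ℝ) * (N : ℝ) ^ (-(j + 1 : ℝ)) := by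
            gcongr
        _ = _ := by rw [← Real.rpow_add hN0, ← Real.rpow_add hN0]; congr 1; push_cast; ring
    · intro i _ x hx
      exact hasDerivAt_logPhase _ _ (hN0.trans_le hx.1)
    · intro x hx
      have hx0 : 0 < x := hN0.trans_le hx.1
      have hx2 : x ≤ 2 * N := by linarith [hx.2]
      have e : logPhase (s * t) (j + 1) x = t * j.factorial * (x ^ (j + 1))⁻¹ := by
        simp only [logPhase]
        linear_combination (t * j.factorial * (x ^ (j + 1))⁻¹) * hss
      rw [e, hl, epow, hc]
      constructor
      · calc _ = t * j.factorial * ((2 * (N : ℝ)) ^ (j + 1))⁻¹ := by rw [mul_pow]; field_simp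
          _ ≤ _ := by gcongr
      · calc t * j.factorial * (x ^ (j + 1))⁻¹ ≤ t * j.factorial * ((N : ℝ) ^ (j + 1))⁻¹ := by
              gcongr; exact hx.1
          _ ≤ (j + 1) * (t * j.factorial * ((N : ℝ) ^ (j + 1))⁻¹) :=
              le_mul_of_one_le_left (by positivity) (by linarith [(Nat.cast_nonneg j : (0:ℝ) ≤ j)])
          _ = _ := by field_simp
    · intro x hx
      have hx0 : 0 < x := hN0.trans_le hx.1
      have e : |logPhase (s * t) (j + 1 + 1) x| = t * (j + 1).factorial * (x ^ (j + 2))⁻¹ := by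
        simp only [logPhase, hs, abs_mul, abs_pow, abs_neg, abs_one, one_pow, one_mul, abs_of_pos ht0]
        rw [abs_of_nonneg (by positivity), abs_of_nonneg (by positivity)]
        ring
      rw [e, hl, epow, hc]
      calc t * (j + 1).factorial * (x ^ (j + 2))⁻¹ ≤ t * (j + 1).factorial * ((N : ℝ) ^ (j + 2))⁻¹ := by
            gcongr; exact hx.1
        _ = _ := by rw [Nat.factorial_succ]; push_cast; field_simp; ring
  · push Not at hbig
    refine (norm_sum_exp_le_length (fun n : ℕ => t * Real.log (N + n)) L).trans (hLr.trans ?_)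
    have h1 : (1 : ℝ) ≤ (N : ℝ) ^ (1 - min δ 1) := Real.one_le_rpow hN1 (by linarith [min_le_right δ 1])
    calc (N : ℝ) ≤ N₀ * 1 := by linarith
      _ ≤ _ := by gcongr; exact le_max_right _ _

/-- Power saving for zeta sums over blocks of length at least a small power of `t`. -/
theorem exists_norm_sum_exp_log_le {ε : ℝ} (hε : 0 < ε) :
    ∃ M δ : ℝ, 0 ≤ M ∧ 0 < δ ∧ ∀ (t : ℝ) (N L : ℕ), 1 ≤ t → 1 ≤ N → t ^ ε ≤ N → (N : ℝ) ≤ t ^ 2 → L ≤ N →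
      ‖∑ n ∈ Finset.range L, Complex.exp (Complex.I * ((t * Real.log (N + n) : ℝ) : ℂ))‖ ≤
        M * (N : ℝ) ^ (1 - δ) := by
  have hk : ∀ k : ℕ, ∃ M δ : ℝ, 0 ≤ M ∧ 0 < δ ∧ ∀ (t : ℝ) (N L : ℕ), 1 ≤ k → 1 ≤ N →
      (N : ℝ) ^ (if k = 1 then 1 / 2 else k - 5 / 4 : ℝ) ≤ t →
      t ≤ (N : ℝ) ^ (k - 1 / 4 : ℝ) → L ≤ N →
      ‖∑ n ∈ Finset.range L, Complex.exp (Complex.I * ((t * Real.log (N + n) : ℝ) : ℂ))‖ ≤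
        M * (N : ℝ) ^ (1 - δ) := by
    intro k
    rcases Nat.lt_or_ge k 1 with h0 | h0
    · exact ⟨0, 1, le_rfl, one_pos, fun _ _ _ h => absurd h (by omega)⟩
    rcases h0.eq_or_lt with h1 | h1
    · subst h1
      obtain ⟨M, δ, hM, hδ, h⟩ := (powerSaving_one (α := 3 / 4) (β := 1 / 8) (by norm_num) (by norm_num)).log le_rfl
      refine ⟨M, δ, hM, hδ, fun t N L _ hN ht1 ht2 hL => h t N L hN (le_trans ?_ ht1) ht2 hL⟩
      have hN1 : (1 : ℝ) ≤ N := by exact_mod_cast hN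
      exact Real.rpow_le_rpow_of_exponent_le hN1 (by norm_num)
    · obtain ⟨M, δ, hM, hδ, h⟩ := (powerSaving_of_two_le h1).log h0
      refine ⟨M, δ, hM, hδ, fun t N L _ hN ht1 ht2 hL => h t N L hN (le_trans (le_of_eq ?_) ht1) ht2 hL⟩
      rw [if_neg (by omega)]; congr 1; ring
  choose M δ hM hδ hk using hk
  set K : ℕ := ⌈1 / ε + 1 / 4⌉₊ with hK
  have hne : (Finset.range (K + 1)).Nonempty := ⟨0, by simp⟩
  refine ⟨∑ k ∈ Finset.range (K + 1), M k + 1, min ((Finset.range (K + 1)).inf' hne δ) 1,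
    by have := Finset.sum_nonneg fun k (_ : k ∈ Finset.range (K + 1)) => hM k
       linarith,
    lt_min ((Finset.lt_inf'_iff hne).2 fun k _ => hδ k) one_pos, ?_⟩
  intro t N L ht hN htN hNt hL
  set Ms := ∑ k ∈ Finset.range (K + 1), M k with hMs
  set δs := min ((Finset.range (K + 1)).inf' hne δ) 1 with hδs
  have hMs0 : 0 ≤ Ms := Finset.sum_nonneg fun k _ => hM k
  have hN1 : (1 : ℝ) ≤ N := by exact_mod_cast hN
  rcases hN.eq_or_lt with h1 | h1
  · subst h1
    refine (norm_sum_exp_le_length (fun n : ℕ => t * Real.log ((1 : ℕ) + n)) L).trans ?_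
    have : (L : ℝ) ≤ 1 := by exact_mod_cast hL
    simp; linarith
  have hNlog : 0 < Real.log N := Real.log_pos (by exact_mod_cast h1)
  have hN0 : (0 : ℝ) < N := by linarith
  have ht0 : 0 < t := by linarith
  set τ := Real.log t / Real.log N with hτ
  have htτ : t = (N : ℝ) ^ τ := by
    rw [Real.rpow_def_of_pos hN0, hτ, mul_div_cancel₀ _ hNlog.ne', Real.exp_log ht0]
  have hτ1 : 1 / 2 ≤ τ := by
    rw [hτ, le_div_iff₀ hNlog]
    have := Real.log_le_log hN0 hNt
    rw [Real.log_pow] at this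
    push_cast at this; linarith
  have hτ2 : τ ≤ 1 / ε := by
    rw [hτ, div_le_div_iff₀ hNlog hε]
    have := Real.log_le_log (by positivity) htN
    rw [Real.log_rpow ht0] at this
    linarith
  -- With t = N^τ this k satisfies k - 5/4 < τ ≤ k - 1/4, so t lies in the window of k. Since τ ≤
  -- 1/ε, only finitely many k occur and the constants can be taken uniform.
  set k := ⌈τ + 1 / 4⌉₊ with hkdef
  have hk1 : 1 ≤ k := Nat.one_le_ceil_iff.2 (by linarith)
  have hkle : τ + 1 / 4 ≤ k := Nat.le_ceil _
  have hklt : (k : ℝ) < τ + 1 / 4 + 1 := Nat.ceil_lt_add_one (by linarith)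
  have hkK : k ∈ Finset.range (K + 1) := by
    have : k ≤ K := Nat.ceil_le_ceil (by linarith)
    simp; omega
  have := hk k t N L hk1 hN ?_ ?_ hL
  · refine this.trans ?_
    gcongr
    · have := Finset.single_le_sum (fun k _ => hM k) hkK
      linarith
    · exact (min_le_left _ _).trans (Finset.inf'_le _ hkK)
  · rw [htτ]
    refine Real.rpow_le_rpow_of_exponent_le hN1 ?_
    split_ifs with h1
    · exact hτ1
    · linarith
  · rw [htτ]
    exact Real.rpow_le_rpow_of_exponent_le hN1 (by linarith)

/-! ### The growth of ζ to the left of Re s = 1 -/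

open Finset in
theorem norm_sum_mul_le_of_antitone {b : ℕ → ℝ} {z : ℕ → ℂ} {B : ℝ} {L : ℕ} (hb : Antitone b)
    (hb0 : ∀ n, 0 ≤ b n) (hB : ∀ m ≤ L, ‖∑ n ∈ range m, z n‖ ≤ B) :
    ‖∑ n ∈ range L, (b n : ℂ) * z n‖ ≤ b 0 * B := by
  have hB0 : 0 ≤ B := by simpa using hB 0 (by omega)
  cases L with
  | zero => simpa using mul_nonneg (hb0 0) hB0
  | succ L =>
    have habel : ∀ m, ∑ n ∈ range (m + 1), (b n : ℂ) * z n = b m * ∑ n ∈ range (m + 1), z n +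
        ∑ n ∈ range m, ((b n - b (n + 1) : ℝ) : ℂ) * ∑ i ∈ range (n + 1), z i := by
      intro m
      induction m with
      | zero => simp
      | succ m ih =>
        rw [sum_range_succ, ih, sum_range_succ z (m + 1),
          sum_range_succ (fun n => ((b n - b (n + 1) : ℝ) : ℂ) * ∑ i ∈ range (n + 1), z i) m]
        push_cast
        ring
    rw [habel]
    calc _ ≤ b L * B + ∑ n ∈ range L, (b n - b (n + 1)) * B := by
          refine (norm_add_le _ _).trans (add_le_add ?_ ((norm_sum_le _ _).trans (sum_le_sum fun n hn => ?_)))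
          · rw [norm_mul, Complex.norm_real, Real.norm_of_nonneg (hb0 _)]
            exact mul_le_mul_of_nonneg_left (hB _ le_rfl) (hb0 _)
          · have : 0 ≤ b n - b (n + 1) := sub_nonneg.2 (hb (Nat.le_succ n))
            rw [norm_mul, Complex.norm_real, Real.norm_of_nonneg this]
            exact mul_le_mul_of_nonneg_left (hB _ (by have := mem_range.1 hn; omega)) this
      _ = b 0 * B := by rw [← sum_mul, sum_range_sub', ← add_mul]; ring

open Finset in
-- Partial summation removes the decreasing weight (N + n)^{-Re s}; what remains is the conjugate of
-- a sum with phase t log(N + n).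
theorem norm_sum_cpow_block_le {N : ℕ} (hN : 1 ≤ N) {s : ℂ} (hs : 0 ≤ s.re) {B : ℝ}
    (hB : ∀ m ≤ N, ‖∑ n ∈ range m,
      Complex.exp (Complex.I * ((s.im * Real.log (N + n) : ℝ) : ℂ))‖ ≤ B) :
    ‖∑ n ∈ range N, ((N + n : ℕ) : ℂ) ^ (-s)‖ ≤ (N : ℝ) ^ (-s.re) * B := by
  have e : ∀ n : ℕ, ((N + n : ℕ) : ℂ) ^ (-s) = (((N + n : ℝ) ^ (-s.re) : ℝ) : ℂ) *
      Complex.exp (Complex.I * ((-(s.im * Real.log (N + n)) : ℝ) : ℂ)) := by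
    intro n
    have h0 : (0 : ℝ) < N + n := by positivity
    have h1 : ((N + n : ℕ) : ℂ) = ((N + n : ℝ) : ℂ) := by push_cast; rfl
    rw [h1, Complex.cpow_def_of_ne_zero (by exact_mod_cast h0.ne'), Real.rpow_def_of_pos h0,
      ← Complex.ofReal_log h0.le, Complex.ofReal_exp, ← Complex.exp_add]
    congr 1
    apply Complex.ext <;> simp
    ring
  simp_rw [e]
  have := norm_sum_mul_le_of_antitone (b := fun n : ℕ => (N + n : ℝ) ^ (-s.re)) (L := N)
    (z := fun n => Complex.exp (Complex.I * ((-(s.im * Real.log (N + n)) : ℝ) : ℂ))) (B := B) ?_ ?_ ?_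
  · simpa using this
  · intro m n hmn
    have h0 : (0 : ℝ) < N + m := by positivity
    exact Real.rpow_le_rpow_of_nonpos h0 (by gcongr) (by linarith)
  · intro n; positivity
  · intro m hm
    rw [norm_sum_exp_neg]
    exact hB m hm

open Finset in
theorem sum_Ico_two_pow {M : Type*} [AddCommMonoid M] (f : ℕ → M) (J : ℕ) :
    ∑ n ∈ Ico 1 (2 ^ J), f n = ∑ j ∈ range J, ∑ n ∈ range (2 ^ j), f (2 ^ j + n) := by
  induction J with
  | zero => simp
  | succ J ih =>
    rw [sum_range_succ, ← ih, ← sum_Ico_consecutive f (Nat.one_le_two_pow) (Nat.pow_le_pow_right two_pos (Nat.le_succ J)),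
      sum_Ico_eq_sum_range f (2 ^ J), pow_succ, mul_two, Nat.add_sub_cancel]

/-- Bound for the Dirichlet polynomial approximating `ζ` to the left of the line `Re s = 1`. -/
theorem exists_norm_zetaPoly_le {ε : ℝ} (hε : 0 < ε) :
    ∃ M r₀ : ℝ, 0 ≤ M ∧ 0 < r₀ ∧ ∀ (r : ℝ) (s : ℂ) (J : ℕ), 0 < r → r ≤ r₀ → 1 - r ≤ s.re → 1 ≤ s.im →
      (2 : ℝ) ^ J ≤ s.im ^ 2 →
      ‖∑ n ∈ Finset.Ico (1 : ℕ) (2 ^ J), (n : ℂ) ^ (-s)‖ ≤ J * (s.im ^ (ε * r) + M) := by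
  obtain ⟨M, δ, hM, hδ, h⟩ := exists_norm_sum_exp_log_le hε
  refine ⟨M, min δ 1, hM, lt_min hδ one_pos, ?_⟩
  intro r s J hr hr0 hσ ht hJ
  have hrδ := hr0.trans (min_le_left _ _)
  have hr1 := hr0.trans (min_le_right _ _)
  have hσ0 : 0 ≤ s.re := by linarith
  rw [sum_Ico_two_pow]
  refine (norm_sum_le _ _).trans ?_
  calc _ ≤ ∑ j ∈ Finset.range J, (s.im ^ (ε * r) + M) := by
        refine Finset.sum_le_sum fun j hj => ?_
        have hj := Finset.mem_range.1 hj
        set N := 2 ^ j with hN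
        have hN1 : 1 ≤ N := Nat.one_le_two_pow
        have hN1r : (1 : ℝ) ≤ N := by exact_mod_cast hN1
        have hN0 : (0 : ℝ) < N := by linarith
        have hpos : 0 < s.im ^ (ε * r) := Real.rpow_pos_of_pos (by linarith) _
        -- Short blocks are bounded trivially by N^r ≤ t^{εr}. In long blocks the saving N^{-δ}
        -- beats N^{1 - Re s} ≤ N^r because r ≤ δ.
        rcases lt_or_ge (N : ℝ) (s.im ^ ε) with hlt | hge
        · refine (norm_sum_cpow_block_le hN1 hσ0 (B := N) fun m hm =>
            (norm_sum_exp_le_length (fun n : ℕ => s.im * Real.log (N + n)) m).trans (by exact_mod_cast hm)).trans ?_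
          calc (N : ℝ) ^ (-s.re) * N = (N : ℝ) ^ (1 - s.re) := by
                rw [show 1 - s.re = -s.re + 1 by ring, Real.rpow_add hN0, Real.rpow_one]
            _ ≤ (N : ℝ) ^ r := Real.rpow_le_rpow_of_exponent_le hN1r (by linarith)
            _ ≤ (s.im ^ ε) ^ r := Real.rpow_le_rpow hN0.le hlt.le hr.le
            _ = s.im ^ (ε * r) := by rw [← Real.rpow_mul (by linarith)]
            _ ≤ _ := by linarith
        · have hNt : (N : ℝ) ≤ s.im ^ 2 := by
            refine le_trans ?_ hJ
            rw [hN]; push_cast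
            exact pow_le_pow_right₀ (by norm_num) hj.le
          refine (norm_sum_cpow_block_le hN1 hσ0 (B := M * (N : ℝ) ^ (1 - δ)) fun m hm =>
            h s.im N m ht hN1 hge hNt hm).trans ?_
          calc (N : ℝ) ^ (-s.re) * (M * (N : ℝ) ^ (1 - δ)) = M * (N : ℝ) ^ (1 - s.re - δ) := by
                rw [show 1 - s.re - δ = -s.re + (1 - δ) by ring, Real.rpow_add hN0]; ring
            _ ≤ M * 1 := by
                gcongr
                exact Real.rpow_le_one_of_one_le_of_nonpos hN1r (by linarith)
            _ ≤ _ := by linarith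
    _ = _ := by rw [Finset.sum_const, Finset.card_range, nsmul_eq_mul]

/-- The error in comparing `n ^ (-s)` with the integral of `x ^ (-s)` over `[n, n + 1]`. -/
noncomputable def zetaError (s : ℂ) (n : ℕ) : ℂ :=
  (n : ℂ) ^ (-s) - (((n + 1 : ℕ) : ℂ) ^ (1 - s) - (n : ℂ) ^ (1 - s)) / (1 - s)

/-- The mean value inequality is used twice on [n, n + 1]: once to compare x^{-s} with n^{-s}, once
to integrate that difference. Re s ≥ 1/2 makes the derivative at most ‖s‖ n^{-3/2}. -/
theorem norm_zetaError_le {s : ℂ} (hs : 1 / 2 ≤ s.re) (h1 : s ≠ 1) {n : ℕ} (hn : 1 ≤ n) :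
    ‖zetaError s n‖ ≤ ‖s‖ * (n : ℝ) ^ (-(3 / 2) : ℝ) := by
  have hn1 : (1 : ℝ) ≤ n := by exact_mod_cast hn
  have hn0 : (0 : ℝ) < n := by linarith
  have hs0 : s ≠ 0 := by rintro rfl; norm_num at hs
  have h1s : 1 - s ≠ 0 := sub_ne_zero.2 (Ne.symm h1)
  have hderiv : ∀ x : ℝ, 0 < x → HasDerivAt (fun y : ℝ => (y : ℂ) ^ (-s)) (-s * (x : ℂ) ^ (-s - 1)) x := by
    intro x hx
    exact hasDerivAt_ofReal_cpow_const hx.ne' (neg_ne_zero.2 hs0)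
  have hb : ∀ x ∈ Set.Icc (n : ℝ) (n + 1), ‖(n : ℂ) ^ (-s) - (x : ℂ) ^ (-s)‖ ≤ ‖s‖ * (n : ℝ) ^ (-(3 / 2) : ℝ) := by
    intro x hx
    have := (convex_Icc (n : ℝ) (n + 1)).norm_image_sub_le_of_norm_hasDerivWithin_le
      (f := fun y : ℝ => (y : ℂ) ^ (-s)) (f' := fun x : ℝ => -s * (x : ℂ) ^ (-s - 1))
      (C := ‖s‖ * (n : ℝ) ^ (-(3 / 2) : ℝ))
      (fun y hy => (hderiv y (by linarith [hy.1])).hasDerivWithinAt) (fun y hy => by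
        have hy0 : 0 < y := by linarith [hy.1]
        rw [norm_mul, norm_neg, Complex.norm_cpow_eq_rpow_re_of_pos hy0]
        gcongr
        simp only [Complex.sub_re, Complex.neg_re, Complex.one_re]
        calc y ^ (-s.re - 1) ≤ y ^ (-(3 / 2) : ℝ) :=
              Real.rpow_le_rpow_of_exponent_le (by linarith [hy.1]) (by linarith)
          _ ≤ _ := Real.rpow_le_rpow_of_nonpos hn0 hy.1 (by norm_num)) hx
      (⟨le_rfl, by linarith⟩ : (n : ℝ) ∈ Set.Icc (n : ℝ) (n + 1))
    refine (le_trans (by simp) this).trans ?_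
    rw [Real.norm_eq_abs, abs_sub_comm, abs_of_nonneg (by linarith [hx.1])]
    exact mul_le_of_le_one_right (by positivity) (by linarith [hx.2])
  have := (convex_Icc (n : ℝ) (n + 1)).norm_image_sub_le_of_norm_hasDerivWithin_le
      (f := fun y : ℝ => (y : ℂ) * (n : ℂ) ^ (-s) - (y : ℂ) ^ (-s + 1) / (-s + 1))
      (f' := fun x : ℝ => 1 * (n : ℂ) ^ (-s) - (x : ℂ) ^ (-s))
      (C := ‖s‖ * (n : ℝ) ^ (-(3 / 2) : ℝ))
      (fun y hy => (((hasDerivAt_id y).ofReal_comp.mul_const _).sub (hasDerivAt_ofReal_cpow_const'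
        (by linarith [hy.1]) (by simpa using h1))).hasDerivWithinAt)
      (fun y hy => by rw [one_mul]; exact hb y hy)
      (⟨le_rfl, by linarith⟩ : (n : ℝ) ∈ Set.Icc (n : ℝ) (n + 1))
      (⟨by linarith, le_rfl⟩ : (n : ℝ) + 1 ∈ Set.Icc (n : ℝ) (n + 1))
  rw [add_sub_cancel_left, norm_one, mul_one] at this
  refine le_trans (le_of_eq ?_) this
  congr 1
  rw [zetaError, show -s + 1 = 1 - s by ring]
  push_cast
  ring

/-- A telescoping majorant, which gives the tail of Σ n^{-3/2} with an explicit constant. -/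
theorem rpow_neg_three_halves_le {n : ℕ} (hn : 1 ≤ n) :
    (n : ℝ) ^ (-(3 / 2) : ℝ) ≤ 4 * (1 / √n - 1 / √(n + 1)) := by
  have hn1 : (1 : ℝ) ≤ n := by exact_mod_cast hn
  have hn0 : (0 : ℝ) < n := by linarith
  set a := √(n : ℝ) with ha
  set b := √((n : ℝ) + 1) with hb
  have ha0 : 0 < a := Real.sqrt_pos.2 hn0
  have hb0 : 0 < b := Real.sqrt_pos.2 (by linarith)
  have haa : a ^ 2 = n := Real.sq_sqrt hn0.le
  have hbb : b ^ 2 = n + 1 := Real.sq_sqrt (by linarith)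
  have e : (n : ℝ) ^ (-(3 / 2) : ℝ) = 1 / a ^ 3 := by
    rw [Real.rpow_neg hn0.le, ha, Real.sqrt_eq_rpow, ← Real.rpow_natCast, ← Real.rpow_mul hn0.le, one_div]
    norm_num
  have hb2 : b ≤ 3 / 2 * a := by
    refine le_of_sq_le_sq ?_ (by positivity)
    nlinarith
  rw [e, div_sub_div _ _ ha0.ne' hb0.ne', ← mul_div_assoc, div_le_div_iff₀ (by positivity) (by positivity)]
  have h1 : (b - a) * (b + a) = 1 := by nlinarith
  have h2 : b - a = 1 / (b + a) := by field_simp; linarith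
  have h3 : 1 / (5 / 2 * a) ≤ b - a := by
    rw [h2]; exact one_div_le_one_div_of_le (by positivity) (by linarith)
  have h4 : 1 ≤ (b - a) * (5 / 2 * a) := by
    rwa [div_le_iff₀ (by positivity)] at h3
  have h5 : a * b ≤ 3 / 2 * a ^ 2 := by nlinarith
  have h6 : a ^ 2 * 1 ≤ a ^ 2 * ((b - a) * (5 / 2 * a)) := by gcongr
  nlinarith

theorem summable_zetaError_bound (N : ℕ) :
    Summable fun k : ℕ => ((N + 1 + k : ℕ) : ℝ) ^ (-(3 / 2) : ℝ) := by
  have := (summable_nat_add_iff (N + 1)).2 (Real.summable_nat_rpow.2 (by norm_num : -(3 / 2 : ℝ) < -1))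
  refine this.congr fun k => ?_
  rw [add_comm k]

theorem tsum_zetaError_bound (N : ℕ) :
    ∑' k : ℕ, ((N + 1 + k : ℕ) : ℝ) ^ (-(3 / 2) : ℝ) ≤ 4 / √(N + 1 : ℕ) := by
  refine Real.tsum_le_of_sum_range_le (fun k => by positivity) fun m => ?_
  calc _ ≤ ∑ k ∈ Finset.range m, 4 * ((fun k : ℕ => 1 / √((N + 1 + k : ℕ) : ℝ)) k -
        (fun k : ℕ => 1 / √((N + 1 + k : ℕ) : ℝ)) (k + 1)) := by
        refine Finset.sum_le_sum fun k _ => ?_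
        have := rpow_neg_three_halves_le (n := N + 1 + k) (by omega)
        simp only
        rw [show ((N + 1 + (k + 1) : ℕ) : ℝ) = ((N + 1 + k : ℕ) : ℝ) + 1 by push_cast; ring]
        exact this
    _ ≤ _ := by
        rw [← Finset.mul_sum, Finset.sum_range_sub', add_zero]
        have : 0 ≤ 1 / √((N + 1 + m : ℕ) : ℝ) := by positivity
        rw [show 4 / √((N + 1 : ℕ) : ℝ) = 4 * (1 / √((N + 1 : ℕ) : ℝ)) by ring]
        linarith

/-- First-order Euler–Maclaurin summation. For Re s > 1 the integrals telescope to the middle term;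
both sides times s - 1 are analytic on Re s > 1/2, so the identity continues there. -/
theorem riemannZeta_eq_sum_add_tsum_zetaError (N : ℕ) {s : ℂ} (hs : 1 / 2 < s.re) (h1 : s ≠ 1) :
    riemannZeta s = ∑ n ∈ Finset.Ico 1 (N + 1), (n : ℂ) ^ (-s) + ((N + 1 : ℕ) : ℂ) ^ (1 - s) / (s - 1) +
      ∑' k : ℕ, zetaError s (N + 1 + k) := by
  set R : ℝ := ‖s‖ + 3 with hR
  -- The ball keeps ‖z‖ bounded, so that one summable majorant serves the whole convex set; it
  -- contains both s and the point 2, near which the identity is known.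
  set U : Set ℂ := {z | 1 / 2 < z.re} ∩ Metric.ball 0 R with hU
  have hUo : IsOpen U := (isOpen_lt continuous_const Complex.continuous_re).inter Metric.isOpen_ball
  have hUc : Convex ℝ U := (convex_halfSpace_re_gt _).inter (convex_ball _ _)
  set E : ℂ → ℕ → ℂ := fun z k => (z - 1) * ((N + 1 + k : ℕ) : ℂ) ^ (-z) +
    (((N + 1 + k + 1 : ℕ) : ℂ) ^ (1 - z) - ((N + 1 + k : ℕ) : ℂ) ^ (1 - z)) with hE
  have hEe : ∀ z ≠ 1, ∀ k, E z k = (z - 1) * zetaError z (N + 1 + k) := by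
    intro z hz k
    have : 1 - z ≠ 0 := sub_ne_zero.2 (Ne.symm hz)
    simp only [hE, zetaError]
    field_simp
    ring
  have hEb : ∀ k, ∀ z ∈ U, ‖E z k‖ ≤ ((R + 1) * R) * ((N + 1 + k : ℕ) : ℝ) ^ (-(3 / 2) : ℝ) := by
    intro k z hz
    have hzR : ‖z‖ ≤ R := by simpa using (Metric.mem_ball.1 hz.2).le
    by_cases hz1 : z = 1
    · have : E z k = 0 := by simp only [hE, hz1]; simp
      rw [this, norm_zero]; positivity
    · rw [hEe z hz1, norm_mul]
      calc _ ≤ (R + 1) * (‖z‖ * ((N + 1 + k : ℕ) : ℝ) ^ (-(3 / 2) : ℝ)) := by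
            gcongr
            · exact (norm_sub_le _ _).trans (by rw [norm_one]; linarith)
            · exact norm_zetaError_le (le_of_lt hz.1) hz1 (by omega)
        _ ≤ (R + 1) * (R * ((N + 1 + k : ℕ) : ℝ) ^ (-(3 / 2) : ℝ)) := by gcongr
        _ = _ := by ring
  have hcp : ∀ n : ℕ, ∀ w : ℂ → ℂ, Differentiable ℂ w → Differentiable ℂ fun z => ((n + 1 : ℕ) : ℂ) ^ (w z) :=
    fun n w hw z => (hw z).const_cpow (Or.inl (by exact_mod_cast Nat.succ_ne_zero n))
  have hEd : ∀ k, Differentiable ℂ fun z => E z k := by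
    intro k
    have a1 := hcp (N + k) (fun z => -z) (by fun_prop)
    have a2 := hcp (N + k + 1) (fun z => 1 - z) (by fun_prop)
    have a3 := hcp (N + k) (fun z => 1 - z) (by fun_prop)
    simp only [hE]
    simp only [show N + 1 + k = N + k + 1 by omega]
    exact ((differentiable_id.sub_const 1).mul a1).add (a2.sub a3)
  have hsumd : DifferentiableOn ℂ (fun z => ∑' k, E z k) U :=
    Complex.differentiableOn_tsum_of_summable_norm ((summable_zetaError_bound N).mul_left _)
      (fun k => (hEd k).differentiableOn) hUo hEb
  set F : ℂ → ℂ := fun z => (z - 1) * ∑ n ∈ Finset.range N, ((n + 1 : ℕ) : ℂ) ^ (-z) + ((N + 1 : ℕ) : ℂ) ^ (1 - z) +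
    ∑' k, E z k with hF
  have hFd : DifferentiableOn ℂ F U := by
    refine DifferentiableOn.add (Differentiable.differentiableOn ?_) hsumd
    refine Differentiable.add (Differentiable.mul (by fun_prop) ?_) (hcp N _ (by fun_prop))
    exact Differentiable.fun_sum fun n _ => hcp n _ (by fun_prop)
  have hz2 : (2 : ℂ) ∈ U := by
    refine ⟨by norm_num, ?_⟩
    simp only [Metric.mem_ball, dist_zero_right, hR, Complex.norm_ofNat]
    linarith [norm_nonneg s]
  have hsU : s ∈ U := ⟨hs, by simp [hR]⟩
  have hlocal : F =ᶠ[nhds 2] riemannZeta₁ := by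
    have hmem : {z : ℂ | 1 < z.re} ∩ U ∈ nhds (2 : ℂ) :=
      ((isOpen_lt continuous_const Complex.continuous_re).inter hUo).mem_nhds ⟨by norm_num, hz2⟩
    filter_upwards [hmem] with z hz
    have hzre : 1 < z.re := hz.1
    have hz1 : z ≠ 1 := by rintro rfl; simp at hzre
    have hz10 : z - 1 ≠ 0 := sub_ne_zero.2 hz1
    rw [show riemannZeta₁ z = (z - 1) * riemannZeta z by
      rw [riemannZeta_eq_inv_sub_mul hz1, mul_inv_cancel_left₀ hz10]]
    have hsumm : Summable fun n : ℕ => ((n + 1 : ℕ) : ℂ) ^ (-z) := by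
      have := (summable_nat_add_iff 1).2 (Complex.summable_one_div_nat_cpow.2 hzre)
      refine this.congr fun n => ?_
      rw [Complex.cpow_neg, one_div]
    have hζ : riemannZeta z = ∑' n : ℕ, ((n + 1 : ℕ) : ℂ) ^ (-z) := by
      rw [zeta_eq_tsum_one_div_nat_add_one_cpow hzre]
      refine tsum_congr fun n => ?_
      rw [Complex.cpow_neg, one_div]; push_cast; rfl
    rw [hζ, ← hsumm.sum_add_tsum_nat_add N, mul_add]
    simp only [hF]
    rw [add_assoc]
    congr 1
    have hsummN : Summable fun k : ℕ => (z - 1) * ((k + N + 1 : ℕ) : ℂ) ^ (-z) :=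
      ((summable_nat_add_iff N).2 hsumm).mul_left (z - 1)
    have htel : HasSum (fun k : ℕ => ((N + 1 + k + 1 : ℕ) : ℂ) ^ (1 - z) - ((N + 1 + k : ℕ) : ℂ) ^ (1 - z))
        (-((N + 1 : ℕ) : ℂ) ^ (1 - z)) := by
      have hsE : Summable fun k => E z k :=
        Summable.of_norm_bounded ((summable_zetaError_bound N).mul_left _) fun k => hEb k z hz.2
      have hs2 : Summable (fun k : ℕ => ((N + 1 + k + 1 : ℕ) : ℂ) ^ (1 - z) - ((N + 1 + k : ℕ) : ℂ) ^ (1 - z)) := by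
        refine (hsE.sub hsummN).congr fun k => ?_
        simp only [hE]
        rw [show k + N + 1 = N + 1 + k by omega]; ring
      rw [hs2.hasSum_iff_tendsto_nat]
      have : ∀ m : ℕ, ∑ k ∈ Finset.range m, (((N + 1 + k + 1 : ℕ) : ℂ) ^ (1 - z) - ((N + 1 + k : ℕ) : ℂ) ^ (1 - z)) =
          ((N + 1 + m : ℕ) : ℂ) ^ (1 - z) - ((N + 1 : ℕ) : ℂ) ^ (1 - z) := by
        intro m
        have := Finset.sum_range_sub (fun k : ℕ => ((N + 1 + k : ℕ) : ℂ) ^ (1 - z)) m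
        simpa [add_assoc] using this
      simp_rw [this]
      rw [← zero_sub]
      refine Filter.Tendsto.sub_const ?_ _
      rw [tendsto_zero_iff_norm_tendsto_zero]
      have : ∀ m : ℕ, ‖((N + 1 + m : ℕ) : ℂ) ^ (1 - z)‖ = ((m + (N + 1) : ℕ) : ℝ) ^ (-(z.re - 1)) := by
        intro m
        rw [Complex.norm_natCast_cpow_of_pos (by omega), add_comm (N + 1)]
        congr 1
        simp
      simp_rw [this]
      exact (tendsto_rpow_neg_atTop (by linarith)).comp (tendsto_natCast_atTop_atTop.comp
        (Filter.tendsto_add_atTop_nat (N + 1)))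
    have : ∑' k, E z k = ∑' k : ℕ, (z - 1) * ((k + N + 1 : ℕ) : ℂ) ^ (-z) + (-((N + 1 : ℕ) : ℂ) ^ (1 - z)) := by
      rw [← htel.tsum_eq, ← hsummN.tsum_add htel.summable]
      refine tsum_congr fun k => ?_
      simp only [hE]
      rw [show k + N + 1 = N + 1 + k by omega]
    rw [this, tsum_mul_left]
    ring
  have hEq := (hFd.analyticOnNhd hUo).eqOn_of_preconnected_of_eventuallyEq
    (differentiable_riemannZeta₁.differentiableOn.analyticOnNhd hUo) hUc.isPreconnected hz2 hlocal hsU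
  have h10 : s - 1 ≠ 0 := sub_ne_zero.2 h1
  rw [riemannZeta_eq_inv_sub_mul h1, ← hEq]
  simp only [hF]
  simp_rw [hEe s h1]
  rw [tsum_mul_left, Finset.sum_Ico_eq_sum_range, Nat.add_sub_cancel]
  simp_rw [add_comm 1]
  field_simp

theorem norm_riemannZeta_le_sum_add {N : ℕ} {s : ℂ} (hs : 1 / 2 < s.re) (h1 : s ≠ 1) :
    ‖riemannZeta s‖ ≤ ‖∑ n ∈ Finset.Ico (1 : ℕ) (N + 1), (n : ℂ) ^ (-s)‖ +
      ((N + 1 : ℕ) : ℝ) ^ (1 - s.re) / ‖s - 1‖ + 4 * ‖s‖ / √(N + 1 : ℕ) := by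
  rw [riemannZeta_eq_sum_add_tsum_zetaError N hs h1]
  refine (norm_add_le _ _).trans (add_le_add ((norm_add_le _ _).trans (add_le_add le_rfl ?_)) ?_)
  · rw [norm_div, Complex.norm_natCast_cpow_of_pos (by omega)]
    simp
  · calc _ ≤ ∑' k : ℕ, ‖s‖ * ((N + 1 + k : ℕ) : ℝ) ^ (-(3 / 2) : ℝ) :=
          tsum_of_norm_bounded ((summable_zetaError_bound N).mul_left _).hasSum
            fun k => norm_zetaError_le hs.le h1 (by omega)
      _ ≤ ‖s‖ * (4 / √(N + 1 : ℕ)) := by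
          rw [tsum_mul_left]
          exact mul_le_mul_of_nonneg_left (tsum_zetaError_bound N) (norm_nonneg _)
      _ = _ := by ring

/-- The Lindelöf function of `ζ` is `o(1 - σ)` as `σ → 1`. -/
theorem exists_norm_riemannZeta_le {ε : ℝ} (hε : 0 < ε) :
    ∃ r₀ : ℝ, 0 < r₀ ∧ ∀ r : ℝ, 0 < r → r ≤ r₀ → ∃ C : ℝ, 1 ≤ C ∧ ∀ s : ℂ, 1 - r ≤ s.re → s.re ≤ 3 →
      1 ≤ |s.im| → ‖riemannZeta s‖ ≤ C * |s.im| ^ (ε * r) := by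
  obtain ⟨M, r₀, hM, hr₀, h⟩ := exists_norm_zetaPoly_le (half_pos hε)
  refine ⟨min r₀ (1 / 4), by positivity, fun r hr hrr => ?_⟩
  have hr1 := hrr.trans (min_le_left _ _)
  have hr2 := hrr.trans (min_le_right _ _)
  -- Half of the exponent is reserved for the number J = O(log t) of dyadic blocks, through log t ≤
  -- t^κ/κ with κ = εr/2.
  have hκ : 0 < ε / 2 * r := by positivity
  refine ⟨4 * (1 / (ε / 2 * r)) * (1 + M) + 33, by
    have : 0 ≤ 4 * (1 / (ε / 2 * r)) * (1 + M) := by positivity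
    linarith, ?_⟩
  have main : ∀ s : ℂ, 1 - r ≤ s.re → s.re ≤ 3 → 1 ≤ s.im →
      ‖riemannZeta s‖ ≤ (4 * (1 / (ε / 2 * r)) * (1 + M) + 33) * s.im ^ (ε * r) := by
    intro s hσ hσ3 ht
    set t := s.im with htdef
    have ht0 : 0 < t := by linarith
    -- A sum of length about t² makes the Euler–Maclaurin error 4‖s‖/√(2^J) bounded.
    obtain ⟨J, hJ1, hJ2⟩ := exists_nat_pow_near (one_le_pow₀ ht : 1 ≤ t ^ 2) (one_lt_two)
    have hs1 : s ≠ 1 := by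
      rintro rfl; simp at htdef; linarith
    obtain ⟨N, hN⟩ : ∃ N, 2 ^ J = N + 1 := ⟨2 ^ J - 1, by have := Nat.one_le_two_pow (n := J); omega⟩
    have hNr : ((N + 1 : ℕ) : ℝ) = 2 ^ J := by rw [← hN]; push_cast; rfl
    have hz := norm_riemannZeta_le_sum_add (N := N) (s := s) (by linarith) hs1
    rw [hNr, ← hN] at hz
    have h1 := h r s J hr hr1 hσ ht hJ1
    have hlog2 : (1 : ℝ) / 2 < Real.log 2 := by linarith [Real.log_two_gt_d9]
    have hlogt : 0 ≤ Real.log t := Real.log_nonneg ht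
    have hJ : (J : ℝ) ≤ 4 * Real.log t := by
      have := Real.log_le_log (by positivity) hJ1
      rw [Real.log_pow, Real.log_pow] at this
      push_cast at this
      have hJ0 : (0 : ℝ) ≤ J := by positivity
      nlinarith
    have hlog : Real.log t ≤ t ^ (ε / 2 * r) / (ε / 2 * r) := Real.log_le_rpow_div ht0.le hκ
    have hp1 : 1 ≤ t ^ (ε / 2 * r) := Real.one_le_rpow ht hκ.le
    have h2 : (2 ^ J : ℝ) ^ (1 - s.re) / ‖s - 1‖ ≤ 1 := by
      have ht1 : t ≤ ‖s - 1‖ := by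
        have := Complex.abs_im_le_norm (s - 1)
        simp only [Complex.sub_im, Complex.one_im, sub_zero] at this
        exact (le_abs_self _).trans this
      rw [div_le_one (by linarith)]
      refine le_trans ?_ ht1
      calc (2 ^ J : ℝ) ^ (1 - s.re) ≤ (2 ^ J : ℝ) ^ (1 / 2 : ℝ) :=
            Real.rpow_le_rpow_of_exponent_le (one_le_pow₀ (by norm_num)) (by linarith)
        _ ≤ (t ^ 2) ^ (1 / 2 : ℝ) := Real.rpow_le_rpow (by positivity) hJ1 (by norm_num)
        _ = t := by rw [← Real.sqrt_eq_rpow, Real.sqrt_sq ht0.le]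
    have h3 : 4 * ‖s‖ / √(2 ^ J) ≤ 32 := by
      have hsn : ‖s‖ ≤ 4 * t := by
        have := Complex.norm_le_abs_re_add_abs_im s
        rw [abs_of_nonneg (by linarith : 0 ≤ s.re), ← htdef, abs_of_pos ht0] at this
        linarith
      have hsq : t / 2 ≤ √(2 ^ J) := by
        apply Real.le_sqrt_of_sq_le
        have : (2 : ℝ) ^ (J + 1) = 2 ^ J * 2 := pow_succ _ _
        nlinarith
      rw [div_le_iff₀ (by linarith)]
      linarith
    calc ‖riemannZeta s‖ ≤ J * (t ^ (ε / 2 * r) + M) + 1 + 32 := by linarith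
      _ ≤ (4 * (t ^ (ε / 2 * r) / (ε / 2 * r))) * (t ^ (ε / 2 * r) + M * t ^ (ε / 2 * r)) +
          33 * (t ^ (ε / 2 * r) * t ^ (ε / 2 * r)) := by
          have a1 : (J : ℝ) ≤ 4 * (t ^ (ε / 2 * r) / (ε / 2 * r)) := by linarith
          have a2 : M ≤ M * t ^ (ε / 2 * r) := le_mul_of_one_le_right hM hp1
          have a3 : 1 ≤ t ^ (ε / 2 * r) * t ^ (ε / 2 * r) := one_le_mul_of_one_le_of_one_le hp1 hp1
          have a4 : J * (t ^ (ε / 2 * r) + M) ≤ (4 * (t ^ (ε / 2 * r) / (ε / 2 * r))) * (t ^ (ε / 2 * r) + M * t ^ (ε / 2 * r)) := by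
            gcongr
          linarith
      _ = (4 * (1 / (ε / 2 * r)) * (1 + M) + 33) * (t ^ (ε / 2 * r) * t ^ (ε / 2 * r)) := by ring
      _ = _ := by rw [← Real.rpow_add ht0]; congr 2; ring
  intro s hσ hσ3 ht
  rcases le_total 0 s.im with h0 | h0
  · rw [abs_of_nonneg h0] at ht ⊢
    exact main s hσ hσ3 ht
  · rw [abs_of_nonpos h0] at ht ⊢
    have := main ((starRingEnd ℂ) s) (by simpa using hσ) (by simpa using hσ3) (by simpa using ht)
    rwa [riemannZeta_conj, RCLike.norm_conj, Complex.conj_im] at this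

/-! ### Circle averages and logarithmic derivatives -/

open Metric Real in
-- On the circle Re w = (w + r²/w)/2 with w = z - c. Against L the first summand averages to 0 by
-- the mean value property, and the second gives (r²/2) L'(c) by Cauchy's formula.
theorem circleAverage_re_mul_re_sub {L : ℂ → ℂ} {c : ℂ} {r : ℝ} (hr : 0 < r)
    (hL : DifferentiableOn ℂ L (closedBall c r)) :
    circleAverage (fun z => (L z).re * (z - c).re) c r = r ^ 2 / 2 * (deriv L c).re := by
  have hsph : ∀ z ∈ sphere c r, z - c ≠ 0 := by
    intro z hz h
    rw [mem_sphere_iff_norm, h, norm_zero] at hz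
    exact hr.ne hz
  set A : ℂ → ℂ := fun z => L z * (z - c) with hA
  set B : ℂ → ℂ := fun z => (z - c)⁻¹ * L z with hB
  have hLc : ContinuousOn L (sphere c r) := hL.continuousOn.mono sphere_subset_closedBall
  have hAc : CircleIntegrable A c r := ContinuousOn.circleIntegrable hr.le (by fun_prop)
  have hBc : CircleIntegrable B c r := ContinuousOn.circleIntegrable hr.le
    (ContinuousOn.mul (ContinuousOn.inv₀ (by fun_prop) hsph) hLc)
  have hAv : circleAverage A c r = 0 := by
    have hd : DifferentiableOn ℂ A (closedBall c r) := by fun_prop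
    have := (hd.mono closure_ball_subset_closedBall).diffContOnCl
    have := DiffContOnCl.circleAverage (f := A) (c := c) (R := r) (by rwa [abs_of_pos hr])
    rw [this]; simp [hA]
  have hBv : circleAverage B c r = deriv L c := by
    rw [circleAverage_eq_circleIntegral hr.ne']
    have := hL.deriv_eq_smul_circleIntegral hr
    have e : (∮ z in C(c, r), (z - c)⁻¹ • B z) = ∮ z in C(c, r), (1 / (z - c) ^ 2) • L z := by
      congr 1; ext z
      simp only [hB, smul_eq_mul, one_div, sq, mul_inv]
      ring
    rw [e, this, smul_smul, inv_mul_cancel₀ Complex.two_pi_I_ne_zero, one_smul]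
  have hsum : circleAverage (fun z => (1 / 2 : ℂ) • A z + ((r : ℂ) ^ 2 / 2) • B z) c r =
      (r : ℂ) ^ 2 / 2 * deriv L c := by
    have h1 := circleAverage_fun_add (c := c) (R := r) (f₁ := fun z => (1 / 2 : ℂ) • A z)
      (f₂ := fun z => ((r : ℂ) ^ 2 / 2) • B z) (CircleIntegrable.const_fun_smul hAc) (CircleIntegrable.const_fun_smul hBc)
    rw [h1, circleAverage_fun_smul, circleAverage_fun_smul, hAv, hBv]
    simp
  have hint : CircleIntegrable (fun z => (1 / 2 : ℂ) • A z + ((r : ℂ) ^ 2 / 2) • B z) c r :=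
    (CircleIntegrable.const_fun_smul hAc).add (CircleIntegrable.const_fun_smul hBc)
  have hre := Complex.reCLM.circleAverage_comp_comm hint
  rw [hsum] at hre
  calc _ = circleAverage (⇑Complex.reCLM ∘ fun z => (1 / 2 : ℂ) • A z + ((r : ℂ) ^ 2 / 2) • B z) c r := by
        refine circleAverage_congr_sphere fun z hz => ?_
        rw [abs_of_pos hr] at hz
        have hn : Complex.normSq (z - c) = r ^ 2 := by
          rw [Complex.normSq_eq_norm_sq, mem_sphere_iff_norm.1 hz]
        have hinv : (r : ℂ) ^ 2 * (z - c)⁻¹ = (starRingEnd ℂ) (z - c) := by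
          rw [Complex.inv_def, hn]
          have : (r : ℂ) ≠ 0 := by exact_mod_cast hr.ne'
          push_cast
          field_simp
        have e : (1 / 2 : ℂ) • A z + ((r : ℂ) ^ 2 / 2) • B z =
            (1 / 2 : ℂ) * (L z * (z - c) + (starRingEnd ℂ) (z - c) * L z) := by
          rw [← hinv]
          simp only [hA, hB, smul_eq_mul]
          ring
        simp only [Function.comp_apply, e, Complex.reCLM_apply]
        simp [Complex.mul_re]
        ring
    _ = _ := by
      rw [hre, Complex.reCLM_apply, show (r : ℂ) ^ 2 / 2 = ((r ^ 2 / 2 : ℝ) : ℂ) by push_cast; ring,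
        Complex.re_ofReal_mul]

open Metric Real in
-- Without zeros, g = exp P on a slightly larger disc, so log ‖g‖ = Re P and P' = g'/g.
theorem circleAverage_log_norm_mul_re_sub {g : ℂ → ℂ} {c : ℂ} {r : ℝ} (hr : 0 < r)
    (hg : AnalyticOnNhd ℂ g (closedBall c r)) (h0 : ∀ z ∈ closedBall c r, g z ≠ 0) :
    circleAverage (fun z => Real.log ‖g z‖ * (z - c).re) c r = r ^ 2 / 2 * (logDeriv g c).re := by
  have hopen : IsOpen {z | AnalyticAt ℂ g z ∧ g z ≠ 0} := by
    rw [isOpen_iff_mem_nhds]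
    intro z hz
    exact hz.1.eventually_analyticAt.and (hz.1.continuousAt.eventually_ne hz.2)
  obtain ⟨δ, hδ, hsub⟩ := (isCompact_closedBall c r).exists_thickening_subset_open hopen
    (fun z hz => ⟨hg z hz, h0 z hz⟩)
  rw [thickening_closedBall hδ hr.le] at hsub
  have hcb : closedBall c r ⊆ ball c (δ + r) := closedBall_subset_ball (by linarith)
  have hgd : DifferentiableOn ℂ g (ball c (δ + r)) := fun z hz =>
    (hsub hz).1.differentiableAt.differentiableWithinAt
  have hcm : c ∈ ball c (δ + r) := mem_ball_self (by linarith)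
  have hld : DifferentiableOn ℂ (fun z => deriv g z / g z) (ball c (δ + r)) :=
    (hgd.deriv isOpen_ball).div hgd fun z hz => (hsub hz).2
  obtain ⟨P, hP0, hP⟩ := hld.isExactOn_ball.with_val_at c (Complex.log (g c))
  have hexp : ∀ z ∈ ball c (δ + r), g z = Complex.exp (P z) := by
    have hconst : ∀ z ∈ ball c (δ + r), HasDerivAt (fun z => g z * Complex.exp (-P z)) 0 z := by
      intro z hz
      have h1 := (hsub hz).1.differentiableAt.hasDerivAt.mul (hP z hz).neg.cexp
      have h2 := (hsub hz).2
      have e : (0 : ℂ) = deriv g z * Complex.exp (-P z) +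
          g z * (Complex.exp (-P z) * -(deriv g z / g z)) := by
        field_simp
        ring
      rw [e]
      exact h1
    intro z hz
    have := (convex_ball c (δ + r)).is_const_of_fderivWithin_eq_zero (𝕜 := ℂ)
      (f := fun z => g z * Complex.exp (-P z))
      (fun w hw => (hconst w hw).differentiableAt.differentiableWithinAt)
      (fun w hw => by
        rw [fderivWithin_of_isOpen isOpen_ball hw]
        ext
        simpa using (hconst w hw).deriv) hz hcm
    simp only [hP0, Complex.exp_neg, Complex.exp_log (hsub hcm).2] at this
    rw [mul_inv_cancel₀ (hsub hcm).2] at this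
    field_simp at this
    exact this
  have := circleAverage_re_mul_re_sub hr (L := P) fun z hz =>
    (hP z (hcb hz)).differentiableAt.differentiableWithinAt
  rw [(hP c hcm).deriv] at this
  rw [logDeriv_apply, ← this]
  refine circleAverage_congr_sphere fun z hz => ?_
  rw [abs_of_pos hr] at hz
  rw [hexp z (hcb (sphere_subset_closedBall hz)), Complex.norm_exp, Real.log_exp]

open Metric Filter Topology in
/-- An analytic function on a closed disc is a product of linear factors and a function without
zeros. -/
theorem AnalyticOnNhd.exists_eq_prod_mul_ne_zero {f : ℂ → ℂ} {c : ℂ} {r : ℝ} (hr : 0 < r)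
    (hf : AnalyticOnNhd ℂ f (closedBall c r)) (hc : f c ≠ 0) :
    ∃ (S : Finset ℂ) (n : ℂ → ℕ) (g : ℂ → ℂ), AnalyticOnNhd ℂ g (closedBall c r) ∧
      (∀ z ∈ closedBall c r, g z ≠ 0) ∧ (∀ u ∈ S, u ∈ closedBall c r ∧ f u = 0) ∧
      ∀ z ∈ closedBall c r, f z = (∏ u ∈ S, (z - u) ^ n u) * g z := by
  set U := closedBall c r with hU
  have hcU : c ∈ U := mem_closedBall_self hr.le
  have hUp : IsPreconnected U := (convex_closedBall c r).isPreconnected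
  have hord : ∀ u : U, meromorphicOrderAt f u ≠ ⊤ := by
    intro u
    rw [(hf u u.2).meromorphicOrderAt_eq, ne_eq, ENat.map_eq_top_iff]
    intro h
    rw [analyticOrderAt_eq_top] at h
    exact hc (hf.eqOn_zero_of_preconnected_of_eventuallyEq_zero hUp u.2 h hcU)
  set D := MeromorphicOn.divisor f U with hD
  have hfin : D.support.Finite := D.finiteSupport (isCompact_closedBall c r)
  obtain ⟨g, hg, hg0, hfg⟩ := hf.meromorphicOn.extract_zeros_poles hord hfin
  have hD0 : ∀ u, 0 ≤ D u := fun u => (MeromorphicOn.AnalyticOnNhd.divisor_nonneg hf) u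
  have hSU : ∀ u ∈ hfin.toFinset, u ∈ U := fun u hu => D.supportWithinDomain (by simpa using hu)
  have hprod : ∀ z, (∏ᶠ u, (fun w : ℂ => w - u) ^ D u) z =
      ∏ u ∈ hfin.toFinset, (z - u) ^ (D u).toNat := by
    intro z
    rw [finprod_eq_prod_of_mulSupport_subset (s := hfin.toFinset)]
    · rw [Finset.prod_apply]
      refine Finset.prod_congr rfl fun u _ => ?_
      rw [Pi.pow_apply]
      conv_lhs => rw [← Int.toNat_of_nonneg (hD0 u)]
      rw [zpow_natCast]
    · intro u hu
      simp only [Set.Finite.coe_toFinset, Function.mem_support]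
      intro h
      apply hu
      simp only [h, zpow_zero]
  have heq : ∀ z ∈ U, f z = (∏ u ∈ hfin.toFinset, (z - u) ^ (D u).toNat) * g z := by
    have hR : AnalyticOnNhd ℂ (fun z => (∏ u ∈ hfin.toFinset, (z - u) ^ (D u).toNat) * g z) U := by
      intro z hz
      refine AnalyticAt.mul ?_ (hg z hz)
      refine Finset.analyticAt_fun_prod _ fun u _ => ?_
      fun_prop
    refine hf.eqOn_of_preconnected_of_frequently_eq hR hUp hcU (Filter.Eventually.frequently ?_)
    have hUc : U ∈ 𝓝 c := closedBall_mem_nhds c hr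
    have := mem_codiscreteWithin_iff_forall_mem_nhdsNE.1 hfg c hcU
    filter_upwards [this, mem_nhdsWithin_of_mem_nhds hUc] with z hz hzU
    rcases hz with hz | hz
    · have hz' : f z = ((∏ᶠ u, (fun w : ℂ => w - u) ^ D u) • g) z := hz
      rw [hz', Pi.smul_apply', hprod, smul_eq_mul]
    · exact absurd hzU hz
  refine ⟨hfin.toFinset, fun u => (D u).toNat, g, hg, fun z hz => hg0 ⟨z, hz⟩, fun u hu => ⟨hSU u hu, ?_⟩, heq⟩
  rw [heq u (hSU u hu), Finset.prod_eq_zero hu, zero_mul]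
  have h1 : D u ≠ 0 := by simpa using hu
  have h2 := hD0 u
  rw [sub_self, zero_pow]
  omega

/-- The logarithmic derivative of a product of powers. -/
theorem logDeriv_prod_pow_mul {S : Finset ℂ} {p : ℂ → ℂ → ℂ} {n : ℂ → ℕ} {g : ℂ → ℂ} {c : ℂ}
    (hp : ∀ u ∈ S, DifferentiableAt ℂ (p u) c) (hp0 : ∀ u ∈ S, p u c ≠ 0)
    (hg : DifferentiableAt ℂ g c) (hg0 : g c ≠ 0) :
    logDeriv (fun z => (∏ u ∈ S, p u z ^ n u) * g z) c =
      ∑ u ∈ S, n u * logDeriv (p u) c + logDeriv g c := by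
  classical
  induction S using Finset.induction_on with
  | empty => simp
  | insert a S ha ih =>
    have hS := ih (fun u hu => hp u (Finset.mem_insert_of_mem hu))
      (fun u hu => hp0 u (Finset.mem_insert_of_mem hu))
    have hpa := hp a (Finset.mem_insert_self a S)
    have hpa0 := hp0 a (Finset.mem_insert_self a S)
    have e : (fun z => (∏ u ∈ insert a S, p u z ^ n u) * g z) =
        fun z => p a z ^ n a * ((∏ u ∈ S, p u z ^ n u) * g z) := by
      funext z
      rw [Finset.prod_insert ha, mul_assoc]
    rw [e, logDeriv_mul (f := fun z => p a z ^ n a)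
      (g := fun z => (∏ u ∈ S, p u z ^ n u) * g z) c (pow_ne_zero _ hpa0)
      (mul_ne_zero (Finset.prod_ne_zero_iff.2 fun u hu =>
        pow_ne_zero _ (hp0 u (Finset.mem_insert_of_mem hu))) hg0) (hpa.pow _)
      ((DifferentiableAt.fun_finsetProd fun u hu =>
        (hp u (Finset.mem_insert_of_mem hu)).pow _).mul hg), hS, logDeriv_fun_pow hpa,
      Finset.sum_insert ha, add_assoc]

open Metric Real in
/-- A lower bound for the real part of a logarithmic derivative: zeros to the left of the centre
only increase it. -/
theorem circleAverage_log_norm_mul_re_sub_le {f : ℂ → ℂ} {c : ℂ} {r : ℝ} (hr : 0 < r)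
    (hf : AnalyticOnNhd ℂ f (closedBall c r)) (h0 : ∀ z ∈ closedBall c r, c.re ≤ z.re → f z ≠ 0)
    (hs : ∀ z ∈ sphere c r, f z ≠ 0) :
    circleAverage (fun z => Real.log ‖f z‖ * (z - c).re) c r ≤ r ^ 2 / 2 * (logDeriv f c).re := by
  have hcU : c ∈ closedBall c r := mem_closedBall_self hr.le
  obtain ⟨S, n, g, hg, hg0, hS, hfg⟩ := hf.exists_eq_prod_mul_ne_zero hr (h0 c hcU le_rfl)
  have hSb : ∀ u ∈ S, ‖u - c‖ < r := by
    intro u hu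
    refine lt_of_le_of_ne (mem_closedBall_iff_norm.1 (hS u hu).1) fun h => ?_
    exact hs u (mem_sphere_iff_norm.2 h) (hS u hu).2
  have hSre : ∀ u ∈ S, u.re < c.re := fun u hu => by
    by_contra h
    exact h0 u (hS u hu).1 (not_lt.1 h) (hS u hu).2
  -- The reflected factor has the modulus of z - u on the circle and no zero in the disc, so
  -- replacing z - u by it makes the zero-free formula exact without changing the average.
  set q : ℂ → ℂ → ℂ := fun u z => r - (starRingEnd ℂ) (u - c) * (z - c) / r with hq
  have hrC : (r : ℂ) ≠ 0 := by exact_mod_cast hr.ne'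
  have hq0 : ∀ u ∈ S, ∀ z ∈ closedBall c r, q u z ≠ 0 := by
    intro u hu z hz h
    have h1 : (r : ℂ) * r = (starRingEnd ℂ) (u - c) * (z - c) := by
      simp only [hq] at h
      field_simp at h
      linear_combination h
    have h2 := congrArg norm h1
    rw [norm_mul, norm_mul, Complex.norm_real, RCLike.norm_conj, Real.norm_of_nonneg hr.le] at h2
    have := hSb u hu
    have := mem_closedBall_iff_norm.1 hz
    nlinarith [norm_nonneg (u - c), norm_nonneg (z - c)]
  set G : ℂ → ℂ := fun z => (∏ u ∈ S, q u z ^ n u) * g z with hG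
  have hqan : ∀ u z, AnalyticAt ℂ (q u) z := fun u z => by
    simp only [hq]
    fun_prop (disch := exact hrC)
  have hGan : AnalyticOnNhd ℂ G (closedBall c r) := fun z hz =>
    (Finset.analyticAt_fun_prod _ fun u _ => (hqan u z).pow (n u)).mul (hg z hz)
  have hG0 : ∀ z ∈ closedBall c r, G z ≠ 0 := fun z hz =>
    mul_ne_zero (Finset.prod_ne_zero_iff.2 fun u hu => pow_ne_zero _ (hq0 u hu z hz)) (hg0 z hz)
  have hqn : ∀ u, ∀ z ∈ sphere c r, ‖q u z‖ = ‖z - u‖ := by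
    intro u z hz
    have hn : (starRingEnd ℂ) (z - c) * (z - c) = (r : ℂ) ^ 2 := by
      rw [mul_comm, Complex.mul_conj, Complex.normSq_eq_norm_sq, mem_sphere_iff_norm.1 hz]
      push_cast; rfl
    have e : q u z = (starRingEnd ℂ) (z - u) * ((z - c) / r) := by
      simp only [hq]
      have hm : (starRingEnd ℂ) (z - u) = (starRingEnd ℂ) (z - c) - (starRingEnd ℂ) (u - c) := by
        rw [← map_sub]; congr 1; ring
      rw [hm]
      field_simp
      linear_combination -hn
    rw [e, norm_mul, RCLike.norm_conj, norm_div, mem_sphere_iff_norm.1 hz, Complex.norm_real,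
      Real.norm_of_nonneg hr.le, div_self hr.ne', mul_one]
  have havg : circleAverage (fun z => Real.log ‖f z‖ * (z - c).re) c r =
      r ^ 2 / 2 * (logDeriv G c).re := by
    rw [← circleAverage_log_norm_mul_re_sub hr hGan hG0]
    refine circleAverage_congr_sphere fun z hz => ?_
    rw [abs_of_pos hr] at hz
    have : ‖f z‖ = ‖G z‖ := by
      rw [hfg z (sphere_subset_closedBall hz)]
      simp only [hG, norm_mul, norm_prod, norm_pow, hqn _ z hz]
    simp only [this]
  rw [havg]
  refine mul_le_mul_of_nonneg_left ?_ (by positivity)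
  have hcS : ∀ u ∈ S, c - u ≠ 0 := fun u hu h => by
    rw [sub_eq_zero] at h
    exact (hSre u hu).ne (by rw [h])
  have hgc := hg0 c hcU
  have hgd := (hg c hcU).differentiableAt
  have hfl : logDeriv f c = ∑ u ∈ S, n u * (c - u)⁻¹ + logDeriv g c := by
    have he : f =ᶠ[nhds c] fun z => (∏ u ∈ S, (z - u) ^ n u) * g z :=
      Filter.eventuallyEq_of_mem (closedBall_mem_nhds c hr) hfg
    rw [(logDeriv_congr_nhds he).eq_of_nhds, logDeriv_prod_pow_mul (p := fun u z => z - u)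
      (fun u _ => by fun_prop) hcS hgd hgc]
    congr 1
    refine Finset.sum_congr rfl fun u _ => ?_
    rw [logDeriv_apply, deriv_sub_const, deriv_id'', one_div]
  have hGl : logDeriv G c = ∑ u ∈ S, n u * (-(starRingEnd ℂ) (u - c) / (r ^ 2 : ℝ)) +
      logDeriv g c := by
    rw [hG, logDeriv_prod_pow_mul (fun u _ => (hqan u c).differentiableAt)
      (fun u hu => hq0 u hu c hcU) hgd hgc]
    congr 1
    refine Finset.sum_congr rfl fun u _ => ?_
    have hd : HasDerivAt (q u) (-((starRingEnd ℂ) (u - c) * 1 / r)) c :=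
      ((((hasDerivAt_id c).sub_const c).const_mul _).div_const _).const_sub _
    rw [logDeriv_apply, hd.deriv]
    simp only [hq, sub_self, mul_zero, zero_div, sub_zero, mul_one]
    congr 1
    push_cast
    field_simp
  rw [hfl, hGl, Complex.add_re, Complex.add_re, Complex.re_sum, Complex.re_sum]
  -- For each zero, Re 1/(c - u) = Re(c - u)/‖c - u‖² dominates Re(c - u)/r², because Re(c - u) > 0
  -- and ‖c - u‖ < r.
  refine add_le_add (Finset.sum_le_sum fun u hu => ?_) le_rfl
  rw [← Complex.ofReal_natCast, Complex.re_ofReal_mul, Complex.re_ofReal_mul]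
  refine mul_le_mul_of_nonneg_left ?_ (Nat.cast_nonneg _)
  have h1 : 0 < c.re - u.re := sub_pos.2 (hSre u hu)
  have h2 : 0 < ‖c - u‖ := norm_pos_iff.2 (hcS u hu)
  have h3 : ‖c - u‖ < r := by rw [norm_sub_rev]; exact hSb u hu
  rw [Complex.inv_re, Complex.normSq_eq_norm_sq, Complex.div_ofReal_re, Complex.neg_re,
    Complex.conj_re, Complex.sub_re, Complex.sub_re, neg_sub]
  gcongr

/-! ### A one-sided bound for ζ'/ζ to the right of Re s = 1 -/

open scoped LSeries.notation in
/-- The reciprocal of `ζ` to the right of the line `Re s = 1`. -/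
theorem norm_inv_riemannZeta_le {s : ℂ} (h1 : 1 < s.re) (h3 : s.re ≤ 3) :
    ‖riemannZeta s‖⁻¹ ≤ 1 / (s.re - 1) + 12 := by
  have hσ : 1 < ((s.re : ℂ)).re := by simpa using h1
  have e := ArithmeticFunction.LSeries_zeta_mul_Lseries_moebius h1
  rw [ArithmeticFunction.LSeries_zeta_eq_riemannZeta h1] at e
  have e2 : ‖riemannZeta s‖⁻¹ = ‖LSeries (↗ArithmeticFunction.moebius) s‖ := by
    rw [← norm_inv, eq_comm]
    congr 1
    exact eq_inv_of_mul_eq_one_right e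
  have hs0 : LSeriesSummable 1 (s.re : ℂ) := LSeriesSummable_one_iff.2 hσ
  have hle : ∀ n, ‖LSeries.term (↗ArithmeticFunction.moebius) s n‖ ≤ ‖LSeries.term 1 (s.re : ℂ) n‖ := by
    intro n
    rcases eq_or_ne n 0 with rfl | hn
    · simp
    rw [LSeries.norm_term_eq, LSeries.norm_term_eq, if_neg hn, if_neg hn, Complex.ofReal_re]
    refine div_le_div_of_nonneg_right ?_ (by positivity)
    rw [Pi.one_apply, norm_one, Complex.norm_intCast]
    exact_mod_cast ArithmeticFunction.abs_moebius_le_one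
  have hsum := hs0.norm
  have e3 : ∑' n, ‖LSeries.term 1 (s.re : ℂ) n‖ = ‖riemannZeta s.re‖ := by
    have : riemannZeta s.re = ((∑' n, ‖LSeries.term 1 (s.re : ℂ) n‖ : ℝ) : ℂ) := by
      rw [← LSeries_one_eq_riemannZeta hσ, LSeries, Complex.ofReal_tsum]
      refine tsum_congr fun n => ?_
      rcases eq_or_ne n 0 with rfl | hn
      · simp
      rw [LSeries.norm_term_eq, LSeries.term_of_ne_zero hn, if_neg hn]
      rw [Complex.ofReal_div, Complex.ofReal_cpow (by positivity)]
      simp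
    rw [this, Complex.norm_real, Real.norm_of_nonneg (tsum_nonneg fun _ => norm_nonneg _)]
  rw [e2]
  refine (norm_tsum_le_tsum_norm (hsum.of_nonneg_of_le (fun _ => norm_nonneg _) hle)).trans
    (((hsum.of_nonneg_of_le (fun _ => norm_nonneg _) hle).tsum_le_tsum hle hsum).trans ?_)
  rw [e3]
  -- With N = 0 the sum is empty, and the formula reads ζ(σ) ≤ 1/(σ - 1) + 4σ.
  have h := norm_riemannZeta_le_sum_add (N := 0) (s := (s.re : ℂ)) (by rw [Complex.ofReal_re]; linarith)
    (by intro h; rw [← Complex.ofReal_one, Complex.ofReal_inj] at h; linarith)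
  refine h.trans (le_of_eq_of_le ?_ (add_le_add (le_refl (1 / (s.re - 1))) (by linarith : 4 * s.re ≤ 12)))
  have h4 : ‖(s.re : ℂ) - 1‖ = s.re - 1 := by
    rw [← Complex.ofReal_one, ← Complex.ofReal_sub, Complex.norm_real,
      Real.norm_of_nonneg (by linarith)]
  rw [h4, Complex.norm_real, Real.norm_of_nonneg (by linarith)]
  simp

open Metric Set in
/-- There is a circle around `c` that avoids the zeros of `ζ`. -/
theorem exists_sphere_riemannZeta_ne_zero (c : ℂ) {ρ : ℝ} (hρ : 0 < ρ) :
    ∃ r, ρ / 2 ≤ r ∧ r ≤ ρ ∧ ∀ z ∈ sphere c r, riemannZeta z ≠ 0 := by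
  have hfin : (closedBall c ρ ∩ riemannZetaZeros).Finite :=
    (isCompact_closedBall c ρ).inter_riemannZetaZeros_finite
  have hinf : (Icc (ρ / 2) ρ).Infinite := Icc_infinite (by linarith)
  obtain ⟨r, hr, hr'⟩ := (hinf.sdiff (hfin.image fun z => dist z c)).nonempty
  refine ⟨r, hr.1, hr.2, fun z hz h => hr' ⟨z, ⟨?_, h⟩, hz⟩⟩
  exact mem_closedBall.2 ((mem_sphere.1 hz).trans_le hr.2)

open Metric Real in
/-- The real part of `-ζ'/ζ` to the right of the line `Re s = 1` grows more slowly than any multiple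
of the logarithm. -/
theorem exists_neg_re_logDeriv_riemannZeta_le {ε : ℝ} (hε : 0 < ε) :
    ∃ C, ∀ s : ℂ, 1 < s.re → s.re ≤ 2 → 2 ≤ |s.im| →
      -(logDeriv riemannZeta s).re ≤ ε * Real.log |s.im| + C := by
  obtain ⟨r₀, hr₀, hz⟩ := exists_norm_riemannZeta_le (show 0 < ε / 4 by positivity)
  set ρ := min r₀ (1 / 2) with hρd
  have hρ : 0 < ρ := lt_min hr₀ (by norm_num)
  have hρ2 : ρ ≤ 1 / 2 := min_le_right _ _
  obtain ⟨C, hC, hb⟩ := hz ρ hρ (min_le_left _ _)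
  refine ⟨4 * Real.log C / ρ + ε * Real.log 2 + 56 / ρ ^ 2, fun c hc1 hc2 hct => ?_⟩
  obtain ⟨r, hr1, hr2, hrs⟩ := exists_sphere_riemannZeta_ne_zero c hρ
  have hr : 0 < r := by linarith
  have hball : ∀ z ∈ closedBall c r, |z.re - c.re| ≤ r ∧ |z.im - c.im| ≤ r := fun z hz => by
    have := mem_closedBall_iff_norm.1 hz
    exact ⟨(Complex.abs_re_le_norm (z - c)).trans this, (Complex.abs_im_le_norm (z - c)).trans this⟩
  have him : ∀ z ∈ closedBall c r, 1 ≤ |z.im| ∧ |z.im| ≤ 2 * |c.im| := fun z hz => by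
    have h1 := (hball z hz).2
    have h2 := abs_sub_abs_le_abs_sub c.im z.im
    have h3 := abs_sub_abs_le_abs_sub z.im c.im
    rw [abs_sub_comm] at h2
    constructor <;> linarith
  have hne1 : ∀ z ∈ closedBall c r, z ≠ 1 := fun z hz h => by
    have := (him z hz).1
    rw [h] at this
    norm_num at this
  have hopen : IsOpen ({1}ᶜ : Set ℂ) := isOpen_compl_singleton
  have hdiff : DifferentiableOn ℂ riemannZeta {1}ᶜ := fun z hz =>
    (differentiableAt_riemannZeta hz).differentiableWithinAt
  have han : AnalyticOnNhd ℂ riemannZeta (closedBall c r) := fun z hz =>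
    hdiff.analyticAt (hopen.mem_nhds (hne1 z hz))
  have hle := circleAverage_log_norm_mul_re_sub_le hr han
    (fun z _ h => riemannZeta_ne_zero_of_one_le_re (by linarith)) hrs
  set A := Real.log C + ε / 4 * ρ * Real.log (2 * |c.im|) with hA
  have hlog2 : 0 ≤ Real.log (2 * |c.im|) := Real.log_nonneg (by linarith)
  have hlogC : 0 ≤ Real.log C := Real.log_nonneg hC
  have hA0 : 0 ≤ A := by positivity
  have hci : CircleIntegrable (fun z => -(Real.log ‖riemannZeta z‖ * (z - c).re)) c r := by
    refine ContinuousOn.circleIntegrable hr.le ?_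
    refine ((ContinuousOn.log ?_ fun z hz => norm_ne_zero_iff.2 (hrs z hz)).mul (by fun_prop)).neg
    exact (han.continuousOn.mono sphere_subset_closedBall).norm
  -- On the left half log|ζ| ≤ A and the weight is at most r. On the right half the weight Re(z - c)
  -- is at most Re z - 1 and at most 1/2, so (1/(Re z - 1) + 12) Re(z - c) ≤ 1 + 6 = 7.
  have hup : circleAverage (fun z => -(Real.log ‖riemannZeta z‖ * (z - c).re)) c r ≤ A * r + 7 := by
    refine circleAverage_mono_on_of_le_circle hci fun z hz => ?_
    rw [abs_of_pos hr] at hz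
    have hzb := sphere_subset_closedBall hz
    have hzre := abs_le.1 (hball z hzb).1
    have hz0 : 0 < ‖riemannZeta z‖ := norm_pos_iff.2 (hrs z hz)
    rcases le_or_gt z.re c.re with h | h
    · have h1 : Real.log ‖riemannZeta z‖ ≤ A := by
        have h2 := hb z (by linarith) (by linarith) (him z hzb).1
        have h3 : 0 < |z.im| := by linarith [(him z hzb).1]
        refine (Real.log_le_log hz0 h2).trans ?_
        rw [Real.log_mul (by positivity) (by positivity), Real.log_rpow h3, hA]
        have := Real.log_le_log h3 (him z hzb).2
        gcongr
      rw [Complex.sub_re]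
      nlinarith
    · have h1 := norm_inv_riemannZeta_le (s := z) (by linarith) (by linarith)
      have h2 : -Real.log ‖riemannZeta z‖ ≤ 1 / (z.re - 1) + 12 := by
        rw [← Real.log_inv]
        exact (Real.log_le_self (by positivity)).trans h1
      have h3 : 0 < z.re - c.re := by linarith
      have h4 : 1 / (z.re - 1) * (z.re - c.re) ≤ 1 := by
        rw [one_div, inv_mul_le_iff₀ (by linarith)]
        linarith
      rw [Complex.sub_re]
      have h5 := mul_le_mul_of_nonneg_right h2 h3.le
      nlinarith [mul_nonneg hA0 hr.le]
  have hneg : circleAverage (fun z => -(Real.log ‖riemannZeta z‖ * (z - c).re)) c r =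
      -circleAverage (fun z => Real.log ‖riemannZeta z‖ * (z - c).re) c r := by
    rw [← neg_one_smul ℝ (circleAverage _ c r), ← circleAverage_fun_smul]
    simp
  rw [hneg] at hup
  have hfin : -(logDeriv riemannZeta c).re ≤ 2 * A / r + 14 / r ^ 2 := by
    have : r ^ 2 / 2 * (-(logDeriv riemannZeta c).re) ≤ A * r + 7 := by linarith
    calc -(logDeriv riemannZeta c).re = 2 / r ^ 2 * (r ^ 2 / 2 * (-(logDeriv riemannZeta c).re)) := by
          field_simp
      _ ≤ 2 / r ^ 2 * (A * r + 7) := by gcongr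
      _ = _ := by field_simp; ring
  -- Since r ≥ ρ/2, the factor ρ in the logarithmic part of A cancels and 4 · ε/4 = ε remains; the
  -- other terms depend on ρ but not on c.
  have h1 : 2 * A / r ≤ 2 * A / (ρ / 2) := by gcongr
  have h2 : 14 / r ^ 2 ≤ 14 / (ρ / 2) ^ 2 := by gcongr
  have h3 : 2 * A / (ρ / 2) = 4 * Real.log C / ρ + ε * Real.log (2 * |c.im|) := by
    rw [hA]; field_simp; ring
  have h4 : 14 / (ρ / 2) ^ 2 = 56 / ρ ^ 2 := by field_simp; ring
  rw [Real.log_mul (by norm_num) (by positivity)] at h3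
  linarith

/-! ### The digamma function -/

open Filter Topology Finset in
/-- The digamma function as a limit of finite sums. -/
theorem tendsto_digamma {w : ℂ} (hw : 0 < w.re) :
    Tendsto (fun m : ℕ => (Real.log (m + 1 : ℕ) : ℂ) - ∑ j ∈ range (m + 2), (w + j)⁻¹) atTop
      (𝓝 (Complex.digamma w)) := by
  set R := max (‖w‖ + 1) 2 with hR
  have hR2 : 2 ≤ R := le_max_right _ _
  set t : Set ℂ := {z | 0 < z.re} ∩ Metric.ball 0 R with ht
  have hto : IsOpen t := (isOpen_lt continuous_const Complex.continuous_re).inter Metric.isOpen_ball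
  have htc : IsPreconnected t :=
    ((convex_halfSpace_re_gt 0).inter (convex_ball 0 R)).isPreconnected
  have hwt : w ∈ t := ⟨hw, by rw [mem_ball_zero_iff]; exact (lt_add_one _).trans_le (le_max_left _ _)⟩
  have h1t : (1 : ℂ) ∈ t := ⟨by simp, by rw [mem_ball_zero_iff, norm_one]; linarith⟩
  have hslit : ∀ z : ℂ, 0 < z.re → ∀ j : ℕ, z + j ∈ Complex.slitPlane := fun z hz j => by
    refine Or.inl ?_
    rw [Complex.add_re, Complex.natCast_re]
    positivity
  have hne : ∀ z : ℂ, 0 < z.re → ∀ j : ℕ, z + j ≠ 0 := fun z hz j =>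
    Complex.slitPlane_ne_zero (hslit z hz j)
  -- `g m` is the increment from n = m + 1 to n = m + 2 of the logarithm of Gauss's product n^z
  -- n!/(z(z+1)⋯(z+n)), whose value at n = 1 is -log z - log(z + 1). The derivatives `g' m` are
  -- O(1/m²) on bounded sets, so the series may be differentiated termwise.
  set g : ℕ → ℂ → ℂ := fun m z => z * (Real.log (m + 2 : ℕ) - Real.log (m + 1 : ℕ) : ℝ) +
    Real.log (m + 2 : ℕ) - Complex.log (z + (m + 2 : ℕ)) with hg
  set g' : ℕ → ℂ → ℂ := fun m z => (Real.log (m + 2 : ℕ) - Real.log (m + 1 : ℕ) : ℝ) -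
    (z + (m + 2 : ℕ))⁻¹ with hg'
  have hL : ∀ z : ℂ, 0 < z.re → ∀ j : ℕ,
      HasDerivAt (fun z : ℂ => Complex.log (z + j)) (z + j)⁻¹ z := fun z hz j => by
    have := ((hasDerivAt_id z).add_const (j : ℂ)).clog (hslit z hz j)
    simpa using this
  have hder : ∀ m, ∀ z ∈ t, HasDerivAt (g m) (g' m z) z := fun m z hz => by
    have := (((hasDerivAt_id z).mul_const
      ((Real.log (m + 2 : ℕ) - Real.log (m + 1 : ℕ) : ℝ) : ℂ)).add_const
      (Real.log (m + 2 : ℕ) : ℂ)).sub (hL z hz.1 (m + 2))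
    rw [one_mul] at this
    exact this
  have hlogd : ∀ m : ℕ, (1 : ℝ) / (m + 2) ≤ Real.log (m + 2 : ℕ) - Real.log (m + 1 : ℕ) ∧
      Real.log (m + 2 : ℕ) - Real.log (m + 1 : ℕ) ≤ 1 / (m + 1) := fun m => by
    rw [← Real.log_div (by positivity) (by positivity)]
    push_cast
    have e1 : ((m : ℝ) + 2) / (m + 1) - 1 = 1 / (m + 1) := by field_simp; ring
    have e2 : 1 - (((m : ℝ) + 2) / (m + 1))⁻¹ = 1 / (m + 2) := by field_simp; ring
    exact ⟨e2 ▸ Real.one_sub_inv_le_log_of_pos (by positivity),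
      e1 ▸ Real.log_le_sub_one_of_pos (by positivity)⟩
  have hsum : Summable fun m : ℕ => (1 + R) * (1 / ((m : ℝ) + 1) ^ 2) := by
    refine Summable.mul_left _ ?_
    have := (summable_nat_add_iff 1).2 (Real.summable_one_div_nat_pow.2 one_lt_two)
    simpa using this
  have hbd : ∀ m, ∀ z ∈ t, ‖g' m z‖ ≤ (1 + R) * (1 / ((m : ℝ) + 1) ^ 2) := fun m z hz => by
    have e : g' m z = ((Real.log (m + 2 : ℕ) - Real.log (m + 1 : ℕ) - 1 / (m + 2) : ℝ) : ℂ) +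
        z / ((m + 2) * (z + (m + 2 : ℕ))) := by
      have h1 := hne z hz.1 (m + 2)
      have h2 : (m : ℂ) + 2 ≠ 0 := by exact_mod_cast (by positivity : (m : ℝ) + 2 ≠ 0)
      simp only [hg']
      push_cast at h1 ⊢
      field_simp
      ring
    rw [e, add_mul (1 : ℝ) R, one_mul]
    refine (norm_add_le _ _).trans (add_le_add ?_ ?_)
    · rw [Complex.norm_real, Real.norm_of_nonneg (by linarith [(hlogd m).1])]
      have : (1 : ℝ) / (m + 1) - 1 / (m + 2) ≤ 1 / ((m : ℝ) + 1) ^ 2 := by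
        rw [div_sub_div _ _ (by positivity) (by positivity), div_le_div_iff₀ (by positivity)
          (by positivity)]
        have : (0 : ℝ) ≤ m := Nat.cast_nonneg m
        nlinarith
      linarith [(hlogd m).2]
    · have h1 : (m : ℝ) + 1 ≤ ‖z + (m + 2 : ℕ)‖ := by
        refine le_trans ?_ (Complex.re_le_norm _)
        rw [Complex.add_re, Complex.natCast_re]
        push_cast
        have : 0 < z.re := hz.1
        linarith
      have h2 : ‖(m : ℂ) + 2‖ = m + 2 := by
        rw [show (m : ℂ) + 2 = ((m + 2 : ℝ) : ℂ) by push_cast; rfl, Complex.norm_real,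
          Real.norm_of_nonneg (by positivity)]
      rw [norm_div, norm_mul, h2, ← mul_one_div]
      refine mul_le_mul (mem_ball_zero_iff.1 hz.2).le ?_ (by positivity) (by positivity)
      rw [sq]
      gcongr
      linarith
  have hg1 : Summable fun m => g m 1 := by
    refine Summable.of_norm_bounded hsum fun m => ?_
    have e : g m 1 = ((Real.log (m + 2 : ℕ) - Real.log (m + 1 : ℕ) -
        (Real.log ((m + 1 : ℕ) + 2 : ℕ) - Real.log ((m + 1 : ℕ) + 1 : ℕ)) : ℝ) : ℂ) := by
      simp only [hg]
      have : (1 : ℂ) + (m + 2 : ℕ) = ((m + 3 : ℕ) : ℝ) := by push_cast; ring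
      rw [this, ← Complex.ofReal_log (by positivity)]
      push_cast
      ring_nf
    have h1 := hlogd m
    have h2 := hlogd (m + 1)
    have h5 : (1 : ℝ) / ((m + 1 : ℕ) + 1) = 1 / (m + 2) := by push_cast; ring
    have h6 : (1 : ℝ) / ((m + 1 : ℕ) + 2) = 1 / (m + 3) := by push_cast; ring
    rw [h5, h6] at h2
    have : (1 : ℝ) / (m + 1) - 1 / (m + 3) ≤ 2 * (1 / ((m : ℝ) + 1) ^ 2) := by
      rw [div_sub_div _ _ (by positivity) (by positivity), mul_one_div, div_le_div_iff₀ (by positivity)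
        (by positivity)]
      have : (0 : ℝ) ≤ m := Nat.cast_nonneg m
      nlinarith [pow_nonneg this 3]
    have h4 : 2 * (1 / ((m : ℝ) + 1) ^ 2) ≤ (1 + R) * (1 / ((m : ℝ) + 1) ^ 2) := by
      gcongr; linarith
    rw [e, Complex.norm_real, Real.norm_of_nonneg (by linarith)]
    linarith
  set G : ℂ → ℂ := fun z => -Complex.log z - Complex.log (z + 1) + ∑' m, g m z with hG
  have hGd : ∀ z ∈ t, HasDerivAt G (-z⁻¹ - (z + 1)⁻¹ + ∑' m, g' m z) z := fun z hz => by
    have h0 := hL z hz.1 0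
    have h1 := hL z hz.1 1
    simp only [Nat.cast_zero, add_zero, Nat.cast_one] at h0 h1
    exact (h0.neg.sub h1).add
      (hasDerivAt_tsum_of_isPreconnected hsum hto htc hder hbd h1t hg1 hz)
  have hpart : ∀ z : ℂ, ∀ M : ℕ, -Complex.log z - Complex.log (z + 1) + ∑ m ∈ range M, g m z =
      z * Real.log (M + 1 : ℕ) + Real.log ((M + 1).factorial) -
        ∑ j ∈ range (M + 2), Complex.log (z + j) := by
    intro z M
    induction M with
    | zero => simp [Finset.sum_range_succ]; ring_nf
    | succ M ih =>
      rw [Finset.sum_range_succ, ← add_assoc, ih, Finset.sum_range_succ _ (M + 2),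
        Nat.factorial_succ (M + 1), Nat.cast_mul, Real.log_mul (by positivity) (by positivity)]
      simp only [hg]
      push_cast
      ring_nf
  have hpart' : ∀ M : ℕ, -w⁻¹ - (w + 1)⁻¹ + ∑ m ∈ range M, g' m w =
      Real.log (M + 1 : ℕ) - ∑ j ∈ range (M + 2), (w + j)⁻¹ := by
    intro M
    induction M with
    | zero => simp [Finset.sum_range_succ]; ring_nf
    | succ M ih =>
      rw [Finset.sum_range_succ, ← add_assoc, ih, Finset.sum_range_succ _ (M + 2)]
      simp only [hg']
      push_cast
      ring_nf
  have hexp : ∀ z ∈ t, Complex.exp (G z) = Complex.Gamma z := fun z hz => by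
    have hs := summable_of_summable_hasDerivAt_of_isPreconnected hsum hto htc hder hbd h1t hg1 hz
    have h1 := (Complex.continuous_exp.tendsto _).comp
      (hs.hasSum.tendsto_sum_nat.const_add (-Complex.log z - Complex.log (z + 1)))
    have h2 := (Complex.GammaSeq_tendsto_Gamma z).comp (tendsto_add_atTop_nat 1)
    refine tendsto_nhds_unique h1 (h2.congr fun M => ?_)
    simp only [Function.comp, hpart]
    rw [Complex.exp_sub, Complex.exp_add, Complex.exp_sum, Complex.GammaSeq]
    congr 1
    · rw [Complex.cpow_def_of_ne_zero (by exact_mod_cast (Nat.succ_ne_zero M)), mul_comm z,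
        ← Complex.ofReal_exp (Real.log _), Real.exp_log (by positivity), Complex.natCast_log]
      push_cast
      rfl
    · exact Finset.prod_congr rfl fun j _ => (Complex.exp_log (hne z hz.1 j)).symm
  have hψ : Complex.digamma w = -w⁻¹ - (w + 1)⁻¹ + ∑' m, g' m w := by
    have hev : Complex.Gamma =ᶠ[𝓝 w] fun z => Complex.exp (G z) :=
      Filter.eventuallyEq_of_mem (hto.mem_nhds hwt) fun z hz => (hexp z hz).symm
    rw [Complex.digamma_def, logDeriv_apply, hev.deriv_eq, hev.eq_of_nhds, (hGd w hwt).cexp.deriv,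
      mul_div_cancel_left₀ _ (Complex.exp_ne_zero _)]
  have hs' : Summable fun m => g' m w := Summable.of_norm_bounded hsum fun m => hbd m w hwt
  rw [hψ]
  exact (hs'.hasSum.tendsto_sum_nat.const_add _).congr hpart'

/-- One step of the comparison of the digamma function with the logarithm. -/
theorem norm_inv_sub_log_le {z : ℂ} (hz : 0 < z.re) :
    ‖z⁻¹ - (Complex.log (z + 1) - Complex.log z)‖ ≤ 1 / ‖z‖ ^ 2 := by
  have hz0 : z ≠ 0 := fun h => by simp [h] at hz
  have hre : ∀ t : ℝ, 0 ≤ t → 0 < (z + t).re := fun t ht => by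
    rw [Complex.add_re, Complex.ofReal_re]; linarith
  have hd : ∀ t ∈ Set.Icc (0 : ℝ) 1, HasDerivWithinAt
      (fun t : ℝ => t * z⁻¹ - Complex.log (z + t)) (z⁻¹ - (z + t)⁻¹) (Set.Icc 0 1) t := by
    intro t ht
    have h1 : HasDerivAt (fun t : ℝ => (t : ℂ)) 1 t := Complex.ofRealCLM.hasDerivAt
    have h2 := (h1.mul_const z⁻¹).sub ((h1.const_add z).clog_real (Or.inl (hre t ht.1)))
    rw [one_mul, one_div] at h2
    exact h2.hasDerivWithinAt
  have h := norm_image_sub_le_of_norm_deriv_le_segment_01' (C := 1 / ‖z‖ ^ 2) hd fun t ht => ?_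
  · simp only [Complex.ofReal_one, one_mul, Complex.ofReal_zero, zero_mul, add_zero, zero_sub,
      sub_neg_eq_add] at h
    rwa [← sub_add]
  · have h0 : z + t ≠ 0 := fun h => by have := hre t ht.1; simp [h] at this
    have e : z⁻¹ - (z + t)⁻¹ = t / (z * (z + t)) := by field_simp; ring
    have h3 : ‖z‖ ≤ ‖z + t‖ := by
      rw [← sq_le_sq₀ (norm_nonneg _) (norm_nonneg _), ← Complex.normSq_eq_norm_sq,
        ← Complex.normSq_eq_norm_sq, Complex.normSq_apply, Complex.normSq_apply, Complex.add_re,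
        Complex.add_im, Complex.ofReal_re, Complex.ofReal_im, add_zero]
      nlinarith [mul_nonneg hz.le ht.1]
    have h4 : 0 < ‖z‖ := norm_pos_iff.2 hz0
    rw [e, norm_div, norm_mul, Complex.norm_real, Real.norm_of_nonneg ht.1, sq]
    gcongr
    exact ht.2.le

open Finset in
/-- A comparison of a sum over an arithmetic progression in the right half-plane with an integral. -/
theorem sum_inv_norm_add_sq_le {w : ℂ} (hw : 1 / 2 ≤ w.re) (n : ℕ) :
    ∑ j ∈ range n, 1 / ‖w + j‖ ^ 2 ≤ 6 / ‖w‖ := by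
  set a := ‖w‖ with ha
  have ha2 : 1 / 2 ≤ a := hw.trans (Complex.re_le_norm w)
  have h1 : ∀ j : ℕ, 1 / ‖w + j‖ ^ 2 ≤ 2 * (1 / (a + j) ^ 2) := fun j => by
    have : (a + j) ^ 2 ≤ 2 * ‖w + j‖ ^ 2 := by
      have e1 : a ^ 2 = w.re * w.re + w.im * w.im := by
        rw [ha, ← Complex.normSq_eq_norm_sq, Complex.normSq_apply]
      have e2 : ‖w + j‖ ^ 2 = (w.re + j) * (w.re + j) + w.im * w.im := by
        rw [← Complex.normSq_eq_norm_sq, Complex.normSq_apply]; simp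
      have : (0 : ℝ) ≤ j := Nat.cast_nonneg j
      nlinarith [sq_nonneg (a - j), mul_nonneg (by linarith : 0 ≤ w.re) this]
    have h0 : 0 < (a + j) ^ 2 := by positivity
    rw [mul_one_div, div_le_div_iff₀ (by linarith) h0]
    linarith
  have h2 : ∑ j ∈ range n, 1 / (a + j) ^ 2 ≤ 3 * (1 / a - 1 / (a + n)) := by
    induction n with
    | zero => simp
    | succ n ih =>
      rw [sum_range_succ]
      refine (add_le_add_left ih _).trans ?_
      have h3 : 0 < a + n := by positivity
      have h4 : 1 / (a + n) ^ 2 ≤ 3 * (1 / (a + n) - 1 / (a + n + 1)) := by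
        have : (1 : ℝ) / 2 ≤ a + n := by have : (0 : ℝ) ≤ n := Nat.cast_nonneg n
                                         linarith
        rw [div_sub_div _ _ h3.ne' (by positivity), mul_div_assoc', div_le_div_iff₀ (by positivity)
          (by positivity)]
        nlinarith
      push_cast
      rw [← add_assoc]
      linarith
  calc ∑ j ∈ range n, 1 / ‖w + j‖ ^ 2 ≤ ∑ j ∈ range n, 2 * (1 / (a + j) ^ 2) :=
        sum_le_sum fun j _ => h1 j
    _ ≤ 2 * (3 * (1 / a - 1 / (a + n))) := by rw [← mul_sum]; gcongr
    _ ≤ 6 / a := by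
      have : 0 ≤ 1 / (a + n) := by positivity
      have e : 6 / a = 6 * (1 / a) := by ring
      linarith

open Finset Filter Topology in
/-- The digamma function is close to the logarithm in a right half-plane. -/
theorem norm_digamma_sub_log_le {w : ℂ} (hw : 1 / 2 ≤ w.re) :
    ‖Complex.digamma w - Complex.log w‖ ≤ 6 / ‖w‖ := by
  have hw0 : 0 < w.re := by linarith
  set u : ℕ → ℂ := fun j => (w + j)⁻¹ - (Complex.log (w + j + 1) - Complex.log (w + j)) with hu
  have hre : ∀ j : ℕ, 0 < (w + j).re := fun j => by
    rw [Complex.add_re, Complex.natCast_re]; positivity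
  have hlim : Tendsto (fun m : ℕ => (Real.log (m + 1 : ℕ) : ℂ) - Complex.log (w + (m + 2 : ℕ)))
      atTop (𝓝 0) := by
    have h1 : ∀ m : ℕ, (Real.log (m + 1 : ℕ) : ℂ) - Complex.log (w + (m + 2 : ℕ)) =
        -Complex.log (1 + (w + 1) / (m + 1 : ℕ)) := fun m => by
      have e : w + (m + 2 : ℕ) = ((m + 1 : ℕ) : ℝ) * (1 + (w + 1) / (m + 1 : ℕ)) := by
        have : ((m : ℂ) + 1) ≠ 0 := by exact_mod_cast (Nat.succ_ne_zero m)
        push_cast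
        field_simp
        ring
      rw [e, Complex.log_ofReal_mul (by positivity)]
      · ring
      · intro h
        have h2 := congrArg Complex.re e
        rw [h, mul_zero, Complex.zero_re] at h2
        exact (hre (m + 2)).ne' h2
    simp_rw [h1]
    have h2 : Tendsto (fun m : ℕ => 1 + (w + 1) / ((m + 1 : ℕ) : ℂ)) atTop (𝓝 (1 + 0)) := by
      refine tendsto_const_nhds.add ?_
      have : Tendsto (fun m : ℕ => ((m : ℝ) + 1)⁻¹) atTop (𝓝 0) :=
        tendsto_inv_atTop_zero.comp (tendsto_atTop_add_const_right _ _ tendsto_natCast_atTop_atTop)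
      have h3 := ((Complex.continuous_ofReal.tendsto _).comp this).const_mul (w + 1)
      rw [Complex.ofReal_zero, mul_zero] at h3
      refine h3.congr fun m => ?_
      simp [div_eq_mul_inv]
    rw [add_zero] at h2
    have h4 := ((continuousAt_clog Complex.one_mem_slitPlane).tendsto.comp h2).neg
    simpa using h4
  have hpart : ∀ n : ℕ, ∑ j ∈ range n, u j =
      ∑ j ∈ range n, (w + j)⁻¹ - (Complex.log (w + n) - Complex.log w) := by
    intro n
    induction n with
    | zero => simp
    | succ n ih =>
      rw [sum_range_succ, ih, sum_range_succ]
      simp only [hu]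
      push_cast
      ring_nf
  have hT := (tendsto_digamma hw0).sub hlim |>.sub_const (Complex.log w)
  rw [sub_zero] at hT
  refine le_of_tendsto hT.norm (Eventually.of_forall fun m => ?_)
  have e : (Real.log (m + 1 : ℕ) : ℂ) - ∑ j ∈ range (m + 2), (w + j)⁻¹ -
      ((Real.log (m + 1 : ℕ) : ℂ) - Complex.log (w + (m + 2 : ℕ))) - Complex.log w =
      -∑ j ∈ range (m + 2), u j := by
    rw [hpart]; ring
  rw [e, norm_neg]
  exact (norm_sum_le_of_le _ fun j _ => norm_inv_sub_log_le (hre j)).trans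
    (sum_inv_norm_add_sq_le hw _)

/-- The digamma function is analytic in the right half-plane. -/
theorem differentiableOn_digamma : DifferentiableOn ℂ Complex.digamma {w | 0 < w.re} := by
  have ho : IsOpen {w : ℂ | 0 < w.re} := isOpen_lt continuous_const Complex.continuous_re
  have h1 : DifferentiableOn ℂ Complex.Gamma {w | 0 < w.re} := fun w hw =>
    (Complex.differentiableAt_Gamma w fun m h => by
      rw [h] at hw
      simp only [Set.mem_ofPred_eq, Complex.neg_re, Complex.natCast_re] at hw
      linarith [(Nat.cast_nonneg m : (0 : ℝ) ≤ m)]).differentiableWithinAt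
  exact (h1.deriv ho).div h1 fun w hw => Complex.Gamma_ne_zero_of_re_pos hw

/-- A lower bound for the real part of the digamma function. -/
theorem log_norm_sub_le_re_digamma {w : ℂ} (hw : 1 / 2 ≤ w.re) :
    Real.log ‖w‖ - 12 ≤ (Complex.digamma w).re := by
  have h1 := norm_digamma_sub_log_le hw
  have h2 : 6 / ‖w‖ ≤ 12 := by
    have : 1 / 2 ≤ ‖w‖ := hw.trans (Complex.re_le_norm w)
    rw [div_le_iff₀ (by linarith)]
    linarith
  have h3 := (abs_le.1 ((Complex.abs_re_le_norm _).trans h1)).1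
  rw [Complex.sub_re, Complex.log_re] at h3
  linarith

open Metric in
/-- An upper bound for the derivative of the digamma function. -/
theorem norm_deriv_digamma_le {w : ℂ} (hw : 1 ≤ w.re) :
    ‖deriv Complex.digamma w‖ ≤ 25 / ‖w‖ := by
  have hn : 1 ≤ ‖w‖ := hw.trans (Complex.re_le_norm w)
  have hre : ∀ z ∈ closedBall w (1 / 2), 1 / 2 ≤ z.re := fun z hz => by
    have := (Complex.abs_re_le_norm (z - w)).trans (mem_closedBall_iff_norm.1 hz)
    rw [Complex.sub_re] at this
    linarith [(abs_le.1 this).1]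
  have hd : ∀ z ∈ closedBall w (1 / 2), DifferentiableAt ℂ Complex.digamma z := fun z hz =>
    differentiableOn_digamma.differentiableAt
      ((isOpen_lt continuous_const Complex.continuous_re).mem_nhds
        (show 0 < z.re by linarith [hre z hz]))
  have hl : ∀ z ∈ closedBall w (1 / 2), HasDerivAt Complex.log z⁻¹ z := fun z hz =>
    Complex.hasDerivAt_log (Or.inl (by linarith [hre z hz]))
  have hwb : w ∈ closedBall w (1 / 2) := mem_closedBall_self (by norm_num)
  -- Cauchy's estimate for ψ - log on radius 1/2: the bound 12/‖w‖ becomes 24/‖w‖, and the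
  -- derivative 1/w of log adds the last unit of 25.
  have h1 := Complex.norm_deriv_le_of_forall_mem_sphere_norm_le (c := w) (R := 1 / 2)
    (C := 12 / ‖w‖) (f := fun z => Complex.digamma z - Complex.log z) (by norm_num)
    (DifferentiableOn.diffContOnCl_ball (U := closedBall w (1 / 2)) (fun z hz =>
      ((hd z hz).sub (hl z hz).differentiableAt).differentiableWithinAt) le_rfl)
    fun z hz => by
      refine (norm_digamma_sub_log_le (hre z (sphere_subset_closedBall hz))).trans ?_
      have h2 := mem_sphere_iff_norm.1 hz
      have h3 := norm_sub_norm_le w z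
      rw [norm_sub_rev, h2] at h3
      rw [div_le_div_iff₀ (by linarith) (by linarith)]
      linarith
  have h2 : deriv (fun z => Complex.digamma z - Complex.log z) w =
      deriv Complex.digamma w - w⁻¹ := ((hd w hwb).hasDerivAt.sub (hl w hwb)).deriv
  rw [h2] at h1
  have h3 := norm_sub_norm_le (deriv Complex.digamma w) w⁻¹
  rw [norm_inv] at h3
  have e1 : 12 / ‖w‖ / (1 / 2) = 24 * ‖w‖⁻¹ := by ring
  have e2 : 25 / ‖w‖ = 25 * ‖w‖⁻¹ := by ring
  linarith

/-- The digamma function is real on the real axis. -/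
theorem digamma_conj (w : ℂ) :
    Complex.digamma ((starRingEnd ℂ) w) = (starRingEnd ℂ) (Complex.digamma w) := by
  have h : (starRingEnd ℂ) ∘ Complex.Gamma ∘ (starRingEnd ℂ) = Complex.Gamma := by
    funext z
    simp [Complex.Gamma_conj]
  have h2 := congrFun (deriv_conj_conj (𝕜 := ℂ) (f := Complex.Gamma)) ((starRingEnd ℂ) w)
  rw [h] at h2
  rw [Complex.digamma_def, logDeriv_apply, logDeriv_apply, Complex.Gamma_conj, map_div₀, h2]
  simp

/-! ### Inverse Laplace transforms along vertical lines -/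

section

open MeasureTheory Filter Topology Set

/-- Moving a vertical line of integration. -/
theorem integral_vertical_eq {G : ℂ → ℂ} {a b B θ : ℝ} (hab : a ≤ b) (hθ : 0 < θ)
    (hG : DifferentiableOn ℂ G {s | a ≤ s.re}) (hB : ∀ x t : ℝ, a ≤ x → x ≤ b → 1 ≤ |t| →
      ‖G (x + t * Complex.I)‖ ≤ B * |t| ^ (-θ))
    (ha : Integrable fun t : ℝ => G (a + t * Complex.I))
    (hb : Integrable fun t : ℝ => G (b + t * Complex.I)) :
    ∫ t : ℝ, G (a + t * Complex.I) = ∫ t : ℝ, G (b + t * Complex.I) := by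
  have hhor : ∀ e : ℝ, |e| = 1 →
      Tendsto (fun T : ℝ => ∫ x in a..b, G (x + (e * T : ℝ) * Complex.I)) atTop (𝓝 0) := by
    intro e he
    have h0 : Tendsto (fun T : ℝ => B * T ^ (-θ) * |b - a|) atTop (𝓝 0) := by
      simpa using ((tendsto_rpow_neg_atTop hθ).const_mul B).mul_const |b - a|
    refine squeeze_zero_norm' ?_ h0
    filter_upwards [eventually_ge_atTop 1] with T hT
    have hT' : |e * T| = T := by rw [abs_mul, he, one_mul, abs_of_pos (by linarith)]
    refine intervalIntegral.norm_integral_le_of_norm_le_const fun x hx => ?_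
    rw [uIoc_of_le hab] at hx
    have := hB x (e * T) hx.1.le hx.2 (by rw [hT']; exact hT)
    rwa [hT'] at this
  have hv : ∀ c : ℝ, Integrable (fun t : ℝ => G (c + t * Complex.I)) →
      Tendsto (fun T : ℝ => ∫ t in (-T)..T, G (c + t * Complex.I)) atTop
        (𝓝 (∫ t : ℝ, G (c + t * Complex.I))) := fun c hc =>
    intervalIntegral_tendsto_integral hc tendsto_neg_atTop_atBot tendsto_id
  have hrect : ∀ T : ℝ, (∫ x in a..b, G (x + (-1 * T : ℝ) * Complex.I)) -
      (∫ x in a..b, G (x + (1 * T : ℝ) * Complex.I)) +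
      Complex.I * (∫ t in (-T)..T, G (b + t * Complex.I)) -
      Complex.I * (∫ t in (-T)..T, G (a + t * Complex.I)) = 0 := by
    intro T
    have := Complex.integral_boundary_rect_eq_zero_of_differentiableOn G ⟨a, -T⟩ ⟨b, T⟩
      (hG.mono fun s hs => ?_)
    · simpa using this
    · have h1 := hs.1
      simp only [mem_preimage, uIcc_of_le hab] at h1
      exact h1.1
  have hlim := ((((hhor (-1) (by norm_num)).sub (hhor 1 (by norm_num))).add
    ((hv b hb).const_mul Complex.I)).sub ((hv a ha).const_mul Complex.I))
  have h0 := tendsto_nhds_unique (hlim.congr hrect) tendsto_const_nhds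
  have h1 : Complex.I * ((∫ t : ℝ, G (b + t * Complex.I)) - ∫ t : ℝ, G (a + t * Complex.I)) = 0 := by
    linear_combination h0
  rcases mul_eq_zero.1 h1 with h | h
  · exact absurd h Complex.I_ne_zero
  · exact (sub_eq_zero.1 h).symm

/-- Powers of the modulus are integrable on vertical lines. -/
theorem integrable_norm_add_mul_I_rpow {σ θ : ℝ} (hσ : 0 < σ) (hθ : 1 < θ) :
    Integrable fun t : ℝ => ‖(σ + t * Complex.I : ℂ)‖ ^ (-θ) := by
  have h1 : Integrable fun t : ℝ => (2 * max 1 σ⁻¹) ^ θ * (1 + ‖t‖) ^ (-θ) :=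
    (integrable_one_add_norm (by simpa using hθ)).const_mul _
  have hpos : ∀ t : ℝ, 0 < ‖(σ + t * Complex.I : ℂ)‖ := fun t => by
    refine norm_pos_iff.2 fun h => ?_
    have := congrArg Complex.re h
    simp at this
    linarith
  refine h1.mono' (Continuous.aestronglyMeasurable ?_) (Eventually.of_forall fun t => ?_)
  · exact Continuous.rpow_const (by fun_prop) fun t => Or.inl (hpos t).ne'
  · rw [Real.norm_of_nonneg (by positivity), Real.rpow_neg (hpos t).le, Real.rpow_neg (by positivity),
      ← div_eq_mul_inv, ← inv_div, ← Real.div_rpow (by positivity) (by positivity)]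
    have hre : σ ≤ ‖(σ + t * Complex.I : ℂ)‖ := by
      simpa using Complex.re_le_norm (σ + t * Complex.I : ℂ)
    have him : |t| ≤ ‖(σ + t * Complex.I : ℂ)‖ := by
      simpa using Complex.abs_im_le_norm (σ + t * Complex.I : ℂ)
    have hm : 1 ≤ max 1 σ⁻¹ * ‖(σ + t * Complex.I : ℂ)‖ := by
      calc 1 = σ⁻¹ * σ := by rw [inv_mul_cancel₀ hσ.ne']
        _ ≤ _ := by gcongr; exact le_max_right _ _
    have hm2 : |t| ≤ max 1 σ⁻¹ * ‖(σ + t * Complex.I : ℂ)‖ := by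
      calc |t| = 1 * |t| := by rw [one_mul]
        _ ≤ _ := by gcongr; exact le_max_left _ _
    have hq : (1 + ‖t‖) / (2 * max 1 σ⁻¹) ≤ ‖(σ + t * Complex.I : ℂ)‖ := by
      rw [div_le_iff₀ (by positivity), Real.norm_eq_abs]
      linarith
    gcongr

/-- The dependence on the line of the integral of a power of the modulus. -/
theorem integral_norm_add_mul_I_rpow {σ θ : ℝ} (hσ : 0 < σ) :
    ∫ t : ℝ, ‖(σ + t * Complex.I : ℂ)‖ ^ (-θ) =
      σ ^ (1 - θ) * ∫ t : ℝ, ‖((1 : ℝ) + t * Complex.I : ℂ)‖ ^ (-θ) := by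
  have h := Measure.integral_comp_mul_left (fun t : ℝ => ‖(σ + t * Complex.I : ℂ)‖ ^ (-θ)) σ
  rw [abs_of_pos (inv_pos.2 hσ), smul_eq_mul] at h
  have e : ∀ t : ℝ, ‖(σ + (σ * t : ℝ) * Complex.I : ℂ)‖ ^ (-θ) =
      σ ^ (-θ) * ‖((1 : ℝ) + t * Complex.I : ℂ)‖ ^ (-θ) := fun t => by
    have : (σ + (σ * t : ℝ) * Complex.I : ℂ) = σ * ((1 : ℝ) + t * Complex.I) := by
      push_cast; ring
    rw [this, norm_mul, Complex.norm_real, Real.norm_of_nonneg hσ.le,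
      Real.mul_rpow hσ.le (norm_nonneg _)]
  simp_rw [e] at h
  rw [integral_const_mul] at h
  rw [sub_eq_add_neg, Real.rpow_add hσ, Real.rpow_one, mul_assoc, h, ← mul_assoc,
    mul_inv_cancel₀ hσ.ne', one_mul]

/-- The integral `∫ F(s) e^{sy} dt` over the vertical line `s = σ + it`. -/
noncomputable def verticalIntegral (σ : ℝ) (F : ℂ → ℂ) (y : ℝ) : ℂ :=
  ∫ t : ℝ, F (σ + t * Complex.I) * Complex.exp ((σ + t * Complex.I) * y)

/-- `F` is analytic to the right of `1` and bounded by a multiple of `|s|^(-θ)` to the right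
of `2`. -/
def LaplaceDecay (F : ℂ → ℂ) (θ B : ℝ) : Prop :=
  DifferentiableOn ℂ F {s | 1 < s.re} ∧ ∀ s : ℂ, 2 ≤ s.re → ‖F s‖ ≤ B * ‖s‖ ^ (-θ)

theorem norm_exp_vertical (σ t y : ℝ) :
    ‖Complex.exp ((σ + t * Complex.I) * y)‖ = Real.exp (σ * y) := by
  rw [Complex.norm_exp]
  simp

/-- A function that is differentiable to the right of `1` is continuous on vertical lines. -/
theorem continuous_vertical {F : ℂ → ℂ} (hF : DifferentiableOn ℂ F {s | 1 < s.re}) {σ : ℝ}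
    (hσ : 1 < σ) : Continuous fun t : ℝ => F (σ + t * Complex.I) :=
  hF.continuousOn.comp_continuous (by fun_prop) fun t => by simpa using hσ

namespace LaplaceDecay

variable {F : ℂ → ℂ} {θ B : ℝ}

theorem norm_le (h : LaplaceDecay F θ B) {σ : ℝ} (hσ : 2 ≤ σ) (t : ℝ) :
    ‖F (σ + t * Complex.I)‖ ≤ B * ‖(σ + t * Complex.I : ℂ)‖ ^ (-θ) :=
  h.2 _ (by simpa using hσ)

theorem nonneg (h : LaplaceDecay F θ B) : 0 ≤ B := by
  have := (norm_nonneg _).trans (h.2 2 (by simp))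
  exact nonneg_of_mul_nonneg_left this (Real.rpow_pos_of_pos (by simp) _)

theorem integrable (h : LaplaceDecay F θ B) (hθ : 1 < θ) {σ : ℝ} (hσ : 2 ≤ σ) :
    Integrable fun t : ℝ => F (σ + t * Complex.I) :=
  ((integrable_norm_add_mul_I_rpow (by linarith) hθ).const_mul B).mono'
    (continuous_vertical h.1 (by linarith)).aestronglyMeasurable
    (Eventually.of_forall fun t => h.norm_le hσ t)

theorem integrable_mul_exp (h : LaplaceDecay F θ B) (hθ : 1 < θ) {σ : ℝ} (hσ : 2 ≤ σ) (y : ℝ) :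
    Integrable fun t : ℝ => F (σ + t * Complex.I) * Complex.exp ((σ + t * Complex.I) * y) :=
  (h.integrable hθ hσ).mul_bdd (c := Real.exp (σ * y)) (Continuous.aestronglyMeasurable (by fun_prop))
    (Eventually.of_forall fun t => (norm_exp_vertical σ t y).le)

/-- The scaling t ↦ σt extracts σ^{1-θ}. The dependence on σ is kept explicit because σ is later
optimised: σ → ∞ for y ≤ 0, and σ = 1/y for small y > 0. -/
theorem norm_verticalIntegral_le (h : LaplaceDecay F θ B) (hθ : 1 < θ) {σ : ℝ} (hσ : 2 ≤ σ)
    (y : ℝ) : ‖verticalIntegral σ F y‖ ≤ B * (∫ t : ℝ, ‖((1 : ℝ) + t * Complex.I : ℂ)‖ ^ (-θ)) *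
      (σ ^ (1 - θ) * Real.exp (σ * y)) := by
  have hσ0 : 0 < σ := by linarith
  calc ‖verticalIntegral σ F y‖
      ≤ ∫ t : ℝ, B * ‖(σ + t * Complex.I : ℂ)‖ ^ (-θ) * Real.exp (σ * y) := by
        refine norm_integral_le_of_norm_le (((integrable_norm_add_mul_I_rpow hσ0 hθ).const_mul B).mul_const _)
          (Eventually.of_forall fun t => ?_)
        rw [norm_mul, norm_exp_vertical]
        exact mul_le_mul_of_nonneg_right (h.norm_le hσ t) (Real.exp_pos _).le
    _ = _ := by
        rw [integral_mul_const, integral_const_mul, integral_norm_add_mul_I_rpow hσ0]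
        ring

theorem verticalIntegral_eq (h : LaplaceDecay F θ B) (hθ : 1 < θ) {σ : ℝ} (hσ : 2 ≤ σ) (y : ℝ) :
    verticalIntegral 2 F y = verticalIntegral σ F y := by
  have hB0 := h.nonneg
  refine integral_vertical_eq (G := fun s => F s * Complex.exp (s * y)) (a := 2)
    (B := B * max (Real.exp (2 * y)) (Real.exp (σ * y))) (θ := θ) hσ (by linarith) ?_ ?_
    (h.integrable_mul_exp hθ le_rfl y) (h.integrable_mul_exp hθ hσ y)
  · exact (h.1.mono fun s hs => show 1 < s.re from lt_of_lt_of_le one_lt_two hs).mul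
      (Differentiable.differentiableOn (by fun_prop))
  · intro x t h2 hx ht
    rw [norm_mul, norm_exp_vertical, mul_right_comm]
    refine mul_le_mul ((h.norm_le h2 t).trans ?_) ?_ (Real.exp_pos _).le (by positivity)
    · have him : |t| ≤ ‖(x + t * Complex.I : ℂ)‖ := by
        simpa using Complex.abs_im_le_norm (x + t * Complex.I : ℂ)
      exact mul_le_mul_of_nonneg_left
        (Real.rpow_le_rpow_of_nonpos (by linarith) him (by linarith)) hB0
    · rcases le_total 0 y with hy | hy
      · exact le_max_of_le_right (Real.exp_le_exp.2 (by nlinarith))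
      · exact le_max_of_le_left (Real.exp_le_exp.2 (by nlinarith))

/-- The line can be moved to the right without limit: for y ≤ 0 the exponential is at most 1 and
σ^{1-θ} → 0. -/
theorem verticalIntegral_eq_zero (h : LaplaceDecay F θ B) (hθ : 1 < θ) {y : ℝ} (hy : y ≤ 0) :
    verticalIntegral 2 F y = 0 := by
  set M := B * (∫ t : ℝ, ‖((1 : ℝ) + t * Complex.I : ℂ)‖ ^ (-θ)) with hM
  have hM0 : 0 ≤ M := mul_nonneg h.nonneg (integral_nonneg fun t => by positivity)
  have hlim : Tendsto (fun σ : ℝ => M * σ ^ (1 - θ)) atTop (𝓝 0) := by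
    have := (tendsto_rpow_neg_atTop (show 0 < θ - 1 by linarith)).const_mul M
    rw [mul_zero, neg_sub] at this
    exact this
  have hle : ∀ᶠ σ : ℝ in atTop, ‖verticalIntegral 2 F y‖ ≤ M * σ ^ (1 - θ) := by
    filter_upwards [eventually_ge_atTop 2] with σ hσ
    rw [h.verticalIntegral_eq hθ hσ]
    refine (h.norm_verticalIntegral_le hθ hσ y).trans (mul_le_mul_of_nonneg_left ?_ hM0)
    refine mul_le_of_le_one_right (by positivity) (Real.exp_le_one_iff.2 ?_)
    exact mul_nonpos_of_nonneg_of_nonpos (by linarith) hy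
  exact norm_le_zero_iff.1 (ge_of_tendsto hlim hle)

/-- On the line σ = 1/y the exponential is e and the remaining factor is y^{θ-1}; y ≤ 1/2 makes this
line admissible. -/
theorem exists_norm_verticalIntegral_le (h : LaplaceDecay F θ B) (hθ : 1 < θ) :
    ∃ C, 0 ≤ C ∧ ∀ y, 0 < y → y ≤ 1 / 2 → ‖verticalIntegral 2 F y‖ ≤ C * y ^ (θ - 1) := by
  refine ⟨B * (∫ t : ℝ, ‖((1 : ℝ) + t * Complex.I : ℂ)‖ ^ (-θ)) * Real.exp 1, mul_nonneg
    (mul_nonneg h.nonneg (integral_nonneg fun t => by positivity)) (Real.exp_pos _).le,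
    fun y hy hy2 => ?_⟩
  have hσ : 2 ≤ y⁻¹ := by
    rw [le_inv_comm₀ (by norm_num) hy]
    linarith
  rw [h.verticalIntegral_eq hθ hσ]
  refine (h.norm_verticalIntegral_le hθ hσ y).trans_eq ?_
  rw [inv_mul_cancel₀ hy.ne', Real.inv_rpow hy.le, ← Real.rpow_neg hy.le, neg_sub]
  ring

theorem continuous_verticalIntegral (h : LaplaceDecay F θ B) (hθ : 1 < θ) :
    Continuous (verticalIntegral 2 F) := by
  refine continuous_iff_continuousAt.2 fun y₀ => ?_
  refine continuousAt_of_dominated (bound := fun t : ℝ => ‖F ((2 : ℝ) + t * Complex.I)‖ *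
    Real.exp (2 * (|y₀| + 1))) (Eventually.of_forall fun y =>
      (h.integrable_mul_exp hθ le_rfl y).aestronglyMeasurable) ?_
    ((h.integrable hθ le_rfl).norm.mul_const _) (Eventually.of_forall fun t => by fun_prop)
  filter_upwards [Metric.ball_mem_nhds y₀ one_pos] with y hy
  refine Eventually.of_forall fun t => ?_
  rw [norm_mul, norm_exp_vertical]
  have h1 : y ≤ |y₀| + 1 := by
    have := (abs_lt.1 (Real.dist_eq y y₀ ▸ Metric.mem_ball.1 hy)).2
    linarith [le_abs_self y₀]
  gcongr

end LaplaceDecay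

end

/-! ### Derivatives of inverse Laplace transforms -/

section

open MeasureTheory Filter Topology Set

namespace LaplaceDecay

variable {F : ℂ → ℂ} {θ B B' : ℝ}

theorem of_id_mul_deriv (h : LaplaceDecay F θ B)
    (h' : LaplaceDecay (fun s => s * deriv F s) θ B') : LaplaceDecay (deriv F) θ B' := by
  refine ⟨h.1.deriv (isOpen_lt continuous_const Complex.continuous_re), fun s hs => ?_⟩
  have h1 := h'.2 s hs
  have h2 : 1 ≤ ‖s‖ := le_trans (by linarith) (Complex.re_le_norm s)
  rw [norm_mul] at h1
  exact (le_mul_of_one_le_left (norm_nonneg _) h2).trans h1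

/-- Integration by parts along the line: the derivative in t of F(s) e^{sy} is integrable and has
integral 0. -/
theorem mul_verticalIntegral (h : LaplaceDecay F θ B)
    (h' : LaplaceDecay (fun s => s * deriv F s) θ B') (hθ : 1 < θ) (y : ℝ) :
    y * verticalIntegral 2 F y = -verticalIntegral 2 (deriv F) y := by
  have ho : IsOpen {s : ℂ | 1 < s.re} := isOpen_lt continuous_const Complex.continuous_re
  have hI := h.integrable_mul_exp hθ le_rfl y
  have hI' := (h.of_id_mul_deriv h').integrable_mul_exp hθ le_rfl y
  have hd : ∀ t : ℝ, HasDerivAt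
      (fun t : ℝ => F ((2 : ℝ) + t * Complex.I) * Complex.exp (((2 : ℝ) + t * Complex.I) * y))
      (Complex.I * (deriv F ((2 : ℝ) + t * Complex.I) * Complex.exp (((2 : ℝ) + t * Complex.I) * y)) +
        Complex.I * y * (F ((2 : ℝ) + t * Complex.I) *
          Complex.exp (((2 : ℝ) + t * Complex.I) * y))) t := by
    intro t
    have hl : HasDerivAt (fun t : ℝ => ((2 : ℝ) + t * Complex.I : ℂ)) Complex.I t := by
      have h1 : HasDerivAt (fun t : ℝ => (t : ℂ)) 1 t := Complex.ofRealCLM.hasDerivAt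
      simpa using (h1.mul_const Complex.I).const_add ((2 : ℝ) : ℂ)
    have hF : HasDerivAt F (deriv F ((2 : ℝ) + t * Complex.I)) ((2 : ℝ) + t * Complex.I) :=
      (h.1.differentiableAt (ho.mem_nhds (by simp))).hasDerivAt
    have h2 := (hF.comp t hl).mul (hl.mul_const (y : ℂ)).cexp
    refine h2.congr_deriv ?_
    simp only [Function.comp]
    ring
  have h0 := integral_eq_zero_of_hasDerivAt_of_integrable hd
    ((hI'.const_mul _).add (hI.const_mul _)) hI
  rw [integral_add (hI'.const_mul _) (hI.const_mul _), integral_const_mul, integral_const_mul] at h0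
  have h3 : Complex.I * (verticalIntegral 2 (deriv F) y + y * verticalIntegral 2 F y) = 0 := by
    rw [verticalIntegral, verticalIntegral]
    linear_combination h0
  linear_combination (mul_eq_zero.1 h3).resolve_left Complex.I_ne_zero

theorem hasDerivAt_verticalIntegral_of_id_mul (h : LaplaceDecay F θ B)
    (h' : LaplaceDecay (fun s => s * F s) θ B') (hθ : 1 < θ) (y₀ : ℝ) :
    HasDerivAt (verticalIntegral 2 F) (verticalIntegral 2 (fun s => s * F s) y₀) y₀ := by
  refine (hasDerivAt_integral_of_dominated_loc_of_deriv_le (𝕜 := ℝ)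
    (s := Metric.ball y₀ 1)
    (F := fun y t => F ((2 : ℝ) + t * Complex.I) * Complex.exp (((2 : ℝ) + t * Complex.I) * y))
    (F' := fun y t => ((2 : ℝ) + t * Complex.I) * F ((2 : ℝ) + t * Complex.I) *
      Complex.exp (((2 : ℝ) + t * Complex.I) * y))
    (bound := fun t : ℝ => ‖((2 : ℝ) + t * Complex.I) * F ((2 : ℝ) + t * Complex.I)‖ *
      Real.exp (2 * (|y₀| + 1))) (Metric.ball_mem_nhds y₀ one_pos)
    (Eventually.of_forall fun y => (h.integrable_mul_exp hθ le_rfl y).aestronglyMeasurable)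
    (h.integrable_mul_exp hθ le_rfl y₀)
    (h'.integrable_mul_exp hθ le_rfl y₀).aestronglyMeasurable ?_
    ((h'.integrable hθ le_rfl).norm.mul_const _) ?_).2
  · refine Eventually.of_forall fun t y hy => ?_
    rw [norm_mul, norm_exp_vertical]
    have h1 : y ≤ |y₀| + 1 := by
      have := (abs_lt.1 (Real.dist_eq y y₀ ▸ Metric.mem_ball.1 hy)).2
      linarith [le_abs_self y₀]
    gcongr
  · refine Eventually.of_forall fun t y _ => ?_
    have h1 : HasDerivAt (fun y : ℝ => (y : ℂ)) 1 y := Complex.ofRealCLM.hasDerivAt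
    refine ((h1.const_mul ((2 : ℝ) + t * Complex.I : ℂ)).cexp.const_mul
      (F ((2 : ℝ) + t * Complex.I))).congr_deriv ?_
    ring

/-- Differentiating the transform of F directly would bring down a factor s and require decay of
sF(s), which is not assumed. Away from y = 0 the transform is -1/y times that of F', and for F' the
extra factor is harmless, because sF'(s) decays like F. -/
theorem hasDerivAt_verticalIntegral (h : LaplaceDecay F θ B)
    (h' : LaplaceDecay (fun s => s * deriv F s) θ B') (hθ : 1 < θ) {y : ℝ} (hy : y ≠ 0) :
    HasDerivAt (verticalIntegral 2 F)
      (-(verticalIntegral 2 (fun s => s * deriv F s) y + verticalIntegral 2 F y) / y) y := by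
  have hyC : (y : ℂ) ≠ 0 := by exact_mod_cast hy
  have h1 := (h.of_id_mul_deriv h').hasDerivAt_verticalIntegral_of_id_mul h' hθ y
  have h2 : HasDerivAt (fun y : ℝ => (y : ℂ)) 1 y := Complex.ofRealCLM.hasDerivAt
  have h3 := h1.neg.div h2 hyC
  have hev : verticalIntegral 2 F =ᶠ[𝓝 y] fun x => -verticalIntegral 2 (deriv F) x / x := by
    filter_upwards [isOpen_ne.mem_nhds hy] with x hx
    have hxC : (x : ℂ) ≠ 0 := by exact_mod_cast hx
    rw [← h.mul_verticalIntegral h' hθ, mul_div_cancel_left₀ _ hxC]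
  refine (h3.congr_of_eventuallyEq hev).congr_deriv ?_
  rw [Pi.neg_apply, ← h.mul_verticalIntegral h' hθ]
  field_simp
  ring

end LaplaceDecay

end

/-! ### The archimedean factor -/

section

open MeasureTheory Filter Topology Set

/-- The contribution of the gamma factor and of the polynomial factors of `ξ` to
`exp (-2θ ξ'/ξ)`. -/
noncomputable def archimedeanFactor (θ : ℝ) (s : ℂ) : ℂ :=
  Complex.exp (-2 * θ * (1 / s + 1 / (s - 1)) + θ * Real.log Real.pi -
    θ * Complex.digamma (s / 2))

theorem re_half_pos {s : ℂ} (hs : 1 < s.re) : 1 / 2 ≤ (s / 2).re := by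
  rw [Complex.div_ofNat_re]; linarith

/-- Re 1/s and Re 1/(s - 1) are nonnegative and enter with a negative sign, so only the term -θ Re
ψ(s/2) ≤ -θ(log ‖s‖ - log 2 - 12) matters. -/
theorem norm_archimedeanFactor_le {θ : ℝ} (hθ : 0 ≤ θ) {s : ℂ} (hs : 1 < s.re) :
    ‖archimedeanFactor θ s‖ ≤
      Real.exp (θ * (Real.log Real.pi + Real.log 2 + 12)) * ‖s‖ ^ (-θ) := by
  have hs0 : 0 < ‖s‖ := lt_of_lt_of_le (by linarith) (Complex.re_le_norm s)
  rw [archimedeanFactor, Complex.norm_exp, Real.rpow_def_of_pos hs0, ← Real.exp_add,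
    Real.exp_le_exp]
  have h1 := log_norm_sub_le_re_digamma (re_half_pos hs)
  have h2 : 0 ≤ (1 / s).re := by
    rw [one_div, Complex.inv_re]
    exact div_nonneg (by linarith) (Complex.normSq_nonneg _)
  have h3 : 0 ≤ (1 / (s - 1)).re := by
    rw [one_div, Complex.inv_re, Complex.sub_re, Complex.one_re]
    exact div_nonneg (by linarith) (Complex.normSq_nonneg _)
  have e : (-2 * θ * (1 / s + 1 / (s - 1)) + θ * Real.log Real.pi -
      θ * Complex.digamma (s / 2) : ℂ).re = -2 * θ * ((1 / s).re + (1 / (s - 1)).re) +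
      θ * Real.log Real.pi - θ * (Complex.digamma (s / 2)).re := by
    rw [Complex.sub_re, Complex.add_re, Complex.re_ofReal_mul, Complex.re_ofReal_mul,
      Complex.ofReal_re, show (-2 * θ * (1 / s + 1 / (s - 1)) : ℂ) =
      ((-2 * θ : ℝ) : ℂ) * (1 / s + 1 / (s - 1)) by push_cast; rfl, Complex.re_ofReal_mul,
      Complex.add_re]
  rw [e]
  rw [norm_div, Complex.norm_ofNat, Real.log_div hs0.ne' two_ne_zero] at h1
  have h4 := mul_le_mul_of_nonneg_left h1 hθ
  have h5 := mul_nonneg hθ (add_nonneg h2 h3)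
  linarith

theorem hasDerivAt_archimedeanFactor (θ : ℝ) {s : ℂ} (hs : 1 < s.re) :
    HasDerivAt (archimedeanFactor θ) (archimedeanFactor θ s * (2 * θ * (1 / s ^ 2 + 1 / (s - 1) ^ 2) -
      θ / 2 * deriv Complex.digamma (s / 2))) s := by
  have hs0 : s ≠ 0 := fun h => by simp [h] at hs; linarith
  have hs1 : s - 1 ≠ 0 := fun h => by
    rw [sub_eq_zero.1 h] at hs; simp at hs
  have h1 : HasDerivAt (fun s : ℂ => 1 / s) (-(1 / s ^ 2)) s := by
    simpa using hasDerivAt_inv hs0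
  have h2 : HasDerivAt (fun s : ℂ => 1 / (s - 1)) (-(1 / (s - 1) ^ 2)) s := by
    have h := (hasDerivAt_inv hs1).comp s ((hasDerivAt_id s).sub_const 1)
    simpa [Function.comp_def] using h
  have h3 : HasDerivAt Complex.digamma (deriv Complex.digamma (s / 2)) (s / 2) :=
    (differentiableOn_digamma.differentiableAt ((isOpen_lt continuous_const
      Complex.continuous_re).mem_nhds (lt_of_lt_of_le one_half_pos (re_half_pos hs)))).hasDerivAt
  have h4 := h3.comp s ((hasDerivAt_id s).div_const 2)
  refine (((((h1.add h2).const_mul (-2 * θ : ℂ)).add_const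
    (θ * Real.log Real.pi : ℂ)).sub (h4.const_mul (θ : ℂ))).cexp).congr_deriv ?_
  simp only [archimedeanFactor, Function.comp, id, Pi.add_apply, Pi.sub_apply]
  ring

theorem differentiableOn_archimedeanFactor (θ : ℝ) :
    DifferentiableOn ℂ (archimedeanFactor θ) {s | 1 < s.re} := fun _ hs =>
  (hasDerivAt_archimedeanFactor θ hs).differentiableAt.differentiableWithinAt

theorem laplaceDecay_archimedeanFactor {θ : ℝ} (hθ : 0 ≤ θ) : LaplaceDecay (archimedeanFactor θ) θ
    (Real.exp (θ * (Real.log Real.pi + Real.log 2 + 12))) :=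
  ⟨differentiableOn_archimedeanFactor θ, fun _ hs => norm_archimedeanFactor_le hθ (by linarith)⟩

/-- The logarithmic derivative of the factor is O(1/|s|), since ψ'(w) = O(1/|w|); multiplication by
s therefore only costs a constant. -/
theorem laplaceDecay_id_mul_deriv_archimedeanFactor {θ : ℝ} (hθ : 0 ≤ θ) :
    LaplaceDecay (fun s => s * deriv (archimedeanFactor θ) s) θ
      (Real.exp (θ * (Real.log Real.pi + Real.log 2 + 12)) * (35 * θ)) := by
  refine ⟨differentiableOn_id.mul ((differentiableOn_archimedeanFactor θ).deriv
    (isOpen_lt continuous_const Complex.continuous_re)), fun s hs => ?_⟩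
  have hs1 : 1 < s.re := by linarith
  have hn : 2 ≤ ‖s‖ := hs.trans (Complex.re_le_norm s)
  have hn1 : ‖s‖ ≤ 2 * ‖s - 1‖ := by
    have h1 : 1 ≤ ‖s - 1‖ := le_trans (by rw [Complex.sub_re, Complex.one_re]; linarith)
      (Complex.re_le_norm (s - 1))
    have h2 := norm_add_le (s - 1) 1
    rw [sub_add_cancel, norm_one] at h2
    linarith
  have hd := norm_deriv_digamma_le (w := s / 2) (by rw [Complex.div_ofNat_re]; linarith)
  rw [norm_div, Complex.norm_ofNat] at hd
  simp only [(hasDerivAt_archimedeanFactor θ hs1).deriv]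
  have hL : ‖s * (2 * θ * (1 / s ^ 2 + 1 / (s - 1) ^ 2) -
      θ / 2 * deriv Complex.digamma (s / 2))‖ ≤ 35 * θ := by
    have e1 : ‖(1 / s ^ 2 : ℂ)‖ ≤ 1 / (2 * ‖s‖) := by
      rw [norm_div, norm_pow, norm_one, sq]
      gcongr
    have e2 : ‖(1 / (s - 1) ^ 2 : ℂ)‖ ≤ 2 / ‖s‖ := by
      rw [norm_div, norm_pow, norm_one, div_le_div_iff₀ (by nlinarith) (by linarith)]
      nlinarith
    have e3 : ‖2 * θ * (1 / s ^ 2 + 1 / (s - 1) ^ 2) -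
      θ / 2 * deriv Complex.digamma (s / 2)‖ ≤ 2 * θ * (1 / (2 * ‖s‖) + 2 / ‖s‖) +
        θ / 2 * (25 / (‖s‖ / 2)) := by
      refine (norm_sub_le _ _).trans (add_le_add ?_ ?_)
      · rw [norm_mul, norm_mul, Complex.norm_ofNat, Complex.norm_real, Real.norm_of_nonneg hθ]
        gcongr
        exact (norm_add_le _ _).trans (add_le_add e1 e2)
      · rw [norm_mul, norm_div, Complex.norm_ofNat, Complex.norm_real, Real.norm_of_nonneg hθ]
        gcongr
    rw [norm_mul]
    refine (mul_le_mul_of_nonneg_left e3 (norm_nonneg s)).trans ?_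
    have : ‖s‖ ≠ 0 := by linarith
    field_simp
    linarith
  calc _ = ‖archimedeanFactor θ s‖ * ‖s * (2 * θ * (1 / s ^ 2 + 1 / (s - 1) ^ 2) -
      θ / 2 * deriv Complex.digamma (s / 2))‖ := by
        rw [← norm_mul]; congr 1; ring
    _ ≤ _ := by
        rw [mul_right_comm (Real.exp _)]
        exact mul_le_mul (norm_archimedeanFactor_le hθ hs1) hL (norm_nonneg _) (by positivity)

theorem archimedeanFactor_conj (θ : ℝ) (s : ℂ) :
    archimedeanFactor θ ((starRingEnd ℂ) s) = (starRingEnd ℂ) (archimedeanFactor θ s) := by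
  rw [archimedeanFactor, archimedeanFactor, ← Complex.exp_conj]
  congr 1
  simp only [map_sub, map_add, map_mul, map_div₀, map_neg, map_one, map_ofNat, Complex.conj_ofReal,
    ← digamma_conj]

/-- The inverse Laplace transform of the archimedean factor. -/
noncomputable def archimedeanKernel (θ : ℝ) (y : ℝ) : ℂ :=
  verticalIntegral 2 (archimedeanFactor θ) y

/-- The substitution t ↦ -t exchanges s with its conjugate; this is why the kernel is real. -/
theorem verticalIntegral_conj {F : ℂ → ℂ} {σ : ℝ} (hF : ∀ s : ℂ, s.re = σ →
    F ((starRingEnd ℂ) s) = (starRingEnd ℂ) (F s)) (y : ℝ) :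
    (starRingEnd ℂ) (verticalIntegral σ F y) = verticalIntegral σ F y := by
  rw [verticalIntegral, ← integral_conj, ← integral_neg_eq_self]
  refine integral_congr_ae (Eventually.of_forall fun t => ?_)
  have e : (starRingEnd ℂ) (σ + (-t : ℝ) * Complex.I) = σ + t * Complex.I := by simp
  simp only
  rw [map_mul, ← hF _ (by simp), ← Complex.exp_conj, map_mul, e, Complex.conj_ofReal]

end

/-! ### The Dirichlet series of exp(-2θ ζ'/ζ) -/

section

open Filter Topology
open scoped LSeries.notation ComplexOrder

/-- The von Mangoldt function with complex values. -/
noncomputable def complexVonMangoldt : ArithmeticFunction ℂ :=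
  ⟨fun n => (ArithmeticFunction.vonMangoldt n : ℂ), by simp⟩

/-- Powers are Dirichlet convolutions. Nonnegativity turns absolute convergence of their Dirichlet
series at s into plain convergence at Re s. -/
theorem complexVonMangoldt_pow_nonneg (j n : ℕ) : 0 ≤ (complexVonMangoldt ^ j) n := by
  induction j generalizing n with
  | zero =>
    rw [pow_zero, ArithmeticFunction.one_apply]
    split_ifs <;> simp
  | succ j ih =>
    rw [pow_succ, ArithmeticFunction.mul_apply]
    refine Finset.sum_nonneg fun p _ => mul_nonneg (ih _) ?_
    exact Complex.zero_le_real.2 ArithmeticFunction.vonMangoldt_nonneg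

theorem ofReal_re_complexVonMangoldt_pow (j n : ℕ) :
    (((complexVonMangoldt ^ j) n).re : ℂ) = (complexVonMangoldt ^ j) n :=
  Complex.ext rfl (by simpa using (Complex.le_def.1 (complexVonMangoldt_pow_nonneg j n)).2)

theorem lSeriesHasSum_complexVonMangoldt_pow {s : ℂ} (hs : 1 < s.re) (j : ℕ) :
    LSeriesHasSum (fun n => (complexVonMangoldt ^ j) n) s ((-logDeriv riemannZeta s) ^ j) := by
  induction j with
  | zero =>
    rw [pow_zero, pow_zero, ArithmeticFunction.one_eq_delta]
    have h : HasSum (fun n => LSeries.term LSeries.delta s n) (LSeries.term LSeries.delta s 1) :=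
      hasSum_single 1 fun n hn => by rw [LSeries.term_delta, if_neg hn]
    rwa [LSeries.term_delta, if_pos rfl] at h
  | succ j ih =>
    rw [pow_succ, pow_succ]
    refine ArithmeticFunction.LSeriesHasSum_mul ih ?_
    have h1 : LSeriesSummable (fun n => complexVonMangoldt n) s :=
      ArithmeticFunction.LSeriesSummable_vonMangoldt hs
    have h2 := h1.LSeriesHasSum
    have h3 : LSeries (fun n => complexVonMangoldt n) s = -logDeriv riemannZeta s := by
      rw [logDeriv_apply, ← neg_div]
      exact ArithmeticFunction.LSeries_vonMangoldt_eq_deriv_riemannZeta_div hs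
    rwa [h3] at h2

/-- The coefficients of the Dirichlet series of `exp (-2θ ζ'/ζ)`. -/
noncomputable def expLogDerivCoeff (θ : ℝ) (n : ℕ) : ℝ :=
  ∑' j : ℕ, (2 * θ) ^ j / j.factorial * ((complexVonMangoldt ^ j) n).re

/-- The exponential series in -ζ'/ζ is expanded and the order of summation exchanged. The double
series converges absolutely: its norms add up to the same exponential series at the real point Re s.
-/
theorem lSeriesHasSum_expLogDerivCoeff {θ : ℝ} (hθ : 0 ≤ θ) {s : ℂ} (hs : 1 < s.re) :
    LSeriesHasSum (fun n => (expLogDerivCoeff θ n : ℂ)) s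
      (Complex.exp (-2 * θ * logDeriv riemannZeta s)) := by
  set c : ℕ → ℂ := fun j => (2 * θ) ^ j / j.factorial with hc
  set T : ℕ × ℕ → ℂ := fun p => c p.1 * LSeries.term (fun n => (complexVonMangoldt ^ p.1) n) s p.2
    with hT
  have hσ : 1 < (s.re : ℂ).re := by simpa using hs
  have hnorm : ∀ j n, ‖LSeries.term (fun n => (complexVonMangoldt ^ j) n) s n‖ =
      (LSeries.term (fun n => (complexVonMangoldt ^ j) n) s.re n).re := by
    intro j n
    rcases eq_or_ne n 0 with rfl | hn
    · simp
    rw [LSeries.norm_term_eq, if_neg hn, LSeries.term_of_ne_zero hn,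
      ← ofReal_re_complexVonMangoldt_pow, Complex.norm_real, Real.norm_of_nonneg
        (Complex.le_def.1 (complexVonMangoldt_pow_nonneg j n)).1]
    rw [← Complex.ofReal_natCast, ← Complex.ofReal_cpow (Nat.cast_nonneg n), ← Complex.ofReal_div,
      Complex.ofReal_re]
  have hsumn : ∀ j, HasSum (fun n => ‖LSeries.term (fun n => (complexVonMangoldt ^ j) n) s n‖)
      (((-logDeriv riemannZeta s.re) ^ j).re) := fun j => by
    simp_rw [hnorm]
    exact Complex.hasSum_re (lSeriesHasSum_complexVonMangoldt_pow hσ j)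
  have hcn : ∀ j, ‖c j‖ = (2 * θ) ^ j / j.factorial := fun j => by
    simp only [hc, norm_div, norm_pow, norm_mul, Complex.norm_real, Complex.norm_ofNat,
      Complex.norm_natCast, Real.norm_of_nonneg hθ]
  have hexp : ∀ z : ℂ, HasSum (fun j => c j * (-z) ^ j) (Complex.exp (-2 * θ * z)) := fun z => by
    have h := NormedSpace.expSeries_div_hasSum_exp (𝔸 := ℂ) (-2 * θ * z)
    rw [← Complex.exp_eq_exp_ℂ] at h
    refine h.congr_fun fun j => ?_
    simp only [hc]
    rw [show -2 * θ * z = (2 * θ) * (-z) by ring, mul_pow (2 * (θ : ℂ)) (-z)]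
    ring
  have hsumm : Summable T := by
    refine Summable.of_norm ?_
    refine (summable_prod_of_nonneg fun p => norm_nonneg _).2 ⟨fun j => ?_, ?_⟩
    · simp only [hT, norm_mul]
      exact ((hsumn j).mul_left _).summable
    · simp only [hT, norm_mul, tsum_mul_left, (hsumn _).tsum_eq, hcn]
      have h := (Complex.hasSum_re (hexp (logDeriv riemannZeta s.re))).summable
      refine h.congr fun j => ?_
      have : c j = (((2 * θ) ^ j / j.factorial : ℝ) : ℂ) := by simp only [hc]; push_cast; rfl
      rw [this, Complex.re_ofReal_mul]
  have h1 : HasSum T (Complex.exp (-2 * θ * logDeriv riemannZeta s)) := by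
    have h2 := hsumm.hasSum.prod_fiberwise fun j =>
      (lSeriesHasSum_complexVonMangoldt_pow hs j).mul_left (c j)
    rw [← h2.unique (hexp _)]
    exact hsumm.hasSum
  have h3 : HasSum (T ∘ Prod.swap) (Complex.exp (-2 * θ * logDeriv riemannZeta s)) :=
    (Equiv.prodComm ℕ ℕ).hasSum_iff.2 h1
  have h4 := h3.prod_fiberwise fun n => (h3.summable.prod_factor n).hasSum
  refine h4.congr_fun fun n => ?_
  rcases eq_or_ne n 0 with rfl | hn
  · simp [hT]
  · simp only [hT, Function.comp, Prod.swap, LSeries.term_of_ne_zero hn, expLogDerivCoeff,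
      Complex.ofReal_tsum, ← tsum_div_const]
    refine tsum_congr fun j => ?_
    rw [Complex.ofReal_mul, ofReal_re_complexVonMangoldt_pow, mul_div_assoc]
    simp only [hc]
    push_cast
    rfl

end

/-! ### Integral operators and Fredholm determinants -/

section

open MeasureTheory Filter Set

/-- Functions on a half-line that are bounded and vanish off a bounded interval are square
integrable. -/
theorem memLp_of_norm_le_indicator {t c : ℝ} (ht : 0 ≤ t) {φ : ℝ → ℂ}
    (hm : AEStronglyMeasurable φ (volume.restrict (Iic t)))
    (hb : ∀ x ≤ t, ‖φ x‖ ≤ (Icc (-t) t).indicator (fun _ => c) x) :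
    ∃ h : MemLp φ 2 (volume.restrict (Iic t)), ‖h.toLp φ‖ ≤ c * √(2 * t) := by
  have hc : 0 ≤ c := by
    have := (norm_nonneg _).trans (hb t le_rfl)
    rwa [indicator_of_mem (show t ∈ Icc (-t) t by constructor <;> linarith)] at this
  have hvol : volume.restrict (Iic t) (Icc (-t) t) = ENNReal.ofReal (2 * t) := by
    rw [Measure.restrict_apply measurableSet_Icc,
      inter_eq_left.2 (fun x hx => hx.2), Real.volume_Icc]
    congr 1; ring
  have hI : MemLp ((Icc (-t) t).indicator fun _ => c) 2 (volume.restrict (Iic t)) :=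
    memLp_indicator_const 2 measurableSet_Icc c (Or.inr (by rw [hvol]; exact ENNReal.ofReal_ne_top))
  have hle : ∀ᵐ x ∂volume.restrict (Iic t), ‖φ x‖ ≤ ‖(Icc (-t) t).indicator (fun _ => c) x‖ := by
    filter_upwards [ae_restrict_mem measurableSet_Iic] with x hx
    exact (hb x hx).trans (le_abs_self _)
  refine ⟨hI.mono hm hle, ?_⟩
  rw [Lp.norm_toLp]
  refine ENNReal.toReal_le_of_le_ofReal (by positivity) ((eLpNorm_mono_ae hle).trans_eq ?_)
  rw [eLpNorm_indicator_const measurableSet_Icc two_ne_zero ENNReal.ofNat_ne_top, hvol,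
    ENNReal.ofReal_mul hc, Real.sqrt_eq_rpow, ENNReal.toReal_ofNat,
    ENNReal.ofReal_rpow_of_nonneg (by positivity) (by norm_num), Real.enorm_of_nonneg hc]

/-- A bounded integral operator whose kernel is bounded and vanishes off a bounded square. -/
theorem exists_isIntegralOperator {t M : ℝ} (ht : 0 ≤ t) {k : ℝ → ℝ → ℂ}
    (hk : Continuous (Function.uncurry k))
    (hb : ∀ x ≤ t, ∀ y ≤ t, ‖k x y‖ ≤ M)
    (h0 : ∀ x ≤ t, ∀ y ≤ t, x < -t ∨ y < -t → k x y = 0) :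
    ∃ A : L2Iic t →L[ℂ] L2Iic t, IsIntegralOperator A k := by
  set μ := volume.restrict (Iic t) with hμ
  have hkx : ∀ x, Continuous (k x) := fun x => hk.comp (by fun_prop : Continuous fun y => (x, y))
  -- Each row of the kernel is in L², so the integral is an inner product; Cauchy–Schwarz bounds the
  -- image pointwise by a constant supported on [-t, t].
  have hsec : ∀ x ≤ t, ∃ h : MemLp (fun y => (starRingEnd ℂ) (k x y)) 2 μ,
      ‖h.toLp _‖ ≤ M * √(2 * t) := fun x hx => by
    refine memLp_of_norm_le_indicator ht
      (Complex.continuous_conj.comp (hkx x)).aestronglyMeasurable fun y hy => ?_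
    rw [RCLike.norm_conj]
    by_cases hy' : y ∈ Icc (-t) t
    · rw [indicator_of_mem hy']; exact hb x hx y hy
    · rw [indicator_of_notMem hy', h0 x hx y hy (Or.inr (by
        by_contra h; exact hy' ⟨not_lt.1 h, hy⟩)), norm_zero]
  have hbd : ∀ (f : L2Iic t) (x : ℝ), x ≤ t →
      Integrable (fun y => k x y * f y) μ ∧
      ‖∫ y, k x y * f y ∂μ‖ ≤
        (Icc (-t) t).indicator (fun _ => M * √(2 * t) * ‖f‖) x := fun f x hx => by
    obtain ⟨h, hn⟩ := hsec x hx
    have e : (fun y => inner ℂ (h.toLp _ y) (f y)) =ᵐ[μ] fun y => k x y * f y := by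
      filter_upwards [h.coeFn_toLp] with y hy
      rw [hy, RCLike.inner_apply, RCLike.conj_conj, mul_comm]
    refine ⟨(L2.integrable_inner (𝕜 := ℂ) (h.toLp _) f).congr e, ?_⟩
    by_cases hx' : x ∈ Icc (-t) t
    · rw [indicator_of_mem hx', ← integral_congr_ae e, ← L2.inner_def]
      exact (norm_inner_le_norm _ _).trans (mul_le_mul_of_nonneg_right hn (norm_nonneg f))
    · rw [indicator_of_notMem hx']
      have : ∫ y, k x y * f y ∂μ = 0 := by
        refine integral_eq_zero_of_ae ?_
        filter_upwards [ae_restrict_mem measurableSet_Iic] with y hy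
        rw [h0 x hx y hy (Or.inl (by by_contra h; exact hx' ⟨not_lt.1 h, hx⟩)), zero_mul]; rfl
      rw [this, norm_zero]
  have hmeas : ∀ f : L2Iic t, AEStronglyMeasurable (fun x => ∫ y, k x y * f y ∂μ) μ := fun f => by
    refine StronglyMeasurable.aestronglyMeasurable ?_
    refine StronglyMeasurable.integral_prod_right (f := fun x y => k x y * f y) ?_
    exact hk.stronglyMeasurable.mul ((Lp.stronglyMeasurable f).comp_measurable measurable_snd)
  choose hL hLn using fun f : L2Iic t =>
    memLp_of_norm_le_indicator ht (hmeas f) fun x hx => (hbd f x hx).2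
  refine ⟨LinearMap.mkContinuous
    { toFun := fun f => (hL f).toLp _
      map_add' := fun f g => ?_
      map_smul' := fun a f => ?_ } (M * √(2 * t) * √(2 * t)) fun f => ?_, fun f => ?_⟩
  · rw [← MemLp.toLp_add]
    refine MemLp.toLp_congr _ _ ?_
    filter_upwards [ae_restrict_mem measurableSet_Iic] with x hx
    rw [Pi.add_apply, ← integral_add (hbd f x hx).1 (hbd g x hx).1]
    refine integral_congr_ae ?_
    filter_upwards [Lp.coeFn_add f g] with y hy
    rw [hy, Pi.add_apply, mul_add]
  · rw [RingHom.id_apply, ← MemLp.toLp_const_smul]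
    refine MemLp.toLp_congr _ _ ?_
    filter_upwards [ae_restrict_mem measurableSet_Iic] with x hx
    rw [Pi.smul_apply, ← integral_smul]
    refine integral_congr_ae ?_
    filter_upwards [Lp.coeFn_smul a f] with y hy
    rw [hy, Pi.smul_apply, smul_eq_mul, smul_eq_mul, mul_left_comm]
  · refine (hLn f).trans_eq ?_
    ring
  · filter_upwards [(hL f).coeFn_toLp, ae_restrict_mem measurableSet_Iic] with x hx hx'
    rw [indicator_of_mem hx']
    exact hx

/-- A Fredholm series with a small kernel that vanishes off a bounded square converges, and its sum
is not zero. -/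
theorem hasFredholmDet_of_small {t M : ℝ} (ht : 0 ≤ t) {k : ℝ → ℝ → ℂ}
    (hk : Continuous (Function.uncurry k))
    (hb : ∀ x ≤ t, ∀ y ≤ t, ‖k x y‖ ≤ M)
    (h0 : ∀ x ≤ t, ∀ y ≤ t, x < -t ∨ y < -t → k x y = 0) (hM : M * (2 * t) ≤ 1 / 4)
    {A : L2Iic t →L[ℂ] L2Iic t} (hA : IsIntegralOperator A k) :
    ∃ d : ℂ, HasFredholmDet A d ∧ d ≠ 0 := by
  set μ := volume.restrict (Iic t) with hμ
  have hM0 : 0 ≤ M := (norm_nonneg _).trans (hb t le_rfl t le_rfl)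
  set D : (n : ℕ) → (Fin n → ℝ) → ℂ := fun n x => (Matrix.of fun i j => k (x i) (x j)).det with hD
  set B : (n : ℕ) → (Fin n → ℝ) → ℝ := fun n x =>
    n.factorial * ∏ i, (Icc (-t) t).indicator (fun _ => M) (x i) with hB
  have hvol : μ.real (Icc (-t) t) = 2 * t := by
    rw [hμ, measureReal_restrict_apply measurableSet_Icc, inter_eq_left.2 (fun x hx => hx.2),
      Real.volume_real_Icc_of_le (by linarith)]
    ring
  have hI : Integrable ((Icc (-t) t).indicator fun _ => M) μ := by
    refine (integrable_indicator_iff measurableSet_Icc).2 (integrableOn_const ?_)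
    rw [hμ, Measure.restrict_apply measurableSet_Icc]
    exact ((measure_mono inter_subset_left).trans_lt isCompact_Icc.measure_lt_top).ne
  have hBi : ∀ n, Integrable (B n) (Measure.pi fun _ => μ) := fun n =>
    (Integrable.fintype_prod fun _ => hI).const_mul _
  have hBint : ∀ n, ∫ x, B n x ∂(Measure.pi fun _ => μ) = n.factorial * (M * (2 * t)) ^ n := by
    intro n
    simp only [hB]
    rw [integral_const_mul, integral_fintype_prod_eq_pow, integral_indicator measurableSet_Icc,
      setIntegral_const, hvol, Fintype.card_fin, smul_eq_mul, mul_comm M]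
  have hDB : ∀ n, ∀ᵐ x ∂(Measure.pi fun _ : Fin n => μ), ‖D n x‖ ≤ B n x := by
    intro n
    have hle : ∀ᵐ x ∂(Measure.pi fun _ : Fin n => μ), ∀ i, x i ≤ t := by
      refine ae_all_iff.2 fun i => ?_
      exact (Measure.tendsto_eval_ae_ae (μ := fun _ : Fin n => μ)).eventually
        (ae_restrict_mem measurableSet_Iic)
    filter_upwards [hle] with x hx
    by_cases hall : ∀ i, x i ∈ Icc (-t) t
    -- The Leibniz bound n! Mⁿ suffices in place of Hadamard's: the n! cancels the one in the series
    -- and leaves (2tM)ⁿ.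
    · have h1 := Matrix.det_le (A := Matrix.of fun i j => k (x i) (x j))
        (abv := NormedField.toAbsoluteValue ℂ) (x := M) fun i j => hb _ (hx i) _ (hx j)
      rw [Fintype.card_fin, nsmul_eq_mul] at h1
      refine h1.trans_eq ?_
      simp only [hB, indicator_of_mem (hall _), Finset.prod_const, Finset.card_univ,
        Fintype.card_fin]
    · push Not at hall
      obtain ⟨i, hi⟩ := hall
      have : D n x = 0 := Matrix.det_eq_zero_of_row_eq_zero i fun j =>
        h0 _ (hx i) _ (hx j) (Or.inl (by by_contra h; exact hi ⟨not_lt.1 h, hx i⟩))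
      rw [this, norm_zero]
      exact mul_nonneg (Nat.cast_nonneg _)
        (Finset.prod_nonneg fun i _ => indicator_nonneg (fun _ _ => hM0) _)
  have hDc : ∀ n, Continuous (D n) := fun n => by
    refine Continuous.matrix_det ?_
    refine continuous_matrix fun i j => ?_
    exact hk.comp (by fun_prop : Continuous fun x : Fin n → ℝ => (x i, x j))
  have hDi : ∀ n, Integrable (D n) (Measure.pi fun _ => μ) := fun n =>
    (hBi n).mono' (hDc n).aestronglyMeasurable (hDB n)
  set T : ℕ → ℂ := fun n => (1 / (n.factorial : ℂ)) * ∫ x, D n x ∂(Measure.pi fun _ => μ) with hT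
  have hTn : ∀ n, ‖T n‖ ≤ (1 / 4) ^ n := by
    intro n
    have h1 : ‖∫ x, D n x ∂(Measure.pi fun _ => μ)‖ ≤ n.factorial * (M * (2 * t)) ^ n :=
      hBint n ▸ norm_integral_le_of_norm_le (hBi n) (hDB n)
    have hf : (0 : ℝ) < n.factorial := by exact_mod_cast n.factorial_pos
    simp only [hT]
    rw [norm_mul, norm_div, norm_one, Complex.norm_natCast]
    calc 1 / (n.factorial : ℝ) * ‖∫ x, D n x ∂(Measure.pi fun _ => μ)‖
        ≤ 1 / (n.factorial : ℝ) * (n.factorial * (M * (2 * t)) ^ n) := by gcongr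
      _ = (M * (2 * t)) ^ n := by field_simp
      _ ≤ (1 / 4) ^ n := by gcongr
  have hT0 : T 0 = 1 := by simp [hT, hD, Measure.real]
  have hsum : Summable T :=
    Summable.of_norm_bounded (summable_geometric_of_lt_one (by norm_num) (by norm_num)) hTn
  refine ⟨∑' n, T n, ⟨k, hk.continuousOn, hA, hDi, hsum.hasSum⟩, fun h => ?_⟩
  have hg : Summable fun n : ℕ => (1 / 4 : ℝ) ^ (n + 1) :=
    (summable_nat_add_iff 1).2 (summable_geometric_of_lt_one (by norm_num) (by norm_num))
  have h2 := tsum_of_norm_bounded hg.hasSum fun n => hTn (n + 1)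
  -- The zeroth term is 1 and all the others together are at most 1/3, so the sum cannot vanish.
  have h3 : ∑' n : ℕ, (1 / 4 : ℝ) ^ (n + 1) = 1 / 3 := by
    simp_rw [pow_succ]
    rw [tsum_mul_right, tsum_geometric_of_lt_one (by norm_num) (by norm_num)]
    norm_num
  rw [hsum.tsum_eq_zero_add, hT0] at h
  rw [h3, eq_neg_of_add_eq_zero_right h, norm_neg, norm_one] at h2
  norm_num at h2

/-- The Fredholm determinants of the Hankel operators with a continuous symbol that is supported on
a half-line do not vanish for small parameters. -/
theorem exists_fredholmDet_ne_zero {K : ℝ → ℝ} (hK : Continuous K) (h0 : ∀ x < 0, K x = 0) :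
    ∃ τ : EReal, 0 < τ ∧ ∀ t : ℝ, 0 ≤ t → (t : EReal) < τ →
      ∃ A : L2Iic t →L[ℂ] L2Iic t,
        IsIntegralOperator A (fun x y => (K (x + y) : ℂ)) ∧
        (∃ d : ℂ, HasFredholmDet A d ∧ d ≠ 0) ∧ (∃ d : ℂ, HasFredholmDet (-A) d ∧ d ≠ 0) := by
  obtain ⟨M, hM⟩ := isCompact_Icc.exists_bound_of_continuousOn (s := Icc (0 : ℝ) 2) hK.continuousOn
  have hM0 : 0 ≤ M := (norm_nonneg _).trans (hM 0 (by simp))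
  -- This τ forces t ≤ 1, so x + y ≤ 2 stays where M bounds K, and M · 2t ≤ 1/4. For x, y ≤ t the
  -- kernel vanishes if x < -t or y < -t, since then x + y < 0.
  refine ⟨((1 / (8 * (M + 1)) : ℝ) : EReal), by exact_mod_cast (by positivity), fun t ht htτ => ?_⟩
  have htτ' : t < 1 / (8 * (M + 1)) := by exact_mod_cast htτ
  rw [lt_div_iff₀ (by positivity)] at htτ'
  have ht1 : t ≤ 1 := by nlinarith
  have hb : ∀ x ≤ t, ∀ y ≤ t, ‖(K (x + y) : ℂ)‖ ≤ M := fun x hx y hy => by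
    rw [Complex.norm_real]
    rcases lt_or_ge (x + y) 0 with h | h
    · rw [h0 _ h, norm_zero]; exact hM0
    · exact hM _ ⟨h, by linarith⟩
  have hz : ∀ x ≤ t, ∀ y ≤ t, x < -t ∨ y < -t → (K (x + y) : ℂ) = 0 := fun x hx y hy h => by
    rw [h0 _ (by rcases h with h | h <;> linarith), Complex.ofReal_zero]
  have hc : Continuous (Function.uncurry fun x y => (K (x + y) : ℂ)) := by
    unfold Function.uncurry
    fun_prop
  have hs : M * (2 * t) ≤ 1 / 4 := by nlinarith
  obtain ⟨A, hA⟩ := exists_isIntegralOperator ht hc hb hz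
  refine ⟨A, hA, hasFredholmDet_of_small ht hc hb hz hs hA, ?_⟩
  refine hasFredholmDet_of_small (k := fun x y => -(K (x + y) : ℂ)) ht hc.neg
    (fun x hx y hy => by rw [norm_neg]; exact hb x hx y hy)
    (fun x hx y hy h => by rw [hz x hx y hy h, neg_zero]) hs fun f => ?_
  filter_upwards [Lp.coeFn_neg (A f), hA f] with x h1 h2
  rw [neg_apply, h1, Pi.neg_apply, h2]
  by_cases hx : x ∈ Iic t
  · rw [indicator_of_mem hx, indicator_of_mem hx, ← integral_neg]
    simp only [neg_mul]
  · rw [indicator_of_notMem hx, indicator_of_notMem hx, neg_zero]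

end

/-! ### Fourier uniqueness and inversion -/

section

open MeasureTheory Filter Set Topology
open scoped FourierTransform ContDiff

/-- An integrable function with vanishing Fourier transform vanishes almost everywhere. -/
theorem ae_eq_zero_of_fourier_eq_zero {D : ℝ → ℂ} (hD : Integrable D) (h : ∀ w, 𝓕 D w = 0) :
    ∀ᵐ x, D x = 0 := by
  refine ae_eq_zero_of_integral_contDiff_smul_eq_zero hD.locallyIntegrable fun g hg hgs => ?_
  have hgC : ContDiff ℝ ∞ fun x => (g x : ℂ) := Complex.ofRealCLM.contDiff.comp hg
  have hgsC : HasCompactSupport fun x => (g x : ℂ) := hgs.comp_left Complex.ofReal_zero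
  set G := hgsC.toSchwartzMap hgC with hG
  have hGx : ∀ x, G x = (g x : ℂ) := fun x => rfl
  set P : SchwartzMap ℝ ℂ := 𝓕⁻ G with hP
  have hPG : 𝓕 P = G := FourierTransform.fourier_fourierInv_eq G
  have hPG' : 𝓕 (P : ℝ → ℂ) = fun x => (g x : ℂ) := by
    rw [← SchwartzMap.fourier_coe, hPG]
    rfl
  -- The test function g is the Fourier transform of the Schwartz function `P`. The multiplication
  -- formula moves that transform onto D, where it vanishes.
  have key := VectorFourier.integral_fourierIntegral_smul_eq_flip (L := innerₗ ℝ) (f := D)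
    (g := (P : ℝ → ℂ)) (μ := volume) (ν := volume) Real.continuous_fourierChar continuous_inner hD
    P.integrable
  have h1 : ∀ w, VectorFourier.fourierIntegral Real.fourierChar volume (innerₗ ℝ) D w = 0 := h
  have h2 : ∀ x, VectorFourier.fourierIntegral Real.fourierChar volume (innerₗ ℝ).flip (P : ℝ → ℂ) x
      = (g x : ℂ) := fun x => by
    rw [flip_innerₗ]
    exact congrFun hPG' x
  simp only [h1, h2, zero_smul, integral_zero] at key
  rw [key]
  refine integral_congr_ae (Eventually.of_forall fun x => ?_)
  simp only [smul_eq_mul, Complex.real_smul]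
  ring

/-- Fourier inversion with the kernel `exp (ity)`. -/
theorem integral_mul_exp_of_eq_integral_mul_exp {φ ψ : ℝ → ℂ} (hc : Continuous φ)
    (hi : Integrable φ) (hψ : ∀ y : ℝ, ψ y = ∫ t : ℝ, φ t * Complex.exp (Complex.I * t * y))
    (hψi : Integrable ψ) (u : ℝ) :
    ∫ y : ℝ, ψ y * Complex.exp (-Complex.I * y * u) = 2 * Real.pi * φ u := by
  have hπ : (0 : ℝ) < 2 * Real.pi := by positivity
  have e1 : ∀ w : ℝ, 𝓕⁻ φ w = ψ (2 * Real.pi * w) := fun w => by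
    rw [Real.fourierInv_eq', hψ]
    refine integral_congr_ae (Eventually.of_forall fun t => ?_)
    simp only [RCLike.inner_apply, conj_trivial, smul_eq_mul]
    rw [mul_comm]
    congr 2
    push_cast
    ring
  have e2 : ∀ w : ℝ, 𝓕 φ w = ψ (-(2 * Real.pi) * w) := fun w => by
    have := Real.fourierInv_eq_fourier_neg φ (-w)
    rw [neg_neg] at this
    rw [← this, e1]
    congr 1
    ring
  have hFi : Integrable (𝓕 φ) := by
    rw [show 𝓕 φ = fun w => ψ (-(2 * Real.pi) * w) from funext e2]
    exact hψi.comp_mul_left' (by linarith)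
  have hinv := congrFun (hc.fourier_fourierInv_eq hi hFi) u
  rw [Real.fourier_real_eq_integral_exp_smul] at hinv
  have h3 := Measure.integral_comp_mul_left
    (fun y : ℝ => ψ y * Complex.exp (-Complex.I * y * u)) (2 * Real.pi)
  have h4 : ∫ w : ℝ, ψ (2 * Real.pi * w) * Complex.exp (-Complex.I * (2 * Real.pi * w : ℝ) * u) =
      φ u := by
    rw [← hinv]
    refine integral_congr_ae (Eventually.of_forall fun w => ?_)
    simp only [e1, smul_eq_mul]
    rw [mul_comm]
    congr 2
    push_cast
    ring
  rw [h4, abs_of_pos (inv_pos.2 hπ), Complex.real_smul] at h3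
  rw [h3]
  have : ((2 * Real.pi : ℝ) : ℂ) ≠ 0 := by exact_mod_cast hπ.ne'
  push_cast at this ⊢
  rw [mul_inv_cancel_left₀ this]

/-- A function is determined by its Fourier transform on one horizontal line. -/
theorem FourierFormulaAt.ae_eq {θ c : ℝ} {F K : ℝ → ℂ} (hF : ∀ z : ℂ, z.im = c → FourierFormulaAt θ F z)
    (hK : ∀ z : ℂ, z.im = c → FourierFormulaAt θ K z) : F =ᵐ[volume] K := by
  have hz : ∀ u : ℝ, (u + c * Complex.I : ℂ).im = c := fun u => by simp
  -- Multiplication by e^{-cx} turns the formula on the line Im z = c into an ordinary Fourier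
  -- transform.
  set E : ℝ → ℂ := fun x => Complex.exp (Complex.I * ((0 : ℝ) + c * Complex.I) * x) with hE
  have hD : Integrable fun x => F x * E x - K x * E x := (hF _ (hz 0)).1.sub (hK _ (hz 0)).1
  have h := ae_eq_zero_of_fourier_eq_zero hD fun w => by
    rw [Real.fourier_real_eq_integral_exp_smul]
    have h1 := hF _ (hz (-2 * Real.pi * w))
    have h2 := hK _ (hz (-2 * Real.pi * w))
    have h3 := integral_sub h1.1 h2.1
    rw [← h1.2, ← h2.2, sub_self] at h3
    rw [← h3]
    refine integral_congr_ae (Eventually.of_forall fun x => ?_)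
    have e : Complex.exp (Complex.I * ((-2 * Real.pi * w : ℝ) + c * Complex.I) * x) =
        Complex.exp ((-2 * Real.pi * x * w : ℝ) * Complex.I) * E x := by
      rw [hE, ← Complex.exp_add]
      congr 1
      push_cast
      ring
    simp only [smul_eq_mul]
    rw [e]
    ring
  filter_upwards [h] with x hx
  rw [← sub_mul] at hx
  exact sub_eq_zero.1 ((mul_eq_zero.1 hx).resolve_right (Complex.exp_ne_zero _))

end

/-! ### Decay of exp(-2θ ξ'/ξ) up to Re s = 1 -/

section

open MeasureTheory Filter Set Topology

/-- The function `exp (-2θ ξ'/ξ)` of the variable `s`. -/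
noncomputable def expLogDerivXiAt (θ : ℝ) (s : ℂ) : ℂ :=
  Complex.exp (-2 * θ * (deriv riemannXi s / riemannXi s))

theorem differentiable_riemannXi : Differentiable ℂ riemannXi := by
  have h := differentiable_completedZeta₀
  unfold riemannXi
  fun_prop

theorem ne_neg_two_mul_nat {s : ℂ} (hs : 1 ≤ s.re) (n : ℕ) : s ≠ -(2 * n) := fun h => by
  have := congrArg Complex.re h
  simp at this
  have : (0 : ℝ) ≤ n := Nat.cast_nonneg n
  linarith

theorem riemannXi_ne_zero {s : ℂ} (hs : 1 ≤ s.re) : riemannXi s ≠ 0 := by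
  rcases eq_or_ne s 1 with rfl | h1
  · simp [riemannXi]
  have h0 : s ≠ 0 := fun h => by simp [h] at hs; linarith
  rw [riemannXi_eq h1 (ne_neg_two_mul_nat hs)]
  have hπ : (Real.pi : ℂ) ≠ 0 := by exact_mod_cast Real.pi_ne_zero
  have hG : Complex.Gamma (s / 2) ≠ 0 :=
    Complex.Gamma_ne_zero_of_re_pos (by rw [Complex.div_ofNat_re]; linarith)
  exact mul_ne_zero (mul_ne_zero (mul_ne_zero (div_ne_zero (mul_ne_zero h0 (sub_ne_zero.2 h1))
    two_ne_zero) (by rw [Ne, Complex.cpow_eq_zero_iff]; tauto)) hG)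
    (riemannZeta_ne_zero_of_one_le_re hs)

theorem isOpen_one_lt_re : IsOpen {s : ℂ | 1 < s.re} :=
  isOpen_lt continuous_const Complex.continuous_re

theorem expLogDerivXiAt_eq (θ : ℝ) {s : ℂ} (hs : 1 < s.re) :
    expLogDerivXiAt θ s =
      archimedeanFactor θ s * Complex.exp (-2 * θ * logDeriv riemannZeta s) := by
  have h0 : s ≠ 0 := fun h => by simp [h] at hs; linarith
  have h1 : s - 1 ≠ 0 := fun h => by rw [sub_eq_zero.1 h] at hs; simp at hs
  have hG : Complex.Gamma (s / 2) ≠ 0 :=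
    Complex.Gamma_ne_zero_of_re_pos (by rw [Complex.div_ofNat_re]; linarith)
  have hζ := riemannZeta_ne_zero_of_one_le_re hs.le
  have hπ : (Real.pi : ℂ) ≠ 0 := by exact_mod_cast Real.pi_ne_zero
  have hev : riemannXi =ᶠ[𝓝 s] fun s => s * (s - 1) / 2 * (Real.pi : ℂ) ^ (-s / 2) *
      Complex.Gamma (s / 2) * riemannZeta s := by
    filter_upwards [isOpen_one_lt_re.mem_nhds hs] with z hz
    exact riemannXi_eq (fun h => by rw [h] at hz; simp at hz) (ne_neg_two_mul_nat (le_of_lt hz))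
  have dζ : HasDerivAt riemannZeta (deriv riemannZeta s) s :=
    (differentiableAt_riemannZeta (sub_ne_zero.1 h1)).hasDerivAt
  have dΓ : HasDerivAt (fun s : ℂ => Complex.Gamma (s / 2))
      (deriv Complex.Gamma (s / 2) * (1 / 2)) s := by
    have h : HasDerivAt Complex.Gamma (deriv Complex.Gamma (s / 2)) (s / 2) :=
      (Complex.differentiableAt_Gamma _ fun m h => by
        have := congrArg Complex.re h
        rw [Complex.div_ofNat_re, Complex.neg_re, Complex.natCast_re] at this
        linarith [(Nat.cast_nonneg m : (0 : ℝ) ≤ m)]).hasDerivAt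
    exact h.comp s ((hasDerivAt_id s).div_const 2)
  have dπ : HasDerivAt (fun s : ℂ => (Real.pi : ℂ) ^ (-s / 2))
      ((Real.pi : ℂ) ^ (-s / 2) * Complex.log Real.pi * (-1 / 2)) s :=
    ((hasDerivAt_id s).neg.div_const 2).const_cpow (Or.inl hπ)
  have dp : HasDerivAt (fun s : ℂ => s * (s - 1) / 2) ((1 * (s - 1) + s * 1) / 2) s :=
    ((hasDerivAt_id s).mul ((hasDerivAt_id s).sub_const 1)).div_const 2
  have hp : (Real.pi : ℂ) ^ (-s / 2) ≠ 0 := by rw [Ne, Complex.cpow_eq_zero_iff]; tauto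
  have hd := (((dp.mul dπ).mul dΓ).mul dζ).deriv
  have key : deriv riemannXi s / riemannXi s = 1 / s + 1 / (s - 1) - Complex.log Real.pi / 2 +
      Complex.digamma (s / 2) / 2 + logDeriv riemannZeta s := by
    have hd' : deriv riemannXi s = _ := hev.deriv_eq.trans hd
    rw [hd', hev.eq_of_nhds, Complex.digamma_def, logDeriv_apply, logDeriv_apply]
    simp only [Pi.mul_apply]
    field_simp
    ring
  rw [expLogDerivXiAt, key, archimedeanFactor, ← Complex.exp_add, Complex.ofReal_log Real.pi_pos.le]
  congr 1
  ring

theorem continuousOn_expLogDerivXiAt (θ : ℝ) : ContinuousOn (expLogDerivXiAt θ) {s | 1 ≤ s.re} := by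
  have h := differentiable_riemannXi
  have h1 : Continuous (deriv riemannXi) := h.deriv.continuous
  refine Complex.continuous_exp.comp_continuousOn (continuousOn_const.mul
    (h1.continuousOn.div h.continuous.continuousOn fun s hs => riemannXi_ne_zero hs))

theorem differentiableOn_expLogDerivXiAt (θ : ℝ) :
    DifferentiableOn ℂ (expLogDerivXiAt θ) {s | 1 < s.re} := by
  have h := differentiable_riemannXi
  exact ((h.deriv.differentiableOn.div h.differentiableOn fun s hs =>
    riemannXi_ne_zero (le_of_lt hs)).const_mul _).cexp

theorem expLogDerivXiAt_conj (θ : ℝ) {s : ℂ} (hs : 1 < s.re) :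
    expLogDerivXiAt θ ((starRingEnd ℂ) s) = (starRingEnd ℂ) (expLogDerivXiAt θ s) := by
  have h : (starRingEnd ℂ) ∘ riemannZeta ∘ (starRingEnd ℂ) = riemannZeta := by
    funext z
    simp [riemannZeta_conj]
  have h2 := congrFun (deriv_conj_conj (𝕜 := ℂ) (f := riemannZeta)) ((starRingEnd ℂ) s)
  rw [h] at h2
  rw [expLogDerivXiAt_eq θ hs, expLogDerivXiAt_eq θ (by rwa [Complex.conj_re]), map_mul,
    archimedeanFactor_conj, ← Complex.exp_conj]
  simp only [map_mul, map_neg, map_ofNat, Complex.conj_ofReal, logDeriv_apply, map_div₀, h2,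
    riemannZeta_conj, Function.comp, Complex.conj_conj]

/-- For Re s ≥ 2 the zeta factor is bounded by the sum of the absolute values of the terms of its
Dirichlet series at 2. -/
theorem exists_laplaceDecay_expLogDerivXiAt {θ : ℝ} (hθ : 0 ≤ θ) :
    ∃ B, LaplaceDecay (expLogDerivXiAt θ) θ B := by
  set b : ℝ := ∑' n, ‖LSeries.term (fun n => (expLogDerivCoeff θ n : ℂ)) 2 n‖ with hb
  have h2 := (lSeriesHasSum_expLogDerivCoeff hθ (s := 2) (by simp)).summable.norm
  refine ⟨Real.exp (θ * (Real.log Real.pi + Real.log 2 + 12)) * b,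
    differentiableOn_expLogDerivXiAt θ, fun s hs => ?_⟩
  have hs1 : 1 < s.re := by linarith
  have hA : ‖Complex.exp (-2 * θ * logDeriv riemannZeta s)‖ ≤ b := by
    have h := lSeriesHasSum_expLogDerivCoeff hθ hs1
    have hle : ∀ n, ‖LSeries.term (fun n => (expLogDerivCoeff θ n : ℂ)) s n‖ ≤
        ‖LSeries.term (fun n => (expLogDerivCoeff θ n : ℂ)) 2 n‖ := fun n =>
      LSeries.norm_term_le_of_re_le_re _ (by simpa using hs) n
    rw [← h.tsum_eq]
    exact (norm_tsum_le_tsum_norm h.summable.norm).trans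
      (h.summable.norm.tsum_le_tsum hle h2)
  rw [expLogDerivXiAt_eq θ hs1, norm_mul, mul_right_comm (Real.exp _)]
  exact mul_le_mul (norm_archimedeanFactor_le hθ hs1) hA (norm_nonneg _) (by positivity)

/-- A bound for `exp (-2θ ξ'/ξ)` that is uniform up to the line `Re s = 1`. -/
theorem exists_norm_expLogDerivXiAt_le {θ : ℝ} (hθ : 1 < θ) : ∃ C, 0 ≤ C ∧ ∀ σ t : ℝ,
    1 < σ → σ ≤ 2 → ‖expLogDerivXiAt θ (σ + t * Complex.I)‖ ≤ C * (1 + |t|) ^ (-((θ + 1) / 2)) := by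
  set η := (θ + 1) / 2 with hη
  have hη0 : 0 < η := by linarith
  -- With this ε the zeta factor costs |t|^{2θε} = |t|^{(θ-1)/2}; against |t|^{-θ} this leaves the
  -- exponent -(θ+1)/2 < -1.
  obtain ⟨C₁, hC₁⟩ := exists_neg_re_logDeriv_riemannZeta_le (ε := (θ - 1) / (4 * θ))
    (div_pos (by linarith) (by linarith))
  -- The bound on ζ'/ζ needs |t| ≥ 2. For small t compactness is used on a rectangle that includes
  -- Re s = 1 and the point 1, where ξ has no zero.
  have hcpt : IsCompact (Icc (1 : ℝ) 2 ×ℂ Icc (-2 : ℝ) 2) := isCompact_Icc.reProdIm isCompact_Icc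
  obtain ⟨M, hM⟩ := hcpt.exists_bound_of_continuousOn
    ((continuousOn_expLogDerivXiAt θ).mono fun s hs => hs.1.1)
  have hM0 : 0 ≤ M := (norm_nonneg _).trans (hM 1 (by simp [Complex.mem_reProdIm]))
  set A := Real.exp (θ * (Real.log Real.pi + Real.log 2 + 12)) * Real.exp (2 * θ * C₁) with hA
  refine ⟨M * 3 ^ η + A * 2 ^ η, by positivity, fun σ t hσ hσ2 => ?_⟩
  have hre : (σ + t * Complex.I : ℂ).re = σ := by simp
  have him : (σ + t * Complex.I : ℂ).im = t := by simp
  have ht0 : 0 < 1 + |t| := by positivity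
  rw [add_mul]
  rcases le_or_gt |t| 2 with ht | ht
  · have h1 := hM (σ + t * Complex.I) (by
      rw [Complex.mem_reProdIm, hre, him]
      exact ⟨⟨hσ.le, hσ2⟩, abs_le.1 ht⟩)
    have h2 : 1 ≤ 3 ^ η * (1 + |t|) ^ (-η) := by
      rw [Real.rpow_neg ht0.le, ← div_eq_mul_inv, ← Real.div_rpow (by norm_num) ht0.le]
      exact Real.one_le_rpow (by rw [le_div_iff₀ ht0]; linarith) hη0.le
    have h3 : 0 ≤ A * 2 ^ η * (1 + |t|) ^ (-η) := by positivity
    rw [mul_assoc M]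
    exact h1.trans (by nlinarith)
  · have hs1 : 1 < (σ + t * Complex.I : ℂ).re := by rwa [hre]
    have h1 := hC₁ (σ + t * Complex.I) hs1 (by rwa [hre]) (by rw [him]; exact ht.le)
    rw [him] at h1
    have ht1 : 0 < |t| := by linarith
    have h2 : ‖Complex.exp (-2 * θ * logDeriv riemannZeta (σ + t * Complex.I))‖ ≤
        Real.exp (2 * θ * C₁) * |t| ^ ((θ - 1) / 2) := by
      rw [Complex.norm_exp, show (-2 * θ * logDeriv riemannZeta (σ + t * Complex.I) : ℂ) =
        ((-2 * θ : ℝ) : ℂ) * logDeriv riemannZeta (σ + t * Complex.I) by push_cast; rfl,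
        Complex.re_ofReal_mul, Real.rpow_def_of_pos ht1, ← Real.exp_add, Real.exp_le_exp]
      have h3 := mul_le_mul_of_nonneg_left h1 (show 0 ≤ 2 * θ by linarith)
      have e : 2 * θ * ((θ - 1) / (4 * θ) * Real.log |t| + C₁) =
          2 * θ * C₁ + Real.log |t| * ((θ - 1) / 2) := by
        have : θ ≠ 0 := by linarith
        field_simp
        ring
      linarith
    have h4 : ‖(σ + t * Complex.I : ℂ)‖ ^ (-θ) ≤ |t| ^ (-θ) := by
      refine Real.rpow_le_rpow_of_nonpos ht1 ?_ (by linarith)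
      simpa using Complex.abs_im_le_norm (σ + t * Complex.I : ℂ)
    have h5 := norm_archimedeanFactor_le (θ := θ) (by linarith) hs1
    have h6 : |t| ^ (-θ) * |t| ^ ((θ - 1) / 2) = |t| ^ (-η) := by
      rw [← Real.rpow_add ht1, hη]; congr 1; ring
    have h7 : |t| ^ (-η) ≤ 2 ^ η * (1 + |t|) ^ (-η) := by
      rw [Real.rpow_neg ht0.le, ← div_eq_mul_inv, ← Real.div_rpow (by norm_num) ht0.le,
        Real.rpow_neg ht1.le, ← Real.inv_rpow ht1.le]
      refine Real.rpow_le_rpow (by positivity) ?_ hη0.le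
      rw [inv_eq_one_div, div_le_div_iff₀ ht1 ht0]
      linarith
    rw [expLogDerivXiAt_eq θ hs1, norm_mul]
    calc _ ≤ Real.exp (θ * (Real.log Real.pi + Real.log 2 + 12)) * |t| ^ (-θ) *
          (Real.exp (2 * θ * C₁) * |t| ^ ((θ - 1) / 2)) :=
          mul_le_mul (h5.trans (mul_le_mul_of_nonneg_left h4 (Real.exp_pos _).le)) h2
            (norm_nonneg _) (by positivity)
      _ = A * |t| ^ (-η) := by rw [← h6, hA]; ring
      _ ≤ A * (2 ^ η * (1 + |t|) ^ (-η)) := mul_le_mul_of_nonneg_left h7 (by positivity)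
      _ ≤ _ := by
        have : 0 ≤ M * 3 ^ η * (1 + |t|) ^ (-η) := by positivity
        linarith

end

/-! ### The kernel: growth, support and the Fourier formula -/

section

open MeasureTheory Filter Set Topology

theorem integrable_expLogDerivXiAt {θ σ : ℝ} (hθ : 1 < θ) (hσ : 1 < σ) :
    Integrable fun t : ℝ => expLogDerivXiAt θ (σ + t * Complex.I) := by
  rcases le_or_gt σ 2 with h2 | h2
  · obtain ⟨C, -, hC⟩ := exists_norm_expLogDerivXiAt_le hθ
    have h1 : Integrable fun t : ℝ => C * (1 + ‖t‖) ^ (-((θ + 1) / 2)) :=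
      (integrable_one_add_norm (by rw [Module.finrank_self, Nat.cast_one]; linarith)).const_mul _
    exact h1.mono' (continuous_vertical (differentiableOn_expLogDerivXiAt θ) hσ).aestronglyMeasurable
      (Eventually.of_forall fun t => hC σ t hσ h2)
  · obtain ⟨B, hB⟩ := exists_laplaceDecay_expLogDerivXiAt (by linarith : 0 ≤ θ)
    exact hB.integrable hθ h2.le

/-- The inverse Laplace transform of `exp (-2θ ξ'/ξ)`, up to the factor `2π`. -/
noncomputable def xiLaplaceKernel (θ : ℝ) (y : ℝ) : ℂ :=
  verticalIntegral 2 (expLogDerivXiAt θ) y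

theorem verticalIntegral_expLogDerivXiAt {θ σ : ℝ} (hθ : 1 < θ) (hσ : 1 < σ) (y : ℝ) :
    verticalIntegral σ (expLogDerivXiAt θ) y = xiLaplaceKernel θ y := by
  obtain ⟨B, hB⟩ := exists_laplaceDecay_expLogDerivXiAt (by linarith : 0 ≤ θ)
  rcases le_or_gt σ 2 with h2 | h2
  · obtain ⟨C, hC0, hC⟩ := exists_norm_expLogDerivXiAt_le hθ
    have hint : ∀ c : ℝ, 1 < c → Integrable fun t : ℝ =>
        expLogDerivXiAt θ (c + t * Complex.I) * Complex.exp ((c + t * Complex.I) * y) := fun c hc =>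
      (integrable_expLogDerivXiAt hθ hc).mul_bdd (c := Real.exp (c * y))
        (Continuous.aestronglyMeasurable (by fun_prop))
        (Eventually.of_forall fun t => (norm_exp_vertical c t y).le)
    refine integral_vertical_eq (G := fun s => expLogDerivXiAt θ s * Complex.exp (s * y)) (b := 2)
      (B := C * max (Real.exp (2 * y)) (Real.exp (σ * y))) (θ := (θ + 1) / 2) h2 (by linarith) ?_ ?_
      (hint σ hσ) (hint 2 one_lt_two)
    · exact ((differentiableOn_expLogDerivXiAt θ).mono fun s hs =>
        show 1 < s.re from lt_of_lt_of_le hσ hs).mul (Differentiable.differentiableOn (by fun_prop))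
    · intro x t hx hx2 ht
      rw [norm_mul, norm_exp_vertical, mul_right_comm]
      refine mul_le_mul ((hC x t (by linarith) hx2).trans ?_) ?_ (Real.exp_pos _).le (by positivity)
      · exact mul_le_mul_of_nonneg_left
          (Real.rpow_le_rpow_of_nonpos (by linarith) (by linarith) (by linarith)) hC0
      · rcases le_total 0 y with hy | hy
        · exact le_max_of_le_left (Real.exp_le_exp.2 (by nlinarith))
        · exact le_max_of_le_right (Real.exp_le_exp.2 (by nlinarith))
  · exact (hB.verticalIntegral_eq hθ h2.le y).symm

/-- The majorant of the integrand is uniform in 1 < σ ≤ 2, so the factor e^{σy} can be improved to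
e^y by letting σ → 1+. -/
theorem exists_norm_xiLaplaceKernel_le {θ : ℝ} (hθ : 1 < θ) :
    ∃ C, 0 ≤ C ∧ ∀ y, ‖xiLaplaceKernel θ y‖ ≤ C * Real.exp y := by
  obtain ⟨C, hC0, hC⟩ := exists_norm_expLogDerivXiAt_le hθ
  have h1 : Integrable fun t : ℝ => C * (1 + ‖t‖) ^ (-((θ + 1) / 2)) :=
    (integrable_one_add_norm (by rw [Module.finrank_self, Nat.cast_one]; linarith)).const_mul _
  refine ⟨∫ t : ℝ, C * (1 + ‖t‖) ^ (-((θ + 1) / 2)), integral_nonneg fun t => by positivity,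
    fun y => ?_⟩
  have hle : ∀ᶠ σ : ℝ in 𝓝[>] 1, ‖xiLaplaceKernel θ y‖ ≤
      (∫ t : ℝ, C * (1 + ‖t‖) ^ (-((θ + 1) / 2))) * Real.exp (σ * y) := by
    filter_upwards [Ioo_mem_nhdsGT one_lt_two] with σ hσ
    rw [← verticalIntegral_expLogDerivXiAt hθ hσ.1, ← integral_mul_const]
    refine norm_integral_le_of_norm_le (h1.mul_const _) (Eventually.of_forall fun t => ?_)
    rw [norm_mul, norm_exp_vertical]
    exact mul_le_mul_of_nonneg_right (hC σ t hσ.1 hσ.2.le) (Real.exp_pos _).le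
  have hlim : Tendsto (fun σ : ℝ => (∫ t : ℝ, C * (1 + ‖t‖) ^ (-((θ + 1) / 2))) * Real.exp (σ * y))
      (𝓝[>] 1) (𝓝 ((∫ t : ℝ, C * (1 + ‖t‖) ^ (-((θ + 1) / 2))) * Real.exp (1 * y))) :=
    (Continuous.tendsto (by fun_prop) 1).mono_left nhdsWithin_le_nhds
  rw [one_mul] at hlim
  exact ge_of_tendsto hlim hle

theorem xiLaplaceKernel_eq_zero {θ : ℝ} (hθ : 1 < θ) {y : ℝ} (hy : y ≤ 0) :
    xiLaplaceKernel θ y = 0 := by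
  obtain ⟨B, hB⟩ := exists_laplaceDecay_expLogDerivXiAt (by linarith : 0 ≤ θ)
  exact hB.verticalIntegral_eq_zero hθ hy

theorem continuous_xiLaplaceKernel {θ : ℝ} (hθ : 1 < θ) : Continuous (xiLaplaceKernel θ) := by
  obtain ⟨B, hB⟩ := exists_laplaceDecay_expLogDerivXiAt (by linarith : 0 ≤ θ)
  exact hB.continuous_verticalIntegral hθ

theorem ofReal_re_xiLaplaceKernel (θ y : ℝ) :
    ((xiLaplaceKernel θ y).re : ℂ) = xiLaplaceKernel θ y :=
  Complex.conj_eq_iff_re.1 (verticalIntegral_conj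
    (fun s hs => expLogDerivXiAt_conj θ (by rw [hs]; exact one_lt_two)) y)

/-- The kernel `K_θ`. -/
noncomputable def xiKernel (θ : ℝ) (x : ℝ) : ℝ :=
  (2 * Real.pi)⁻¹ * Real.exp (-(x / 2)) * (xiLaplaceKernel θ x).re

theorem continuous_xiKernel {θ : ℝ} (hθ : 1 < θ) : Continuous (xiKernel θ) := by
  have := continuous_xiLaplaceKernel hθ
  unfold xiKernel
  fun_prop

theorem xiKernel_eq_zero {θ : ℝ} (hθ : 1 < θ) {x : ℝ} (hx : x < 0) : xiKernel θ x = 0 := by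
  rw [xiKernel, xiLaplaceKernel_eq_zero hθ hx.le, Complex.zero_re, mul_zero]

theorem isBigO_xiKernel {θ : ℝ} (hθ : 1 < θ) :
    xiKernel θ =O[atTop] fun x => Real.exp (x / 2) := by
  obtain ⟨C, hC0, hC⟩ := exists_norm_xiLaplaceKernel_le hθ
  refine Asymptotics.IsBigO.of_bound ((2 * Real.pi)⁻¹ * C) (Eventually.of_forall fun x => ?_)
  have h1 : ‖(xiLaplaceKernel θ x).re‖ ≤ C * Real.exp x :=
    (Complex.abs_re_le_norm _).trans (hC x)
  rw [xiKernel, norm_mul, norm_mul, Real.norm_of_nonneg (by positivity : 0 ≤ (2 * Real.pi)⁻¹),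
    Real.norm_of_nonneg (Real.exp_pos _).le, Real.norm_of_nonneg (Real.exp_pos _).le]
  calc _ ≤ (2 * Real.pi)⁻¹ * Real.exp (-(x / 2)) * (C * Real.exp x) := by gcongr
    _ = (2 * Real.pi)⁻¹ * C * (Real.exp (-(x / 2)) * Real.exp x) := by ring
    _ = _ := by rw [← Real.exp_add]; congr 2; ring

theorem fourierFormulaAt_xiKernel {θ : ℝ} (hθ : 1 < θ) {z : ℂ} (hz : 1 / 2 < z.im) :
    FourierFormulaAt θ (fun x => (xiKernel θ x : ℂ)) z := by
  set σ := 1 / 2 + z.im with hσ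
  have hσ1 : 1 < σ := by linarith
  -- Since e^{izx} = e^{x/2} e^{-sx}, the factor e^{-x/2} in the kernel cancels, and the line Im z =
  -- σ - 1/2 corresponds to Re s = σ.
  have hs : (1 / 2 - Complex.I * z : ℂ) = σ + (-z.re : ℝ) * Complex.I := by
    apply Complex.ext <;> simp [hσ]
  set φ : ℝ → ℂ := fun t => expLogDerivXiAt θ (σ + t * Complex.I) with hφ
  set ψ : ℝ → ℂ := fun y => xiLaplaceKernel θ y * Complex.exp (-(σ * y)) with hψ
  have hψφ : ∀ y : ℝ, ψ y = ∫ t : ℝ, φ t * Complex.exp (Complex.I * t * y) := fun y => by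
    simp only [hψ]
    rw [← verticalIntegral_expLogDerivXiAt hθ hσ1, verticalIntegral, ← integral_mul_const]
    refine integral_congr_ae (Eventually.of_forall fun t => ?_)
    simp only [hφ]
    rw [mul_assoc, ← Complex.exp_add]
    congr 2
    ring
  have hψi : Integrable ψ := by
    obtain ⟨C, hC0, hC⟩ := exists_norm_xiLaplaceKernel_le hθ
    have hb : Integrable ((Ioi (0 : ℝ)).indicator fun y => C * Real.exp (-(σ - 1) * y)) :=
      (integrable_indicator_iff measurableSet_Ioi).2
        ((exp_neg_integrableOn_Ioi 0 (show 0 < σ - 1 by linarith)).const_mul C)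
    refine hb.mono' (Continuous.aestronglyMeasurable ?_) (Eventually.of_forall fun y => ?_)
    · have := continuous_xiLaplaceKernel hθ
      fun_prop
    · rcases le_or_gt y 0 with hy | hy
      · rw [indicator_of_notMem (show y ∉ Ioi (0 : ℝ) from not_lt.2 hy)]
        simp only [hψ]
        rw [xiLaplaceKernel_eq_zero hθ hy, zero_mul, norm_zero]
      · rw [indicator_of_mem (show y ∈ Ioi (0 : ℝ) from hy)]
        simp only [hψ]
        rw [norm_mul, Complex.norm_exp]
        have e : (-(σ * y : ℂ)).re = -(σ * y) := by simp
        rw [e]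
        calc _ ≤ C * Real.exp y * Real.exp (-(σ * y)) := by gcongr; exact hC y
          _ = _ := by rw [mul_assoc, ← Real.exp_add]; congr 2; ring
  have hinv := integral_mul_exp_of_eq_integral_mul_exp
    (continuous_vertical (differentiableOn_expLogDerivXiAt θ) hσ1)
    (integrable_expLogDerivXiAt hθ hσ1) hψφ hψi (-z.re)
  have e : ∀ x : ℝ, (xiKernel θ x : ℂ) * Complex.exp (Complex.I * z * x) =
      (2 * Real.pi)⁻¹ * (ψ x * Complex.exp (-Complex.I * x * (-z.re : ℝ))) := fun x => by
    have h1 : Complex.exp (-(x / 2)) * Complex.exp (Complex.I * z * x) =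
        Complex.exp (-(σ * x)) * Complex.exp (-Complex.I * x * (-z.re : ℝ)) := by
      rw [← Complex.exp_add, ← Complex.exp_add]
      congr 1
      linear_combination (-x : ℂ) * hs
    simp only [xiKernel, hψ]
    push_cast at h1 ⊢
    rw [ofReal_re_xiLaplaceKernel]
    linear_combination (2 * (Real.pi : ℂ))⁻¹ * xiLaplaceKernel θ x * h1
  have hbi : Integrable fun x : ℝ => ψ x * Complex.exp (-Complex.I * x * (-z.re : ℝ)) := by
    refine hψi.mul_bdd (c := 1) (Continuous.aestronglyMeasurable (by fun_prop))
      (Eventually.of_forall fun x => ?_)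
    rw [Complex.norm_exp]
    simp
  have hπ : (2 * Real.pi : ℂ) ≠ 0 := by exact_mod_cast (by positivity : 2 * Real.pi ≠ 0)
  refine ⟨?_, ?_⟩
  · simp_rw [e]
    exact hbi.const_mul _
  · simp_rw [e]
    rw [integral_const_mul, hinv, Complex.ofReal_inv, Complex.ofReal_mul, Complex.ofReal_ofNat,
      inv_mul_cancel_left₀ hπ, expLogDerivXi, hs]
    rfl

end

/-! ### Expansion into translates and the derivative of the archimedean kernel -/

section

open MeasureTheory Filter Set Topology

theorem expLogDerivCoeff_zero (θ : ℝ) : expLogDerivCoeff θ 0 = 0 := by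
  simp [expLogDerivCoeff]

theorem archimedeanKernel_eq_zero {θ : ℝ} (hθ : 1 < θ) {y : ℝ} (hy : y ≤ 0) :
    archimedeanKernel θ y = 0 :=
  (laplaceDecay_archimedeanFactor (by linarith)).verticalIntegral_eq_zero hθ hy

/-- The kernel as a superposition of translates of the archimedean kernel. -/
theorem hasSum_archimedeanKernel {θ : ℝ} (hθ : 1 < θ) (x : ℝ) :
    HasSum (fun n : ℕ => (expLogDerivCoeff θ n : ℂ) * archimedeanKernel θ (x - Real.log n))
      (xiLaplaceKernel θ x) := by
  have hθ0 : 0 ≤ θ := by linarith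
  set a : ℕ → ℂ := fun n => (expLogDerivCoeff θ n : ℂ) with ha
  have hg := laplaceDecay_archimedeanFactor hθ0
  set s : ℝ → ℂ := fun t => (2 : ℝ) + t * Complex.I with hs
  have hsre : ∀ t, (s t).re = 2 := fun t => by simp [hs]
  set F : ℕ → ℝ → ℂ := fun n t => LSeries.term a (s t) n *
    (archimedeanFactor θ (s t) * Complex.exp (s t * x)) with hF
  have hnorm : ∀ n t, ‖LSeries.term a (s t) n‖ = ‖LSeries.term a 2 n‖ := fun n t => by
    rw [LSeries.norm_term_eq, LSeries.norm_term_eq, hsre]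
    simp
  have hint := hg.integrable_mul_exp hθ le_rfl x
  have hterm : ∀ n, Continuous fun t => LSeries.term a (s t) n := fun n => by
    rcases eq_or_ne n 0 with rfl | hn
    · simpa using continuous_const
    · have hnC : (n : ℂ) ≠ 0 := by exact_mod_cast hn
      simp only [LSeries.term_of_ne_zero hn, hs]
      refine continuous_const.div ?_ fun t => by rw [Ne, Complex.cpow_eq_zero_iff]; tauto
      exact Continuous.const_cpow (by fun_prop) (Or.inl hnC)
  have hFi : ∀ n, Integrable (F n) := fun n =>
    hint.bdd_mul (c := ‖LSeries.term a 2 n‖) (hterm n).aestronglyMeasurable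
      (Eventually.of_forall fun t => (hnorm n t).le)
  -- On Re s = 2 the modulus of each Dirichlet term does not depend on t, so absolute convergence of
  -- the series at 2 justifies termwise integration.
  have hFs : Summable fun n => ∫ t, ‖F n t‖ := by
    simp only [hF, norm_mul, hnorm, integral_const_mul]
    exact ((lSeriesHasSum_expLogDerivCoeff hθ0 (s := 2) (by simp)).summable.norm).mul_right _
  have h := hasSum_integral_of_summable_integral_norm hFi hFs
  have e1 : ∫ t, ∑' n, F n t = xiLaplaceKernel θ x := by
    refine integral_congr_ae (Eventually.of_forall fun t => ?_)
    have hs1 : 1 < (s t).re := by rw [hsre]; exact one_lt_two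
    simp only [hF]
    rw [tsum_mul_right, (lSeriesHasSum_expLogDerivCoeff hθ0 hs1).tsum_eq,
      expLogDerivXiAt_eq θ hs1]
    ring
  rw [e1] at h
  refine h.congr_fun fun n => ?_
  rcases eq_or_ne n 0 with rfl | hn
  · simp [hF, expLogDerivCoeff_zero]
  · rw [archimedeanKernel, verticalIntegral, ← integral_const_mul]
    refine integral_congr_ae (Eventually.of_forall fun t => ?_)
    have hnC : (n : ℂ) ≠ 0 := by exact_mod_cast hn
    simp only [hF, LSeries.term_of_ne_zero hn, ha]
    rw [Complex.cpow_def_of_ne_zero hnC, div_eq_mul_inv, ← Complex.exp_neg]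
    have e : Complex.exp (s t * (x - Real.log n : ℝ)) =
        Complex.exp (-(Complex.log n * s t)) * Complex.exp (s t * x) := by
      rw [← Complex.exp_add]
      congr 1
      push_cast
      ring
    rw [e]
    ring

/-- The archimedean kernel vanishes on y ≤ 0, which removes every n with log n > x. The index 0
drops out because its coefficient is 0. -/
theorem xiLaplaceKernel_eq_sum {θ : ℝ} (hθ : 1 < θ) {x : ℝ} {N : ℕ} (hx : x < Real.log (N + 1)) :
    xiLaplaceKernel θ x = ∑ n ∈ Finset.Ico 1 (N + 1),
      (expLogDerivCoeff θ n : ℂ) * archimedeanKernel θ (x - Real.log n) := by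
  refine (hasSum_archimedeanKernel hθ x).unique (hasSum_sum_of_ne_finset_zero fun n hn => ?_)
  rcases Nat.eq_zero_or_pos n with rfl | hn0
  · rw [expLogDerivCoeff_zero, Complex.ofReal_zero, zero_mul]
  · have hN : N + 1 ≤ n := by
      by_contra h
      exact hn (Finset.mem_Ico.2 ⟨hn0, not_le.1 h⟩)
    have : Real.log (N + 1) ≤ Real.log n := Real.log_le_log (by positivity) (by exact_mod_cast hN)
    rw [archimedeanKernel_eq_zero hθ (by linarith), mul_zero]

/-- The derivative of the archimedean kernel away from the origin. -/
noncomputable def archimedeanKernelDeriv (θ : ℝ) (y : ℝ) : ℂ :=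
  -(verticalIntegral 2 (fun s => s * deriv (archimedeanFactor θ) s) y + archimedeanKernel θ y) / y

theorem hasDerivAt_archimedeanKernel {θ : ℝ} (hθ : 1 < θ) {y : ℝ} (hy : y ≠ 0) :
    HasDerivAt (archimedeanKernel θ) (archimedeanKernelDeriv θ y) y :=
  (laplaceDecay_archimedeanFactor (by linarith)).hasDerivAt_verticalIntegral
    (laplaceDecay_id_mul_deriv_archimedeanFactor (by linarith)) hθ hy

theorem contDiffAt_archimedeanKernel {θ : ℝ} (hθ : 1 < θ) {y : ℝ} (hy : y ≠ 0) :
    ContDiffAt ℝ 1 (archimedeanKernel θ) y := by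
  have ho : IsOpen {y : ℝ | y ≠ 0} := isOpen_ne
  have hc1 := (laplaceDecay_archimedeanFactor (θ := θ) (by linarith)).continuous_verticalIntegral hθ
  have hc2 := (laplaceDecay_id_mul_deriv_archimedeanFactor (θ := θ)
    (by linarith)).continuous_verticalIntegral hθ
  have h : ContDiffOn ℝ 1 (archimedeanKernel θ) {y | y ≠ 0} := by
    refine (contDiffOn_succ_iff_deriv_of_isOpen (n := 0) ho).2
      ⟨fun y hy => (hasDerivAt_archimedeanKernel hθ hy).differentiableAt.differentiableWithinAt,
        by simp, contDiffOn_zero.2 ?_⟩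
    refine ContinuousOn.congr (f := archimedeanKernelDeriv θ) ?_
      fun y hy => (hasDerivAt_archimedeanKernel hθ hy).deriv
    refine ((hc2.add hc1).neg.continuousOn).div (by fun_prop) fun y hy => ?_
    exact_mod_cast hy
  exact h.contDiffAt (ho.mem_nhds hy)

/-- Both vertical integrals in the numerator are O(y^{θ-1}) as y → 0+. Division by y leaves y^{θ-2},
integrable at 0 because θ > 1. -/
theorem locallyIntegrable_archimedeanKernelDeriv {θ : ℝ} (hθ : 1 < θ) :
    LocallyIntegrable (archimedeanKernelDeriv θ) := by
  have hd1 := laplaceDecay_archimedeanFactor (θ := θ) (by linarith)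
  have hd2 := laplaceDecay_id_mul_deriv_archimedeanFactor (θ := θ) (by linarith)
  have hc := (hd2.continuous_verticalIntegral hθ).add (hd1.continuous_verticalIntegral hθ)
  set V : ℝ → ℂ := fun y => verticalIntegral 2 (fun s => s * deriv (archimedeanFactor θ) s) y +
    archimedeanKernel θ y with hV
  have hVc : Continuous V := hc
  have hmeas : Measurable (archimedeanKernelDeriv θ) :=
    hVc.neg.measurable.div Complex.continuous_ofReal.measurable
  obtain ⟨C₁, hC₁, hb₁⟩ := hd1.exists_norm_verticalIntegral_le hθ
  obtain ⟨C₂, hC₂, hb₂⟩ := hd2.exists_norm_verticalIntegral_le hθ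
  have hI : ∀ R : ℝ, 0 < R → IntegrableOn (archimedeanKernelDeriv θ) (Icc (-R) R) := by
    intro R hR
    obtain ⟨M, hM⟩ := isCompact_Icc.exists_bound_of_continuousOn (s := Icc (0 : ℝ) R) hVc.continuousOn
    have hM0 : 0 ≤ M := (norm_nonneg _).trans (hM 0 ⟨le_rfl, hR.le⟩)
    -- C₂ + C₁ serves for y ≤ 1/2; beyond that (2y)^{θ-1} ≥ 1 lets the compactness bound M be
    -- absorbed.
    set C := C₂ + C₁ + M * 2 ^ (θ - 1) with hC
    have hVb : ∀ y, 0 < y → y ≤ R → ‖V y‖ ≤ C * y ^ (θ - 1) := by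
      intro y hy hyR
      rw [hC, add_mul]
      rcases le_or_gt y (1 / 2) with h | h
      · have h1 : ‖V y‖ ≤ (C₂ + C₁) * y ^ (θ - 1) := by
          rw [add_mul]
          exact (norm_add_le _ _).trans (add_le_add (hb₂ y hy h) (hb₁ y hy h))
        have h2 : 0 ≤ M * 2 ^ (θ - 1) * y ^ (θ - 1) := by positivity
        linarith
      · have h1 : 1 ≤ 2 ^ (θ - 1) * y ^ (θ - 1) := by
          rw [← Real.mul_rpow (by norm_num) hy.le]
          exact Real.one_le_rpow (by linarith) (by linarith)
        have h2 : 0 ≤ (C₂ + C₁) * y ^ (θ - 1) := by positivity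
        rw [mul_assoc M]
        have h3 := hM y ⟨hy.le, hyR⟩
        nlinarith
    have hpow : IntegrableOn (fun y : ℝ => C * y ^ (θ - 2)) (Ioc 0 R) :=
      ((intervalIntegral.intervalIntegrable_rpow' (a := 0) (b := R) (by linarith)).1).const_mul C
    have hsub : Icc (-R) R ⊆ Iic 0 ∪ Ioc 0 R := fun y hy => by
      rcases le_or_gt y 0 with h | h
      · exact Or.inl h
      · exact Or.inr ⟨h, hy.2⟩
    refine IntegrableOn.mono_set (IntegrableOn.union ?_ ?_) hsub
    · refine integrableOn_zero.congr_fun (fun y hy => ?_) measurableSet_Iic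
      have : V y = 0 := by
        simp only [hV]
        rw [archimedeanKernel_eq_zero hθ hy, hd2.verticalIntegral_eq_zero hθ hy, add_zero]
      rw [archimedeanKernelDeriv]
      change 0 = -V y / y
      rw [this, neg_zero, zero_div]
    · refine hpow.mono' hmeas.aestronglyMeasurable ?_
      filter_upwards [ae_restrict_mem measurableSet_Ioc] with y hy
      change ‖-V y / y‖ ≤ _
      rw [norm_div, norm_neg, Complex.norm_real, Real.norm_of_nonneg hy.1.le, div_le_iff₀ hy.1,
        mul_assoc, ← Real.rpow_add_one hy.1.ne']
      refine (hVb y hy.1 hy.2).trans_eq ?_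
      congr 2
      ring
  refine (locallyIntegrable_iff).2 fun k hk => ?_
  obtain ⟨R, hR⟩ := hk.isBounded.subset_closedBall 0
  rw [Real.closedBall_eq_Icc, zero_sub, zero_add] at hR
  refine (hI (max R 1) (by positivity)).mono_set (hR.trans (Icc_subset_Icc ?_ (le_max_left _ _)))
  exact neg_le_neg (le_max_left _ _)

end

/-! ### Regularity of the kernel -/

section

open MeasureTheory Filter Set Topology

theorem exists_lt_log_natCast_add_one (x : ℝ) : ∃ N : ℕ, x < Real.log (N + 1) := by
  obtain ⟨N, hN⟩ := exists_nat_gt (Real.exp x)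
  exact ⟨N, (Real.lt_log_iff_exp_lt (by positivity)).2 (hN.trans (lt_add_one _))⟩

theorem sub_log_ne_zero {x : ℝ} (hx : x ∈ {x : ℝ | ∃ n : ℕ, 1 ≤ n ∧ x = Real.log n}ᶜ) {n : ℕ}
    (hn : 1 ≤ n) : x - Real.log n ≠ 0 := fun h => hx ⟨n, hn, sub_eq_zero.1 h⟩

/-- Near x the kernel is a smooth factor times the real part of a finite sum of translates, each
singular only at some log n. -/
theorem contDiffAt_xiKernel {θ : ℝ} (hθ : 1 < θ) {x : ℝ}
    (hx : x ∈ {x : ℝ | ∃ n : ℕ, 1 ≤ n ∧ x = Real.log n}ᶜ) : ContDiffAt ℝ 1 (xiKernel θ) x := by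
  obtain ⟨N, hN⟩ := exists_lt_log_natCast_add_one x
  have hev : xiLaplaceKernel θ =ᶠ[𝓝 x] fun y => ∑ n ∈ Finset.Ico 1 (N + 1),
      (expLogDerivCoeff θ n : ℂ) * archimedeanKernel θ (y - Real.log n) := by
    filter_upwards [isOpen_Iio.mem_nhds hN] with y hy using xiLaplaceKernel_eq_sum hθ hy
  have h1 : ContDiffAt ℝ 1 (xiLaplaceKernel θ) x := by
    refine ContDiffAt.congr_of_eventuallyEq (ContDiffAt.sum fun n hn => ?_) hev
    have h := contDiffAt_archimedeanKernel hθ (sub_log_ne_zero hx (Finset.mem_Ico.1 hn).1)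
    exact contDiffAt_const.mul (h.comp x (contDiffAt_id.sub contDiffAt_const))
  have h2 : ContDiffAt ℝ 1 (fun y => (xiLaplaceKernel θ y).re) x :=
    Complex.reCLM.contDiff.contDiffAt.comp x h1
  have h3 : ContDiff ℝ 1 fun y : ℝ => (2 * Real.pi)⁻¹ * Real.exp (-(y / 2)) := by fun_prop
  exact h3.contDiffAt.mul h2

theorem deriv_xiKernel {θ : ℝ} (hθ : 1 < θ) {x : ℝ}
    (hx : x ∈ {x : ℝ | ∃ n : ℕ, 1 ≤ n ∧ x = Real.log n}ᶜ) {N : ℕ} (hN : x < Real.log (N + 1)) :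
    deriv (xiKernel θ) x = (2 * Real.pi)⁻¹ * Real.exp (-(x / 2)) *
      (∑ n ∈ Finset.Ico 1 (N + 1),
        (expLogDerivCoeff θ n : ℂ) * archimedeanKernelDeriv θ (x - Real.log n)).re -
      xiKernel θ x / 2 := by
  have hev : xiLaplaceKernel θ =ᶠ[𝓝 x] fun y => ∑ n ∈ Finset.Ico 1 (N + 1),
      (expLogDerivCoeff θ n : ℂ) * archimedeanKernel θ (y - Real.log n) := by
    filter_upwards [isOpen_Iio.mem_nhds hN] with y hy using xiLaplaceKernel_eq_sum hθ hy
  have h1 : HasDerivAt (xiLaplaceKernel θ) (∑ n ∈ Finset.Ico 1 (N + 1),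
      (expLogDerivCoeff θ n : ℂ) * archimedeanKernelDeriv θ (x - Real.log n)) x := by
    refine HasDerivAt.congr_of_eventuallyEq (HasDerivAt.fun_sum fun n hn => ?_) hev
    have h := hasDerivAt_archimedeanKernel hθ (sub_log_ne_zero hx (Finset.mem_Ico.1 hn).1)
    exact (h.comp_sub_const x _).const_mul _
  have h2 := Complex.reCLM.hasFDerivAt.comp_hasDerivAt x h1
  have h3 : HasDerivAt (fun y : ℝ => (2 * Real.pi)⁻¹ * Real.exp (-(y / 2)))
      ((2 * Real.pi)⁻¹ * (Real.exp (-(x / 2)) * (-(1 / 2)))) x :=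
    (((hasDerivAt_id x).div_const 2).neg.exp).const_mul _
  have h4 : HasDerivAt (xiKernel θ) _ x := h3.mul h2
  rw [h4.deriv]
  simp only [Complex.reCLM_apply, xiKernel]
  ring

theorem MeasureTheory.LocallyIntegrable.integrableOn_comp_sub_const {f : ℝ → ℂ}
    (hf : LocallyIntegrable f) (c : ℝ) {k : Set ℝ} (hk : IsCompact k) :
    IntegrableOn (fun x => f (x - c)) k := by
  have h := ((measurePreserving_sub_right volume c).integrableOn_comp_preimage
    (MeasurableEquiv.subRight c).measurableEmbedding (f := f) (s := (fun x => x - c) '' k)).2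
    ((locallyIntegrable_iff.1 hf) _ (hk.image (by fun_prop)))
  rwa [preimage_image_eq _ (sub_left_injective)] at h

theorem locallyIntegrable_deriv_xiKernel {θ : ℝ} (hθ : 1 < θ) :
    LocallyIntegrable (deriv (xiKernel θ)) := by
  refine locallyIntegrable_iff.2 fun k hk => ?_
  obtain ⟨R, hR⟩ := hk.bddAbove
  obtain ⟨N, hN⟩ := exists_lt_log_natCast_add_one R
  -- The points log n form a countable set, so whatever value `deriv` takes there does not affect
  -- integrability.
  have hcount : {x : ℝ | ∃ n : ℕ, 1 ≤ n ∧ x = Real.log n}.Countable := by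
    refine (countable_range fun n : ℕ => Real.log n).mono ?_
    rintro x ⟨n, -, rfl⟩
    exact ⟨n, rfl⟩
  have hsum : IntegrableOn (fun x : ℝ => ∑ n ∈ Finset.Ico 1 (N + 1),
      (expLogDerivCoeff θ n : ℂ) * archimedeanKernelDeriv θ (x - Real.log n)) k :=
    integrable_finsetSum _ fun n _ =>
      ((locallyIntegrable_archimedeanKernelDeriv hθ).integrableOn_comp_sub_const _ hk).const_mul _
  have hre : IntegrableOn (fun x : ℝ => (∑ n ∈ Finset.Ico 1 (N + 1),
      (expLogDerivCoeff θ n : ℂ) * archimedeanKernelDeriv θ (x - Real.log n)).re) k :=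
    Complex.reCLM.integrable_comp hsum
  have hmul := hre.continuousOn_mul
    (g := fun x : ℝ => (2 * Real.pi)⁻¹ * Real.exp (-(x / 2))) (by fun_prop) hk
  have hK : IntegrableOn (fun x => xiKernel θ x / 2) k :=
    ((continuous_xiKernel hθ).div_const 2).continuousOn.integrableOn_compact hk
  refine (hmul.sub hK).congr ?_
  filter_upwards [ae_restrict_mem hk.measurableSet,
    ae_restrict_of_ae (hcount.ae_notMem volume)] with x hxk hx
  exact (deriv_xiKernel hθ hx ((hR hxk).trans_lt hN)).symm

end

theorem theorem2 (θ : ℝ) (hθ : 1 < θ) :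
    ∃ K : ℝ → ℝ,
      -- `K` is the only function with the Fourier formula, even if only on one horizontal line
      (∀ (c : ℝ) (F : ℝ → ℂ), 1 / 2 < c → (∀ z : ℂ, z.im = c → FourierFormulaAt θ F z) →
        F =ᵐ[volume] fun x => (K x : ℂ)) ∧
      -- (K-ii)
      (Continuous K ∧ K =O[atTop] (fun x => Real.exp (x / 2)) ∧
        ∀ z : ℂ, 1 / 2 < z.im → FourierFormulaAt θ (fun x => (K x : ℂ)) z) ∧
      -- (K-iii)
      (∀ x < 0, K x = 0) ∧
      -- (K-iv)
      (ContDiffOn ℝ 1 K {x : ℝ | ∃ n : ℕ, 1 ≤ n ∧ x = Real.log n}ᶜ ∧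
        LocallyIntegrable (deriv K) volume) ∧
      -- (K-v)
      (∃ τ : EReal, 0 < τ ∧ ∀ t : ℝ, 0 ≤ t → (t : EReal) < τ →
        ∃ A : L2Iic t →L[ℂ] L2Iic t,
          IsIntegralOperator A (fun x y => (K (x + y) : ℂ)) ∧
          (∃ d : ℂ, HasFredholmDet A d ∧ d ≠ 0) ∧
          (∃ d : ℂ, HasFredholmDet (-A) d ∧ d ≠ 0)) := by
  refine ⟨xiKernel θ, fun c F hc hF => ?_, ⟨continuous_xiKernel hθ, isBigO_xiKernel hθ,
    fun z hz => fourierFormulaAt_xiKernel hθ hz⟩, fun x hx => xiKernel_eq_zero hθ hx,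
    ⟨fun x hx => (contDiffAt_xiKernel hθ hx).contDiffWithinAt, locallyIntegrable_deriv_xiKernel hθ⟩,
    exists_fredholmDet_ne_zero (continuous_xiKernel hθ) fun x hx => xiKernel_eq_zero hθ hx⟩
  exact FourierFormulaAt.ae_eq hF fun z hz => fourierFormulaAt_xiKernel hθ (by rw [hz]; exact hc)
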